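/- **Theorem (asymptotic optimality with non-uniform control cost).** Let $M\ge 2$, let $\mathcal U$ (controls) and $\mathcal Y$ (observations) be finite sets with $\mathcal U\neq\emptyset$, let $y_0\in\mathcal Y$, and for every hypothesis $i\in\{0,\dots,M-1\}$ and $u\in\mathcal U$ let $p_i^u(y\mid\tilde y)>0$ ($y,\tilde y\in\mathcal Y$) be strictly positive transition probabilities on $\mathcal Y$. Assume that the hypotheses are distinct: for $i\ne j$ there are $u,\tilde y$ with $p_i^u(\cdot\mid\tilde y)\neq p_j^u(\cdot\mid\tilde y)$. Let $c:\mathcal U\to(0,\infty)$ be a cost function. A *sequential test* $(\phi,N,\delta)$ consists of a causal randomized control policy $\phi=\{q_k(u_k\mid y^{k-1},u^{k-1})\}_{k\ge1}$, a stopping time $N$ of the filtration $\mathcal F_k=\sigma(Y^k,U^k)$, and a decision $\delta=\delta(Y^N,U^N)\in\{0,\dots,M-1\}$. Under hypothesis $i$, the law $\mathbb P_i$ (expectation $\mathbb E_i$) of the controls and observations is given by the joint pmfs $$p_i(y^n,u^n)=\prod_{k=1}^n q_k(u_k\mid y^{k-1},u^{k-1})\,p_i^{u_k}(y_k\mid y_{k-1}).$$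 Put $P_{\max}=\max_i\mathbb P_i\{\delta\ne i\}$ (not stopping counts as an error) and $R_i=\max_{j\neq i}\mathbb P_j\{\delta=i\}$ (where $\{\delta=i\}$ includes $N<\infty$). For a conditional pmf $q(u\mid\tilde y)$ let $\mu_i^q$ be the unique stationary distribution of $p_i^q(y\mid\tilde y)=\sum_u q(u\mid\tilde y)p_i^u(y\mid\tilde y)$, and let $$d_i^*=\max_q\ \frac{\min_{j\ne i}\sum_{\tilde y,u}\mu_i^q(\tilde y)q(u\mid\tilde y)D\big(p_i^u(\cdot\mid\tilde y)\,\|\,p_j^u(\cdot\mid\tilde y)\big)}{\sum_{\tilde y,u}\mu_i^q(\tilde y)q(u\mid\tilde y)c(u)},\qquad D(p\|r)=\sum_y p(y)\log\frac{p(y)}{r(y)} .$$ The maximum is attained, and $d_i^*>0$. *(Converse.)* For every sequence of tests with $P_{\max}\to0$ and every $i$, eventually $R_i>0$, and $$\mathbb E_i\Big[\sum_{k=1}^N c(U_k)\Big]\ \ge\ \frac{-\log R_i}{d_i^*}(1+o(1))\ \ge\ \frac{-\log P_{\max}}{d_i^*}(1+o(1)).$$ *(Achievability.)* For each $i$ let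 $q_i^*$ be any maximizer in the definition of $d_i^*$, and let $a>1$. Consider the control policy under which $U_k$ is uniform on $\mathcal U$, independently of the past, at the times $k=\lceil a^\ell\rceil$, $\ell=0,1,\dots$, and otherwise has conditional law $q^*_{\hat\imath_{k-1}}(\cdot\mid Y_{k-1})$, where $\hat\imath_n\in\arg\max_i p_i(Y^n,U^n)$ is the maximum likelihood estimate (ties broken arbitrarily). For $T>0$ stop at $$N^*=\min\Big\{n\ge1:\ \frac{p_{\hat\imath_n}(Y^n,U^n)}{\max_{j\neq\hat\imath_n}p_j(Y^n,U^n)}>T\Big\}$$ and decide $\delta^*=\hat\imath_{N^*}$. Denote by $P^*_{\max},R^*_i$ the maximal error probability and the risks of this test. Then $P^*_{\max}\le (M-1)/T$. Moreover there is $a_0>1$, depending only on the model and on $c$, such that for $1<a<a_0$ and every $i$ the expected cost $\mathbb E_i[\sum_{k=1}^{N^*}c(U_k)]$ is finite for all $T>0$ and, as $T\to\infty$, $$\mathbb E_i\Big[\sum_{k=1}^{N^*}c(U_k)\Big]=\frac{-\log P^*_{\max}}{d_i^*}(1+o(1))=\Big(\inf_{P_{\max}\le P^*_{\max}}\mathbb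 E_i\Big[\sum_{k=1}^{N}c(U_k)\Big]\Big)(1+o(1))$$ $$=\frac{-\log R_i^*}{d_i^*}(1+o(1))=\Big(\inf_{R_0\le R_0^*,\dots,R_{M-1}\le R^*_{M-1}}\mathbb E_i\Big[\sum_{k=1}^{N}c(U_k)\Big]\Big)(1+o(1)),$$ the infima being over all sequential tests $(\phi,N,\delta)$ that satisfy the indicated constraints. -/

import Mathlib

open MeasureTheory ProbabilityTheory Filter Topology
open scoped ENNReal

namespace ControlledSensing

/-! ### Stationary distribution of a strictly positive finite transition matrix -/

/-- `μ` is stationary for the transition probabilities `P` (`P x y` is the probability of moving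
from `x` to `y`). -/
def IsStationaryDist {Y : Type*} [Fintype Y] (P : Y → Y → ℝ) (μ : stdSimplex ℝ Y) : Prop :=
  ∀ y, μ y = ∑ x, μ x * P x y

theorem existsUnique_isStationaryDist {Y : Type*} [Fintype Y] [Nonempty Y] (P : Y → Y → ℝ)
    (hpos : ∀ x y, 0 < P x y) (hsum : ∀ x, ∑ y, P x y = 1) :
    ∃! μ : stdSimplex ℝ Y, IsStationaryDist P μ := by
  classical
  -- existence
  have hdet : (Matrix.of P - 1).det = 0 := by
    rw [← Matrix.exists_mulVec_eq_zero_iff]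
    refine ⟨fun _ => 1, ?_, ?_⟩
    · intro h
      have := congrFun h (Classical.arbitrary Y)
      simp at this
    · funext x
      rw [Matrix.sub_mulVec, Matrix.one_mulVec]
      simp [Matrix.mulVec, dotProduct, hsum]
  obtain ⟨v, hv0, hv⟩ := Matrix.exists_vecMul_eq_zero_iff.mpr hdet
  have hv' : ∀ y, ∑ x, v x * P x y = v y := by
    intro y
    have := congrFun hv y
    rw [Matrix.vecMul_sub, Matrix.vecMul_one] at this
    simp only [Pi.sub_apply, Matrix.vecMul, dotProduct, Matrix.of_apply, Pi.zero_apply] at this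
    linarith
  have hle : ∀ y, |v y| ≤ ∑ x, |v x| * P x y := by
    intro y
    rw [← hv' y]
    refine (Finset.abs_sum_le_sum_abs _ _).trans (le_of_eq ?_)
    exact Finset.sum_congr rfl fun x _ => by rw [abs_mul, abs_of_pos (hpos x y)]
  have htot : ∑ y, |v y| = ∑ y, ∑ x, |v x| * P x y := by
    rw [Finset.sum_comm]
    exact Finset.sum_congr rfl fun x _ => by rw [← Finset.mul_sum, hsum, mul_one]
  have heq : ∀ y, |v y| = ∑ x, |v x| * P x y := by
    intro y
    exact (Finset.sum_eq_sum_iff_of_le fun y _ => hle y).mp htot y (Finset.mem_univ y)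
  have hS : 0 < ∑ y, |v y| := by
    obtain ⟨x, hx⟩ := Function.ne_iff.mp hv0
    exact Finset.sum_pos' (fun y _ => abs_nonneg _) ⟨x, Finset.mem_univ x, abs_pos.mpr hx⟩
  let μ : stdSimplex ℝ Y := ⟨fun y => |v y| / ∑ z, |v z|,
    fun y => by positivity, by rw [← Finset.sum_div, div_self hS.ne']⟩
  have hμ : IsStationaryDist P μ := by
    intro y
    change |v y| / ∑ z, |v z| = ∑ x, (|v x| / ∑ z, |v z|) * P x y
    rw [heq y, Finset.sum_div]
    exact Finset.sum_congr rfl fun x _ => by ring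
  -- uniqueness
  refine ⟨μ, hμ, fun ν hν => ?_⟩
  obtain ⟨δ, hδ0, hδ⟩ : ∃ δ : ℝ, 0 < δ ∧ ∀ x y, δ ≤ P x y := by
    obtain ⟨z, hz⟩ := Finite.exists_min (fun z : Y × Y => P z.1 z.2)
    exact ⟨P z.1 z.2, hpos _ _, fun x y => hz (x, y)⟩
  set w : Y → ℝ := fun y => ν y - μ y with hw
  have hw0 : ∑ y, w y = 0 := by
    simp only [hw, Finset.sum_sub_distrib, stdSimplex.sum_eq_one, sub_self]
  have hwP : ∀ y, w y = ∑ x, w x * (P x y - δ) := by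
    intro y
    have h1 : ∑ x, w x * (P x y - δ) = ∑ x, w x * P x y := by
      simp only [mul_sub, Finset.sum_sub_distrib, ← Finset.sum_mul, hw0, zero_mul, sub_zero]
    rw [h1]
    simp only [hw, sub_mul, Finset.sum_sub_distrib]
    rw [← hν y, ← hμ y]
  have hcon : ∑ y, |w y| ≤ ∑ x, |w x| * (1 - Fintype.card Y * δ) := by
    calc ∑ y, |w y| ≤ ∑ y, ∑ x, |w x| * (P x y - δ) := by
          refine Finset.sum_le_sum fun y _ => ?_
          rw [hwP y]
          refine (Finset.abs_sum_le_sum_abs _ _).trans (le_of_eq ?_)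
          refine Finset.sum_congr rfl fun x _ => ?_
          rw [abs_mul, abs_of_nonneg (sub_nonneg.mpr (hδ x y))]
      _ = ∑ x, |w x| * (1 - Fintype.card Y * δ) := by
          rw [Finset.sum_comm]
          refine Finset.sum_congr rfl fun x _ => ?_
          rw [← Finset.mul_sum, Finset.sum_sub_distrib, hsum]
          simp
  rw [← Finset.sum_mul] at hcon
  have hcard : 0 < (Fintype.card Y : ℝ) := by exact_mod_cast Fintype.card_pos
  have hnn : 0 ≤ ∑ y, |w y| := Finset.sum_nonneg fun y _ => abs_nonneg _
  have hz : ∑ y, |w y| = 0 := by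
    nlinarith [mul_pos hcard hδ0]
  have hwz : ∀ y, w y = 0 := fun y =>
    abs_eq_zero.mp ((Finset.sum_eq_zero_iff_of_nonneg fun y _ => abs_nonneg (w y)).mp hz y
      (Finset.mem_univ y))
  apply stdSimplex.ext
  funext y
  have := hwz y
  simp only [hw] at this
  linarith

/-! ### The controlled Markovian observation model -/

/-- `M` hypotheses, finite control set `U`, finite observation set `Y`:
`p i u y' y` is the probability, under hypothesis `i`, of observing `y` when the current control
is `u` and the previous observation is `y'`; `y₀` is the constant initial observation. -/
structure ObsModel (M : ℕ) (U Y : Type*) [Fintype Y] where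
  p : Fin M → U → Y → Y → ℝ
  p_pos : ∀ i u y' y, 0 < p i u y' y
  p_sum : ∀ i u y', ∑ y, p i u y' y = 1
  y₀ : Y

/-- Histories `((u₁, y₁), …, (uₙ, yₙ))`; entry `k : Fin n` is the pair at time `k + 1`. -/
abbrev Hist (U Y : Type*) (n : ℕ) : Type _ := Fin n → U × Y

/-- The infinite sequences `((u₁, y₁), (u₂, y₂), …)`; entry `k` is the pair at time `k + 1`. -/
abbrev SamplePath (U Y : Type*) : Type _ := ℕ → U × Y

/-- A causal, possibly randomized, control policy: `φ n h` is the law of the control at time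
`n + 1` given the history `h` of the first `n` controls and observations. -/
abbrev Policy (U Y : Type*) [Fintype U] : Type _ := (n : ℕ) → Hist U Y n → stdSimplex ℝ U

/-- A conditional pmf `q(u | ỹ)`, i.e. a stationary randomized policy. -/
abbrev StatPolicy (U Y : Type*) [Fintype U] : Type _ := Y → stdSimplex ℝ U

/-- The first `k` entries of a history of length `n`. -/
def Hist.take {U Y : Type*} {n : ℕ} (h : Hist U Y n) (k : ℕ) (hk : k ≤ n) : Hist U Y k :=
  fun l => h (Fin.castLE hk l)

theorem Hist.eq_iff_take {U Y : Type*} {n : ℕ} (g h : Hist U Y (n + 1)) :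
    g = h ↔ g.take n n.le_succ = h.take n n.le_succ ∧ g (Fin.last n) = h (Fin.last n) := by
  constructor
  · rintro rfl
    exact ⟨rfl, rfl⟩
  · rintro ⟨h1, h2⟩
    funext k
    refine Fin.lastCases h2 (fun k => ?_) k
    exact congrFun h1 k

section Law

variable {M : ℕ} {U Y : Type*} [Fintype U] [Fintype Y]

/-- The last observation of a history (the initial observation if the history is empty). -/
def ObsModel.lastObs (m : ObsModel M U Y) : {n : ℕ} → Hist U Y n → Y
  | 0, _ => m.y₀
  | _ + 1, h => (h (Fin.last _)).2

/-- The joint pmf `p_i(yⁿ, uⁿ)` of the first `n` observations and controls under hypothesis `i`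
and the policy `φ`. -/
noncomputable def ObsModel.jointPmf (m : ObsModel M U Y) (φ : Policy U Y) (i : Fin M) {n : ℕ}
    (h : Hist U Y n) : ℝ :=
  ∏ k : Fin n, φ k (h.take k k.is_lt.le) (h k).1 *
    m.p i (h k).1 (m.lastObs (h.take k k.is_lt.le)) (h k).2

theorem ObsModel.jointPmf_succ (m : ObsModel M U Y) (φ : Policy U Y) (i : Fin M) {n : ℕ}
    (h : Hist U Y (n + 1)) :
    m.jointPmf φ i h = m.jointPmf φ i (h.take n n.le_succ) *
      (φ n (h.take n n.le_succ) (h (Fin.last n)).1 *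
        m.p i (h (Fin.last n)).1 (m.lastObs (h.take n n.le_succ)) (h (Fin.last n)).2) := by
  unfold ObsModel.jointPmf
  rw [Fin.prod_univ_castSucc]
  rfl

theorem ObsModel.jointPmf_nonneg (m : ObsModel M U Y) (φ : Policy U Y) (i : Fin M) {n : ℕ}
    (h : Hist U Y n) : 0 ≤ m.jointPmf φ i h :=
  Finset.prod_nonneg fun _ _ => mul_nonneg (stdSimplex.zero_le _ _) (m.p_pos _ _ _ _).le

/-- The law of (control, observation) at a time at which the control has law `q` and the previous
observation is `y'`, as a pmf. -/
noncomputable def ObsModel.stepPmf (m : ObsModel M U Y) (i : Fin M) (q : stdSimplex ℝ U) (y' : Y) :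
    PMF (U × Y) :=
  PMF.ofFintype (fun z => ENNReal.ofReal (q z.1 * m.p i z.1 y' z.2)) (by
    rw [← ENNReal.ofReal_sum_of_nonneg
      fun z _ => mul_nonneg (stdSimplex.zero_le q _) (m.p_pos _ _ _ _).le]
    rw [Fintype.sum_prod_type]
    simp [← Finset.mul_sum, m.p_sum])

/-- The law of the next pair (control, observation) given the history. -/
noncomputable def ObsModel.nextPmf (m : ObsModel M U Y) (φ : Policy U Y) (i : Fin M) {n : ℕ}
    (h : Hist U Y n) : PMF (U × Y) :=
  m.stepPmf i (φ n h) (m.lastObs h)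

variable [MeasurableSpace U] [DiscreteMeasurableSpace U] [MeasurableSpace Y]
  [DiscreteMeasurableSpace Y]

/-- The transition kernel from the first `n + 1` pairs to the next pair. -/
noncomputable def ObsModel.stepKernel (m : ObsModel M U Y) (φ : Policy U Y) (i : Fin M) (n : ℕ) :
    Kernel ((k : Finset.Iic n) → (fun _ : ℕ => U × Y) k) (U × Y) :=
  Kernel.ofFunOfCountable fun x =>
    (m.nextPmf φ i (n := n + 1)
      fun k => x ⟨k, Finset.mem_Iic.mpr (Nat.lt_succ_iff.mp k.is_lt)⟩).toMeasure

instance (m : ObsModel M U Y) (φ : Policy U Y) (i : Fin M) (n : ℕ) :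
    IsMarkovKernel (m.stepKernel φ i n) :=
  ⟨fun x => by
    change IsProbabilityMeasure (PMF.toMeasure _)
    infer_instance⟩

/-- `ℙ_i`: the law of the whole sequence of controls and observations under hypothesis `i` and
the policy `φ`. -/
noncomputable def ObsModel.law (m : ObsModel M U Y) (φ : Policy U Y) (i : Fin M) :
    Measure (SamplePath U Y) :=
  Kernel.trajMeasure (X := fun _ : ℕ => U × Y) (m.nextPmf φ i (n := 0) Fin.elim0).toMeasure
    (m.stepKernel φ i)

instance (m : ObsModel M U Y) (φ : Policy U Y) (i : Fin M) : IsProbabilityMeasure (m.law φ i) := by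
  unfold ObsModel.law
  infer_instance

/-- The history of the first `n` controls and observations of a path. -/
def hist (n : ℕ) (ω : SamplePath U Y) : Hist U Y n := fun k => ω k

/-- `ℱ_n`, the σ-algebra generated by the first `n` controls and observations. -/
def histFiltration (U Y : Type*) [MeasurableSpace U] [MeasurableSpace Y] :
    Filtration ℕ (inferInstance : MeasurableSpace (SamplePath U Y)) where
  seq n := MeasurableSpace.comap (hist n) inferInstance
  mono' := by
    intro a b hab
    have h : (hist a : SamplePath U Y → Hist U Y a) = (fun h : Hist U Y b => h.take a hab) ∘ hist b := rfl
    change MeasurableSpace.comap (hist a) _ ≤ MeasurableSpace.comap (hist b) _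
    rw [h, ← MeasurableSpace.comap_comp]
    refine MeasurableSpace.comap_mono (Measurable.comap_le ?_)
    exact measurable_pi_lambda _ fun l => measurable_pi_apply _
  le' := by
    intro n
    exact Measurable.comap_le (measurable_pi_lambda _ fun l => measurable_pi_apply _)

/-- The finite-dimensional marginals of `ℙ_i` are the joint pmfs `p_i(yⁿ, uⁿ)`. -/
theorem ObsModel.law_hist_eq (m : ObsModel M U Y) (φ : Policy U Y) (i : Fin M) {n : ℕ}
    (h : Hist U Y n) :
    m.law φ i {ω | hist n ω = h} = ENNReal.ofReal (m.jointPmf φ i h) := by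
  induction n with
  | zero =>
    have : {ω : SamplePath U Y | hist 0 ω = h} = Set.univ := by
      ext ω
      simp only [Set.mem_ofPred_eq, Set.mem_univ, iff_true]
      exact funext fun k => k.elim0
    rw [this, measure_univ]
    simp [ObsModel.jointPmf]
  | succ n ih =>
    rw [m.jointPmf_succ, ENNReal.ofReal_mul (m.jointPmf_nonneg _ _ _), ← ih]
    cases n with
    | zero =>
      have e0 : {ω : SamplePath U Y | hist 0 ω = h.take 0 (Nat.zero_le _)} = Set.univ := by
        ext ω
        simp only [Set.mem_ofPred_eq, Set.mem_univ, iff_true]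
        exact funext fun k => k.elim0
      have e1 : {ω : SamplePath U Y | hist 1 ω = h} = (fun ω => ω 0) ⁻¹' {h 0} := by
        ext ω
        simp only [Set.mem_ofPred_eq, Set.mem_preimage, Set.mem_singleton_iff]
        constructor
        · rintro rfl
          rfl
        · intro h0
          funext k
          rw [Subsingleton.elim k 0]
          exact h0
      rw [e0, measure_univ, one_mul, e1]
      have hmap : (m.law φ i).map (fun ω : SamplePath U Y => ω 0) =
          (m.nextPmf φ i (n := 0) Fin.elim0).toMeasure := by
        have h0 : (fun ω : SamplePath U Y => ω 0) =
            (fun x : (k : Finset.Iic 0) → (fun _ : ℕ => U × Y) k => x ⟨0, by simp⟩) ∘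
              Preorder.frestrictLe (π := fun _ : ℕ => U × Y) 0 := rfl
        have h1 : (m.law φ i).map (Preorder.frestrictLe (π := fun _ : ℕ => U × Y) 0) =
            ((m.nextPmf φ i (n := 0) Fin.elim0).toMeasure).map
              (MeasurableEquiv.piUnique (fun k : Finset.Iic 0 => (fun _ : ℕ => U × Y) k)).symm := by
          unfold ObsModel.law Kernel.trajMeasure
          rw [Measure.map_comp _ _ (by fun_prop), Kernel.traj_map_frestrictLe,
            Kernel.partialTraj_self, Measure.id_comp]
        rw [h0, ← Measure.map_map (by fun_prop) (by fun_prop), h1,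
          Measure.map_map (by fun_prop) (MeasurableEquiv.measurable _)]
        exact Measure.map_id
      rw [← Measure.map_apply (measurable_pi_apply 0) (measurableSet_singleton _), hmap,
        PMF.toMeasure_apply_singleton _ _ (measurableSet_singleton _)]
      have ht : h.take 0 (Nat.zero_le _) = Fin.elim0 := funext fun k => k.elim0
      change _ = ENNReal.ofReal (φ 0 (h.take 0 (Nat.zero_le _)) _ * _)
      rw [ht]
      rfl
    | succ n =>
      set r : (k : Finset.Iic n) → (fun _ : ℕ => U × Y) k :=
        fun k => h ⟨k, Nat.lt_succ_of_lt (Nat.lt_succ_of_le (Finset.mem_Iic.mp k.2))⟩ with hr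
      have key := Kernel.map_frestrictLe_trajMeasure_compProd_eq_map_trajMeasure
        (X := fun _ : ℕ => U × Y) (μ₀ := (m.nextPmf φ i (n := 0) Fin.elim0).toMeasure)
        (κ := m.stepKernel φ i) (a := n)
      change (m.law φ i).map _ ⊗ₘ _ = (m.law φ i).map _ at key
      have e1 : {ω : SamplePath U Y | hist (n + 2) ω = h} =
          (fun x : SamplePath U Y => (Preorder.frestrictLe (π := fun _ : ℕ => U × Y) n x, x (n + 1))) ⁻¹'
            ({r} ×ˢ {h (Fin.last (n + 1))}) := by
        ext ω
        rw [Set.mem_ofPred_eq, Hist.eq_iff_take]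
        simp only [Set.mem_preimage, Set.mem_prod, Set.mem_singleton_iff]
        refine and_congr ⟨fun hh => ?_, fun hh => ?_⟩ Iff.rfl
        · funext k
          exact congrFun hh ⟨k, Nat.lt_succ_of_le (Finset.mem_Iic.mp k.2)⟩
        · funext k
          exact congrFun hh ⟨k, Finset.mem_Iic.mpr (Nat.lt_succ_iff.mp k.is_lt)⟩
      have e2 : {ω : SamplePath U Y | hist (n + 1) ω = h.take (n + 1) (Nat.le_succ _)} =
          Preorder.frestrictLe (π := fun _ : ℕ => U × Y) n ⁻¹' {r} := by
        ext ω
        simp only [Set.mem_ofPred_eq, Set.mem_preimage, Set.mem_singleton_iff]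
        refine ⟨fun hh => ?_, fun hh => ?_⟩
        · funext k
          exact congrFun hh ⟨k, Nat.lt_succ_of_le (Finset.mem_Iic.mp k.2)⟩
        · funext k
          exact congrFun hh ⟨k, Finset.mem_Iic.mpr (Nat.lt_succ_iff.mp k.is_lt)⟩
      rw [e1, e2, ← Measure.map_apply (by fun_prop)
        ((measurableSet_singleton _).prod (measurableSet_singleton _)), ← key,
        Measure.compProd_apply_prod (measurableSet_singleton _) (measurableSet_singleton _),
        lintegral_singleton, Measure.map_apply (by fun_prop) (measurableSet_singleton _), mul_comm]
      congr 1
      change (m.nextPmf φ i (h.take (n + 1) (Nat.le_succ _))).toMeasure _ = _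
      rw [PMF.toMeasure_apply_singleton _ _ (measurableSet_singleton _)]
      rfl

end Law

/-! ### Sequential tests, error probability, risks, cost -/

/-- A sequential test `(φ, N, δ)`: a causal control policy, a stopping time of the filtration
generated by controls and observations, and a decision rule; `decision n` is the decision taken
from the available history when `N = n`. -/
structure SeqTest (M : ℕ) (U Y : Type*) [Fintype U] [MeasurableSpace U] [MeasurableSpace Y] where
  policy : Policy U Y
  N : SamplePath U Y → ℕ∞
  isStoppingTime : IsStoppingTime (histFiltration U Y) N
  decision : (n : ℕ) → Hist U Y n → Fin M

section Test

variable {M : ℕ} {U Y : Type*} [Fintype U] [Fintype Y]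
  [MeasurableSpace U] [DiscreteMeasurableSpace U] [MeasurableSpace Y] [DiscreteMeasurableSpace Y]

/-- The event `{δ = i}` that the test stops and decides for hypothesis `i`. -/
def SeqTest.decides (γ : SeqTest M U Y) (i : Fin M) : Set (SamplePath U Y) :=
  {ω | ∃ n : ℕ, γ.N ω = n ∧ γ.decision n (hist n ω) = i}

/-- `ℙ_i {δ ≠ i}`; never stopping counts as an error. -/
noncomputable def SeqTest.errorProb (γ : SeqTest M U Y) (m : ObsModel M U Y) (i : Fin M) : ℝ :=
  (m.law γ.policy i).real (γ.decides i)ᶜ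

/-- The maximal error probability `P_max = max_i ℙ_i {δ ≠ i}`. -/
noncomputable def SeqTest.maxError (γ : SeqTest M U Y) (m : ObsModel M U Y) : ℝ :=
  ⨆ i, γ.errorProb m i

/-- The risk `R_i = max_{j ≠ i} ℙ_j {δ = i}`. -/
noncomputable def SeqTest.risk (γ : SeqTest M U Y) (m : ObsModel M U Y) (i : Fin M) : ℝ :=
  ⨆ j : {j : Fin M // j ≠ i}, (m.law γ.policy j).real (γ.decides i)

/-- The expected total control cost `𝔼_i [∑_{k ≤ N} c(U_k)]`, in `[0, ∞]`. -/
noncomputable def SeqTest.expectedCost (γ : SeqTest M U Y) (m : ObsModel M U Y) (c : U → ℝ)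
    (i : Fin M) : ℝ≥0∞ :=
  ∫⁻ ω, ∑' k : ℕ, (if ((k + 1 : ℕ) : ℕ∞) ≤ γ.N ω then ENNReal.ofReal (c (ω k).1) else 0)
    ∂(m.law γ.policy i)

/-- The infimum of the expected cost under hypothesis `i` over the tests with `P_max ≤ α`. -/
noncomputable def infCostOfMaxError (m : ObsModel M U Y) (c : U → ℝ) (i : Fin M) (α : ℝ) : ℝ≥0∞ :=
  ⨅ (γ : SeqTest M U Y) (_ : γ.maxError m ≤ α), γ.expectedCost m c i

/-- The infimum of the expected cost under hypothesis `i` over the tests with `R_j ≤ β_j` for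
every `j`. -/
noncomputable def infCostOfRisks (m : ObsModel M U Y) (c : U → ℝ) (i : Fin M) (β : Fin M → ℝ) :
    ℝ≥0∞ :=
  ⨅ (γ : SeqTest M U Y) (_ : ∀ j, γ.risk m j ≤ β j), γ.expectedCost m c i

end Test

/-! ### The optimal coefficients -/

section Rate

variable {M : ℕ} {U Y : Type*} [Fintype U] [Fintype Y]

/-- The Kullback-Leibler distance `D(p‖q)` of two pmfs (used for strictly positive ones). -/
noncomputable def klDist (p q : Y → ℝ) : ℝ := ∑ y, p y * Real.log (p y / q y)

/-- `p_i^q(y | ỹ) = ∑ u, q(u | ỹ) p_i^u(y | ỹ)`. -/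
noncomputable def ObsModel.mixed (m : ObsModel M U Y) (i : Fin M) (q : StatPolicy U Y) :
    Y → Y → ℝ :=
  fun y' y => ∑ u, q y' u * m.p i u y' y

theorem ObsModel.existsUnique_stationary (m : ObsModel M U Y) (i : Fin M) (q : StatPolicy U Y) :
    ∃! μ : stdSimplex ℝ Y, IsStationaryDist (m.mixed i q) μ := by
  have : Nonempty Y := ⟨m.y₀⟩
  refine existsUnique_isStationaryDist _ (fun y' y => ?_) fun y' => ?_
  · obtain ⟨u, -, hu⟩ : ∃ u ∈ Finset.univ, 0 < q y' u := by
      refine Finset.exists_lt_of_sum_lt (f := fun _ : U => (0 : ℝ)) ?_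
      simp
    exact Finset.sum_pos'
      (fun u _ => mul_nonneg (stdSimplex.zero_le _ _) (m.p_pos _ _ _ _).le)
      ⟨u, Finset.mem_univ u, mul_pos hu (m.p_pos _ _ _ _)⟩
  · simp only [ObsModel.mixed]
    rw [Finset.sum_comm]
    simp [← Finset.mul_sum, m.p_sum]

/-- `μ_i^q`, the unique stationary distribution of `p_i^q`. -/
noncomputable def ObsModel.statDist (m : ObsModel M U Y) (i : Fin M) (q : StatPolicy U Y) :
    stdSimplex ℝ Y :=
  (m.existsUnique_stationary i q).choose

/-- `∑_{ỹ, u} μ_i^q(ỹ) q(u | ỹ) f(ỹ, u)`. -/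
noncomputable def ObsModel.statMean (m : ObsModel M U Y) (i : Fin M) (q : StatPolicy U Y)
    (f : Y → U → ℝ) : ℝ :=
  ∑ y', ∑ u, m.statDist i q y' * q y' u * f y' u

/-- Stationary minimal information per unit of stationary cost, under hypothesis `i` and the
stationary randomized policy `q`. -/
noncomputable def ObsModel.rate (m : ObsModel M U Y) (c : U → ℝ) (i : Fin M)
    (q : StatPolicy U Y) : ℝ :=
  (⨅ j : {j : Fin M // j ≠ i}, m.statMean i q fun y' u => klDist (m.p i u y') (m.p j u y')) /
    m.statMean i q fun _ u => c u

/-- The coefficient `d_i^*`, the maximum of the rate over stationary randomized policies. -/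
noncomputable def ObsModel.optRate (m : ObsModel M U Y) (c : U → ℝ) (i : Fin M) : ℝ :=
  ⨆ q : StatPolicy U Y, m.rate c i q

end Rate

/-! ### The proposed test -/

section Proposed

variable {M : ℕ} {U Y : Type*} [Fintype U] [Fintype Y]

/-- `ihat` is a maximum likelihood estimate of the hypothesis under the policy `φ`, with an
arbitrary rule for breaking ties. -/
def ObsModel.IsMLE (m : ObsModel M U Y) (φ : Policy U Y)
    (ihat : (n : ℕ) → Hist U Y n → Fin M) : Prop :=
  ∀ n h i, m.jointPmf φ i h ≤ m.jointPmf φ (ihat n h) h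

open Classical in
/-- `φ` is the control rule that uses the uniform distribution at the times `⌈a ^ ℓ⌉`,
`ℓ = 0, 1, …`, and the conditional pmf `q_î( · | last observation)`, for the current maximum
likelihood estimate `î`, at all other times. -/
def ObsModel.IsPlugInPolicy [Nonempty U] (m : ObsModel M U Y) (a : ℝ)
    (qstar : Fin M → StatPolicy U Y) (φ : Policy U Y) (ihat : (n : ℕ) → Hist U Y n → Fin M) :
    Prop :=
  m.IsMLE φ ihat ∧ ∀ n h, φ n h =
    if ∃ ℓ : ℕ, n + 1 = ⌈a ^ ℓ⌉₊ then stdSimplex.barycenter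
    else qstar (ihat n h) (m.lastObs h)

theorem ObsModel.exists_isPlugInPolicy [Nonempty U] (m : ObsModel M U Y) (hM : 2 ≤ M) (a : ℝ)
    (qstar : Fin M → StatPolicy U Y) : ∃ φ ihat, m.IsPlugInPolicy a qstar φ ihat := by
  classical
  have : Nonempty (Fin M) := ⟨⟨0, by omega⟩⟩
  have key : ∀ (n : ℕ) (h : Hist U Y n), ∃ i₀ : Fin M, ∀ i : Fin M,
      ∏ k : Fin n, m.p i (h k).1 (m.lastObs (h.take k k.is_lt.le)) (h k).2 ≤
      ∏ k : Fin n, m.p i₀ (h k).1 (m.lastObs (h.take k k.is_lt.le)) (h k).2 :=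
    fun n h => Finite.exists_max _
  choose ihat hi using key
  refine ⟨fun n h => if ∃ ℓ : ℕ, n + 1 = ⌈a ^ ℓ⌉₊ then stdSimplex.barycenter
    else qstar (ihat n h) (m.lastObs h), ihat, fun n h i => ?_, fun n h => rfl⟩
  simp only [ObsModel.jointPmf, Finset.prod_mul_distrib]
  exact mul_le_mul_of_nonneg_left (hi n h i)
    (Finset.prod_nonneg fun k _ => stdSimplex.zero_le _ _)

/-- The stopping condition at time `n`: the likelihood ratio between the maximum likelihood
estimate and its best competitor exceeds the threshold `T`. -/
def ObsModel.ExceedsThreshold (m : ObsModel M U Y) (φ : Policy U Y)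
    (ihat : (n : ℕ) → Hist U Y n → Fin M) (T : ℝ) (n : ℕ) (h : Hist U Y n) : Prop :=
  T < m.jointPmf φ (ihat n h) h / ⨆ j : {j : Fin M // j ≠ ihat n h}, m.jointPmf φ j h

/-- The stopping time `N^*`, the first `n ≥ 1` at which the stopping condition holds (`∞` if
there is none). -/
noncomputable def ObsModel.msprtTime (m : ObsModel M U Y) (φ : Policy U Y)
    (ihat : (n : ℕ) → Hist U Y n → Fin M) (T : ℝ) (ω : SamplePath U Y) : ℕ∞ :=
  sInf ((fun n : ℕ => (n : ℕ∞)) '' {n | 1 ≤ n ∧ m.ExceedsThreshold φ ihat T n (hist n ω)})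

variable [MeasurableSpace U] [DiscreteMeasurableSpace U] [MeasurableSpace Y]
  [DiscreteMeasurableSpace Y]

theorem ObsModel.isStoppingTime_msprtTime (m : ObsModel M U Y) (φ : Policy U Y)
    (ihat : (n : ℕ) → Hist U Y n → Fin M) (T : ℝ) :
    IsStoppingTime (histFiltration U Y) (m.msprtTime φ ihat T) := by
  intro n
  have h : {ω | m.msprtTime φ ihat T ω ≤ (n : ℕ∞)} =
      ⋃ l ∈ Set.Icc 1 n, {ω | m.ExceedsThreshold φ ihat T l (hist l ω)} := by
    ext ω
    simp only [Set.mem_ofPred_eq, Set.mem_iUnion, exists_prop, Set.mem_Icc]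
    constructor
    · intro hle
      have hlt : m.msprtTime φ ihat T ω < ((n + 1 : ℕ) : ℕ∞) :=
        lt_of_le_of_lt hle (by exact_mod_cast Nat.lt_succ_self n)
      obtain ⟨_, ⟨l, ⟨hl1, hl⟩, rfl⟩, hln⟩ := sInf_lt_iff.mp hlt
      exact ⟨l, ⟨hl1, Nat.lt_succ_iff.mp (ENat.natCast_lt_natCast.mp hln)⟩, hl⟩
    · rintro ⟨l, ⟨hl1, hln⟩, hl⟩
      have h1 : m.msprtTime φ ihat T ω ≤ (l : ℕ∞) := sInf_le ⟨l, ⟨hl1, hl⟩, rfl⟩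
      exact h1.trans (ENat.natCast_le_natCast.mpr hln)
  change MeasurableSet[(histFiltration U Y) n] {ω | m.msprtTime φ ihat T ω ≤ (n : ℕ∞)}
  rw [h]
  refine MeasurableSet.biUnion (Set.to_countable _) fun l hl => ?_
  exact (histFiltration U Y).mono hl.2 _
    ⟨{x | m.ExceedsThreshold φ ihat T l x}, (Set.to_countable _).measurableSet, rfl⟩

/-- The proposed test: policy `φ`, stopping time `N^*` with threshold `T`, and the maximum
likelihood decision. -/
noncomputable def ObsModel.msprt (m : ObsModel M U Y) (φ : Policy U Y)
    (ihat : (n : ℕ) → Hist U Y n → Fin M) (T : ℝ) : SeqTest M U Y where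
  policy := φ
  N := m.msprtTime φ ihat T
  isStoppingTime := m.isStoppingTime_msprtTime φ ihat T
  decision := ihat

end Proposed

end ControlledSensing

open ControlledSensing

/-! Converse. Fix hypothesis `i`. Up to the stopping time, the expected log-likelihood ratio of `i`
against `j` equals the sum of Kullback-Leibler distances weighted by the expected occupation measure
of the pairs (last observation, control). Changing measure with a tangent line of `exp` bounds this
information below by `x * ℙ_i {δ = i} - 1` whenever `exp x * R_i ≤ 1`
(`le_sum_expect_alive_stepLlr`). The occupation measure is almost invariant, with a balance defect
bounded uniformly in the test and the horizon. By Doeblin's minorization it is therefore within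
bounded distance of a multiple of the stationary weight of some stationary policy `q`
(`exists_statPolicy_of_balance`). Under `q` the least information is at most `d_i^*` times the cost,
so the cost of every test is at least `(x * (1 - error) - C) / d_i^*`, with `C` independent of the
test (`exists_converse`). Working at a truncated horizon and passing to the limit avoids all
integrability assumptions.

Achievability. The error bound `(M - 1) / T` is a change of measure at the stopping time, once
stopping is known to be almost sure. The Bhattacharyya coefficient, the `ℙ_i`-mean of the square
root of the likelihood ratio of `j` against `i`, never increases, and uniform exploration contracts
it by a fixed `ρ < 1`. It tends to `0`, so the test stops; if `a * ρ < 1` it is summable in time, so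
the expected number of wrong estimates is finite. Apart from those and the logarithmically many
explorations, the control follows `q_i^*`. A solution of the Poisson equation then makes the
log-likelihood ratio minus `d_i^*` times the cost a process with nonnegative drift, up to a bounded
corrector, and an exponential moment bound turns this into a pathwise estimate with summable error
(`exists_cost_le_llr`). Before stopping some log-likelihood ratio is at most `max (log T) 0`, hence
the expected cost is at most `(max (log T) 0 + K) / (d_i^* - η)` for each small `η > 0`.

Matching. The converse, applied to the proposed test and to all its competitors, shows that all the
quantities compared are asymptotic to `log T / d_i^*`. -/

set_option linter.unusedSectionVars false

namespace ControlledSensing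

/-! ### Finite-horizon expectations -/

section Expectation

variable {M : ℕ} {U Y : Type*}

/-- The history `h` followed by the pair `z`. -/
def Hist.snoc {n : ℕ} (h : Hist U Y n) (z : U × Y) : Hist U Y (n + 1) :=
  Fin.snoc (α := fun _ => U × Y) h z

@[simp] theorem Hist.snoc_last {n : ℕ} (h : Hist U Y n) (z : U × Y) :
    h.snoc z (Fin.last n) = z :=
  Fin.snoc_last (α := fun _ => U × Y) z h

@[simp] theorem Hist.take_snoc {n : ℕ} (h : Hist U Y n) (z : U × Y) (hn : n ≤ n + 1) :
    (h.snoc z).take n hn = h := by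
  funext k
  exact Fin.snoc_castSucc (α := fun _ => U × Y) z h k

theorem Hist.snoc_take_last {n : ℕ} (h : Hist U Y (n + 1)) :
    (h.take n n.le_succ).snoc (h (Fin.last n)) = h := by
  rw [Hist.eq_iff_take]
  simp

theorem take_hist (n k : ℕ) (hk : k ≤ n) (ω : SamplePath U Y) :
    (hist n ω).take k hk = hist k ω := rfl

/-- The sum along a history of a functional of the successive pasts and next pairs. -/
def Hist.pathSum (F : (k : ℕ) → Hist U Y k → U × Y → ℝ) {n : ℕ} (h : Hist U Y n) : ℝ :=
  ∑ k : Fin n, F k (h.take k k.is_lt.le) (h k)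

@[simp] theorem Hist.pathSum_zero (F : (k : ℕ) → Hist U Y k → U × Y → ℝ) (h : Hist U Y 0) :
    h.pathSum F = 0 := by
  simp [Hist.pathSum]

theorem Hist.pathSum_succ (F : (k : ℕ) → Hist U Y k → U × Y → ℝ) {n : ℕ} (h : Hist U Y (n + 1)) :
    h.pathSum F = (h.take n n.le_succ).pathSum F + F n (h.take n n.le_succ) (h (Fin.last n)) := by
  unfold Hist.pathSum
  rw [Fin.sum_univ_castSucc]
  rfl

@[simp] theorem Hist.pathSum_snoc (F : (k : ℕ) → Hist U Y k → U × Y → ℝ) {n : ℕ}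
    (h : Hist U Y n) (z : U × Y) : (h.snoc z).pathSum F = h.pathSum F + F n h z := by
  rw [Hist.pathSum_succ]
  simp

variable [Fintype U] [Fintype Y]

@[simp] theorem ObsModel.lastObs_snoc (m : ObsModel M U Y) {n : ℕ} (h : Hist U Y n) (z : U × Y) :
    m.lastObs (h.snoc z) = z.2 := by
  change (h.snoc z (Fin.last _)).2 = z.2
  rw [Hist.snoc_last]

/-- The mean of `g (control, observation)` when the control has law `q` and the previous
observation is `y'`. -/
noncomputable def ObsModel.stepMean (m : ObsModel M U Y) (i : Fin M) (q : stdSimplex ℝ U) (y' : Y)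
    (g : U × Y → ℝ) : ℝ :=
  ∑ z : U × Y, q z.1 * m.p i z.1 y' z.2 * g z

theorem ObsModel.stepMean_eq (m : ObsModel M U Y) (i : Fin M) (q : stdSimplex ℝ U) (y' : Y)
    (g : U × Y → ℝ) :
    m.stepMean i q y' g = ∑ u, q u * ∑ y, m.p i u y' y * g (u, y) := by
  simp only [ObsModel.stepMean, Fintype.sum_prod_type, Finset.mul_sum, mul_assoc]

theorem ObsModel.stepMean_fst (m : ObsModel M U Y) (i : Fin M) (q : stdSimplex ℝ U) (y' : Y)
    (g : U → ℝ) : m.stepMean i q y' (fun z => g z.1) = ∑ u, q u * g u := by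
  simp [ObsModel.stepMean_eq, ← Finset.sum_mul, m.p_sum]

theorem ObsModel.stepMean_const (m : ObsModel M U Y) (i : Fin M) (q : stdSimplex ℝ U) (y' : Y)
    (a : ℝ) : m.stepMean i q y' (fun _ => a) = a := by
  rw [m.stepMean_fst i q y' (fun _ => a), ← Finset.sum_mul]
  simp

theorem ObsModel.stepMean_add (m : ObsModel M U Y) (i : Fin M) (q : stdSimplex ℝ U) (y' : Y)
    (f g : U × Y → ℝ) :
    m.stepMean i q y' (fun z => f z + g z) = m.stepMean i q y' f + m.stepMean i q y' g := by
  simp [ObsModel.stepMean, mul_add, Finset.sum_add_distrib]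

theorem ObsModel.stepMean_sub (m : ObsModel M U Y) (i : Fin M) (q : stdSimplex ℝ U) (y' : Y)
    (f g : U × Y → ℝ) :
    m.stepMean i q y' (fun z => f z - g z) = m.stepMean i q y' f - m.stepMean i q y' g := by
  simp [ObsModel.stepMean, mul_sub, Finset.sum_sub_distrib]

theorem ObsModel.stepMean_const_mul (m : ObsModel M U Y) (i : Fin M) (q : stdSimplex ℝ U) (y' : Y)
    (a : ℝ) (f : U × Y → ℝ) :
    m.stepMean i q y' (fun z => a * f z) = a * m.stepMean i q y' f := by
  simp only [ObsModel.stepMean, Finset.mul_sum]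
  exact Finset.sum_congr rfl fun z _ => by ring

theorem ObsModel.stepMean_mono (m : ObsModel M U Y) (i : Fin M) (q : stdSimplex ℝ U) (y' : Y)
    {f g : U × Y → ℝ} (h : ∀ z, f z ≤ g z) : m.stepMean i q y' f ≤ m.stepMean i q y' g :=
  Finset.sum_le_sum fun z _ =>
    mul_le_mul_of_nonneg_left (h z) (mul_nonneg (stdSimplex.zero_le _ _) (m.p_pos _ _ _ _).le)

/-- The expectation of a function of the first `n` controls and observations. -/
noncomputable def ObsModel.expect (m : ObsModel M U Y) (φ : Policy U Y) (i : Fin M) {n : ℕ}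
    (f : Hist U Y n → ℝ) : ℝ :=
  ∑ h, m.jointPmf φ i h * f h

theorem ObsModel.expect_zero (m : ObsModel M U Y) (φ : Policy U Y) (i : Fin M)
    (f : Hist U Y 0 → ℝ) : m.expect φ i f = f Fin.elim0 := by
  rw [ObsModel.expect, Fintype.sum_unique]
  rw [Subsingleton.elim (default : Hist U Y 0) Fin.elim0]
  simp [ObsModel.jointPmf]

theorem ObsModel.jointPmf_snoc (m : ObsModel M U Y) (φ : Policy U Y) (i : Fin M) {n : ℕ}
    (h : Hist U Y n) (z : U × Y) :
    m.jointPmf φ i (h.snoc z) =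
      m.jointPmf φ i h * (φ n h z.1 * m.p i z.1 (m.lastObs h) z.2) := by
  rw [m.jointPmf_succ]
  simp

/-- Tower property; the inductions on the horizon rest on it. -/
theorem ObsModel.expect_succ (m : ObsModel M U Y) (φ : Policy U Y) (i : Fin M) {n : ℕ}
    (f : Hist U Y (n + 1) → ℝ) :
    m.expect φ i f = m.expect φ i fun h : Hist U Y n =>
      m.stepMean i (φ n h) (m.lastObs h) fun z => f (h.snoc z) := by
  unfold ObsModel.expect ObsModel.stepMean
  rw [← (Fin.snocEquiv (fun _ : Fin (n + 1) => U × Y)).sum_comp, Fintype.sum_prod_type_right]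
  refine Finset.sum_congr rfl fun h _ => ?_
  rw [Finset.mul_sum]
  refine Finset.sum_congr rfl fun z _ => ?_
  change m.jointPmf φ i (Hist.snoc h z) * f (Hist.snoc h z) = _
  rw [m.jointPmf_snoc]
  ring

/-- The comparison is asked only on histories of positive probability, because the maximum
likelihood property carries no information where the policy factor vanishes. -/
theorem ObsModel.expect_mono (m : ObsModel M U Y) (φ : Policy U Y) (i : Fin M) {n : ℕ}
    {f g : Hist U Y n → ℝ} (h : ∀ x, 0 < m.jointPmf φ i x → f x ≤ g x) :
    m.expect φ i f ≤ m.expect φ i g := by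
  refine Finset.sum_le_sum fun x _ => ?_
  rcases (m.jointPmf_nonneg φ i x).eq_or_lt with h0 | h0
  · simp [← h0]
  · exact mul_le_mul_of_nonneg_left (h x h0) h0.le

theorem ObsModel.expect_congr (m : ObsModel M U Y) (φ : Policy U Y) (i : Fin M) {n : ℕ}
    {f g : Hist U Y n → ℝ} (h : ∀ x, f x = g x) : m.expect φ i f = m.expect φ i g := by
  rw [funext h]

theorem ObsModel.expect_add (m : ObsModel M U Y) (φ : Policy U Y) (i : Fin M) {n : ℕ}
    (f g : Hist U Y n → ℝ) :
    m.expect φ i (fun h => f h + g h) = m.expect φ i f + m.expect φ i g := by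
  simp [ObsModel.expect, mul_add, Finset.sum_add_distrib]

theorem ObsModel.expect_sub (m : ObsModel M U Y) (φ : Policy U Y) (i : Fin M) {n : ℕ}
    (f g : Hist U Y n → ℝ) :
    m.expect φ i (fun h => f h - g h) = m.expect φ i f - m.expect φ i g := by
  simp [ObsModel.expect, mul_sub, Finset.sum_sub_distrib]

theorem ObsModel.expect_const_mul (m : ObsModel M U Y) (φ : Policy U Y) (i : Fin M) {n : ℕ}
    (a : ℝ) (f : Hist U Y n → ℝ) : m.expect φ i (fun h => a * f h) = a * m.expect φ i f := by
  simp only [ObsModel.expect, Finset.mul_sum]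
  exact Finset.sum_congr rfl fun z _ => by ring

theorem ObsModel.expect_sum (m : ObsModel M U Y) (φ : Policy U Y) (i : Fin M) {n : ℕ}
    {ι : Type*} (s : Finset ι) (f : ι → Hist U Y n → ℝ) :
    m.expect φ i (fun h => ∑ k ∈ s, f k h) = ∑ k ∈ s, m.expect φ i (f k) := by
  simp only [ObsModel.expect, Finset.mul_sum]
  exact Finset.sum_comm

theorem ObsModel.expect_nonneg (m : ObsModel M U Y) (φ : Policy U Y) (i : Fin M) {n : ℕ}
    {f : Hist U Y n → ℝ} (h : ∀ x, 0 ≤ f x) : 0 ≤ m.expect φ i f :=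
  Finset.sum_nonneg fun x _ => mul_nonneg (m.jointPmf_nonneg φ i x) (h x)

/-- An additive functional whose one-step exponential moments are at most `r` has exponential
moment at most `r ^ n` at time `n`. -/
theorem ObsModel.expect_exp_pathSum_le (m : ObsModel M U Y) (φ : Policy U Y) (i : Fin M)
    (F : (k : ℕ) → Hist U Y k → U × Y → ℝ) {r : ℝ} (hr : 0 ≤ r)
    (hF : ∀ k h, m.stepMean i (φ k h) (m.lastObs h) (fun z => Real.exp (F k h z)) ≤ r) (n : ℕ) :
    (m.expect φ i fun h : Hist U Y n => Real.exp (h.pathSum F)) ≤ r ^ n := by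
  induction n with
  | zero => simp [m.expect_zero]
  | succ n ih =>
    rw [m.expect_succ]
    calc _ = m.expect φ i fun h : Hist U Y n => Real.exp (h.pathSum F) *
          m.stepMean i (φ n h) (m.lastObs h) (fun z => Real.exp (F n h z)) := by
          refine m.expect_congr _ _ fun h => ?_
          rw [← m.stepMean_const_mul]
          simp [Real.exp_add]
      _ ≤ m.expect φ i fun h : Hist U Y n => r * Real.exp (h.pathSum F) :=
          m.expect_mono _ _ fun h _ => by
            rw [mul_comm r]
            exact mul_le_mul_of_nonneg_left (hF n h) (Real.exp_pos _).le
      _ ≤ r ^ (n + 1) := by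
          rw [m.expect_const_mul, pow_succ']
          exact mul_le_mul_of_nonneg_left ih hr

/-- The log-likelihood ratio of hypothesis `i` against hypothesis `j` of one step. -/
noncomputable def ObsModel.stepLlr (m : ObsModel M U Y) (i j : Fin M) (k : ℕ) (h : Hist U Y k)
    (z : U × Y) : ℝ :=
  Real.log (m.p i z.1 (m.lastObs h) z.2 / m.p j z.1 (m.lastObs h) z.2)

/-- The log-likelihood ratio of hypothesis `i` against hypothesis `j` of a history. -/
noncomputable def ObsModel.llr (m : ObsModel M U Y) (i j : Fin M) {n : ℕ} (h : Hist U Y n) : ℝ :=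
  h.pathSum (m.stepLlr i j)

theorem ObsModel.exp_neg_stepLlr (m : ObsModel M U Y) (i j : Fin M) {k : ℕ} (h : Hist U Y k)
    (z : U × Y) :
    Real.exp (-m.stepLlr i j k h z) =
      m.p j z.1 (m.lastObs h) z.2 / m.p i z.1 (m.lastObs h) z.2 := by
  rw [ObsModel.stepLlr, ← Real.log_inv, inv_div,
    Real.exp_log (div_pos (m.p_pos _ _ _ _) (m.p_pos _ _ _ _))]

/-- The policy factors agree under all hypotheses, so only the transition probabilities enter the
ratio. The multiplicative form stays valid where the joint pmf is zero, and makes changes of measure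
finite sums. -/
theorem ObsModel.jointPmf_eq_mul_exp (m : ObsModel M U Y) (φ : Policy U Y) (i j : Fin M) {n : ℕ}
    (h : Hist U Y n) :
    m.jointPmf φ j h = m.jointPmf φ i h * Real.exp (-m.llr i j h) := by
  induction n with
  | zero => simp [ObsModel.llr, ObsModel.jointPmf]
  | succ n ih =>
    rw [← h.snoc_take_last, m.jointPmf_snoc, m.jointPmf_snoc, ih, ObsModel.llr, ObsModel.llr,
      Hist.pathSum_snoc, neg_add, Real.exp_add, m.exp_neg_stepLlr]
    have := (m.p_pos i (h (Fin.last n)).1 (m.lastObs (h.take n n.le_succ)) (h (Fin.last n)).2).ne'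
    field_simp

theorem ObsModel.jointPmf_pos_iff (m : ObsModel M U Y) (φ : Policy U Y) (i j : Fin M) {n : ℕ}
    (h : Hist U Y n) : 0 < m.jointPmf φ j h ↔ 0 < m.jointPmf φ i h := by
  rw [m.jointPmf_eq_mul_exp φ i j]
  exact mul_pos_iff_of_pos_right (Real.exp_pos _)

end Expectation

/-! ### Expectations of history functions as integrals over path space -/

section Integrals

variable {M : ℕ} {U Y : Type*} [Fintype U] [Fintype Y]
  [MeasurableSpace U] [DiscreteMeasurableSpace U] [MeasurableSpace Y] [DiscreteMeasurableSpace Y]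


theorem measurable_hist (n : ℕ) : Measurable (hist n : SamplePath U Y → Hist U Y n) :=
  measurable_pi_lambda _ fun _ => measurable_pi_apply _

theorem measurable_comp_hist {β : Type*} [MeasurableSpace β] {n : ℕ} (f : Hist U Y n → β) :
    Measurable fun ω : SamplePath U Y => f (hist n ω) :=
  (measurable_of_countable f).comp (measurable_hist n)

theorem ObsModel.lintegral_hist (m : ObsModel M U Y) (φ : Policy U Y) (i : Fin M) {n : ℕ}
    (f : Hist U Y n → ℝ≥0∞) :
    ∫⁻ ω, f (hist n ω) ∂(m.law φ i) = ∑ h, ENNReal.ofReal (m.jointPmf φ i h) * f h := by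
  rw [← lintegral_map (measurable_of_countable f) (measurable_hist n), lintegral_fintype]
  refine Finset.sum_congr rfl fun h _ => ?_
  rw [Measure.map_apply (measurable_hist n) (measurableSet_singleton _), mul_comm,
    ← m.law_hist_eq φ i h]
  rfl

theorem ObsModel.lintegral_ofReal_hist (m : ObsModel M U Y) (φ : Policy U Y) (i : Fin M) {n : ℕ}
    {f : Hist U Y n → ℝ} (hf : ∀ h, 0 ≤ f h) :
    ∫⁻ ω, ENNReal.ofReal (f (hist n ω)) ∂(m.law φ i) = ENNReal.ofReal (m.expect φ i f) := by
  rw [m.lintegral_hist φ i fun h => ENNReal.ofReal (f h), ObsModel.expect,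
    ENNReal.ofReal_sum_of_nonneg fun h _ => mul_nonneg (m.jointPmf_nonneg φ i h) (hf h)]
  exact Finset.sum_congr rfl fun h _ => (ENNReal.ofReal_mul (m.jointPmf_nonneg φ i h)).symm

theorem ObsModel.law_real_hist (m : ObsModel M U Y) (φ : Policy U Y) (i : Fin M) {n : ℕ}
    (S : Set (Hist U Y n)) :
    (m.law φ i).real (hist n ⁻¹' S) = m.expect φ i (S.indicator 1) := by
  have h0 : ∀ h, 0 ≤ S.indicator (1 : Hist U Y n → ℝ) h :=
    fun h => Set.indicator_nonneg (fun _ _ => zero_le_one) h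
  have h1 := m.lintegral_ofReal_hist φ i h0
  have h2 : ∀ ω, ENNReal.ofReal (S.indicator (1 : Hist U Y n → ℝ) (hist n ω)) =
      (hist n ⁻¹' S).indicator 1 ω := by
    intro ω
    by_cases hS : hist n ω ∈ S
    · rw [Set.indicator_of_mem hS, Set.indicator_of_mem (by exact hS)]; simp
    · rw [Set.indicator_of_notMem hS, Set.indicator_of_notMem (by exact hS)]; simp
  simp_rw [h2] at h1
  rw [lintegral_indicator_one ((measurable_hist n) (Set.to_countable S).measurableSet)] at h1
  rw [measureReal_def, h1, ENNReal.toReal_ofReal (m.expect_nonneg φ i h0)]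

theorem ObsModel.ae_jointPmf_pos (m : ObsModel M U Y) (φ : Policy U Y) (i : Fin M) :
    ∀ᵐ ω ∂(m.law φ i), ∀ n, 0 < m.jointPmf φ i (hist n ω) := by
  rw [ae_all_iff]
  intro n
  have hlin := m.lintegral_hist φ i (n := n) ({h | ¬ 0 < m.jointPmf φ i h}.indicator 1)
  rw [Finset.sum_eq_zero] at hlin
  · rw [lintegral_eq_zero_iff (measurable_comp_hist _)] at hlin
    filter_upwards [hlin] with ω hω
    by_contra hcon
    rw [Set.indicator_of_mem (by exact hcon)] at hω
    simp at hω
  · intro h _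
    by_cases hh : 0 < m.jointPmf φ i h
    · rw [Set.indicator_of_notMem (by simpa using hh), mul_zero]
    · rw [ENNReal.ofReal_of_nonpos (not_lt.mp hh), zero_mul]

end Integrals

/-! ### Stationary distributions and the optimal rate -/

section Doeblin

variable {Y : Type*} [Fintype Y]

/-- Doeblin contraction: since `w` has total mass zero, subtracting `δ` from every entry of `P` does
not change the image of `w`, and the reduced matrix is nonnegative with row sums `1 - |Y| δ`. -/
theorem sum_abs_vecMul_le {P : Y → Y → ℝ} {δ : ℝ} (hδ : ∀ x y, δ ≤ P x y)
    (hsum : ∀ x, ∑ y, P x y = 1) {w : Y → ℝ} (hw : ∑ y, w y = 0) :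
    ∑ y, |∑ x, w x * P x y| ≤ (1 - Fintype.card Y * δ) * ∑ y, |w y| := by
  calc ∑ y, |∑ x, w x * P x y| ≤ ∑ y, ∑ x, |w x| * (P x y - δ) := by
        refine Finset.sum_le_sum fun y _ => ?_
        have h1 : ∑ x, w x * P x y = ∑ x, w x * (P x y - δ) := by
          simp only [mul_sub, Finset.sum_sub_distrib, ← Finset.sum_mul, hw, zero_mul, sub_zero]
        rw [h1]
        refine (Finset.abs_sum_le_sum_abs _ _).trans (le_of_eq ?_)
        refine Finset.sum_congr rfl fun x _ => ?_
        rw [abs_mul, abs_of_nonneg (sub_nonneg.mpr (hδ x y))]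
    _ = (1 - Fintype.card Y * δ) * ∑ y, |w y| := by
        rw [Finset.sum_comm, Finset.mul_sum]
        refine Finset.sum_congr rfl fun x _ => ?_
        rw [← Finset.mul_sum, Finset.sum_sub_distrib, hsum]
        simp [mul_comm]

/-- An almost invariant measure is close to the multiple of the stationary distribution of the
same mass. -/
theorem IsStationaryDist.sum_abs_sub_le {P : Y → Y → ℝ} {δ : ℝ} (hδ : ∀ x y, δ ≤ P x y)
    (hsum : ∀ x, ∑ y, P x y = 1) {μ : stdSimplex ℝ Y} (hμ : IsStationaryDist P μ) (ν : Y → ℝ) :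
    Fintype.card Y * δ * ∑ y, |ν y - (∑ x, ν x) * μ y| ≤ ∑ y, |∑ x, ν x * P x y - ν y| := by
  set w : Y → ℝ := fun y => ν y - (∑ x, ν x) * μ y with hw
  have hw0 : ∑ y, w y = 0 := by
    simp only [hw, Finset.sum_sub_distrib, ← Finset.mul_sum, stdSimplex.sum_eq_one, mul_one,
      sub_self]
  have h1 := sum_abs_vecMul_le hδ hsum hw0
  have h2 : ∀ y, ∑ x, ν x * P x y - ν y = ∑ x, w x * P x y - w y := by
    intro y
    simp only [hw, sub_mul, Finset.sum_sub_distrib, mul_assoc, ← Finset.mul_sum]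
    rw [← hμ y]
    ring
  have h3 : ∑ y, |w y| ≤ ∑ y, |∑ x, w x * P x y| + ∑ y, |∑ x, ν x * P x y - ν y| := by
    rw [← Finset.sum_add_distrib]
    refine Finset.sum_le_sum fun y _ => ?_
    rw [h2 y]
    have := abs_sub (∑ x, w x * P x y) (∑ x, w x * P x y - w y)
    simpa using this
  -- `h1` and `h3` bound the norm of `w` by `1 - |Y| δ` times itself plus the invariance defect of
  -- `ν`; rearrange.
  nlinarith

theorem IsStationaryDist.pos {P : Y → Y → ℝ} (hP : ∀ x y, 0 < P x y) {μ : stdSimplex ℝ Y}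
    (hμ : IsStationaryDist P μ) (y : Y) : 0 < μ y := by
  rw [hμ y]
  obtain ⟨x, -, hx⟩ : ∃ x ∈ Finset.univ, 0 < μ x :=
    Finset.exists_lt_of_sum_lt (f := fun _ : Y => (0 : ℝ)) (by simp)
  exact Finset.sum_pos' (fun x _ => mul_nonneg (stdSimplex.zero_le _ _) (hP _ _).le)
    ⟨x, Finset.mem_univ x, mul_pos hx (hP _ _)⟩

/-- The Poisson equation of a strictly positive transition matrix is solvable. -/
theorem IsStationaryDist.exists_poisson {P : Y → Y → ℝ} (hP : ∀ x y, 0 < P x y)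
    (hsum : ∀ x, ∑ y, P x y = 1) {μ : stdSimplex ℝ Y} (hμ : IsStationaryDist P μ) (g : Y → ℝ) :
    ∃ h : Y → ℝ, ∀ x, g x + ∑ y, P x y * h y - h x = ∑ y, μ y * g y := by
  have hinv : ∀ f : Y → ℝ, ∑ x, μ x * ∑ y, P x y * f y = ∑ y, μ y * f y := by
    intro f
    calc ∑ x, μ x * ∑ y, P x y * f y = ∑ x, ∑ y, μ x * P x y * f y := by
          simp only [Finset.mul_sum, mul_assoc]
      _ = ∑ y, μ y * f y := by
          rw [Finset.sum_comm]
          refine Finset.sum_congr rfl fun y _ => ?_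
          rw [← Finset.sum_mul, ← hμ y]
  -- The rank-one term added to `1 - P` removes the constants from the kernel, so the map becomes
  -- injective, hence surjective in finite dimension. A preimage of `g` solves the Poisson equation
  -- because `μ` annihilates the image of `1 - P`.
  let A : (Y → ℝ) →ₗ[ℝ] (Y → ℝ) :=
    { toFun := fun f x => f x - ∑ y, P x y * f y + ∑ y, μ y * f y
      map_add' := by
        intro f f'
        funext x
        simp only [Pi.add_apply, mul_add, Finset.sum_add_distrib]
        ring
      map_smul' := by
        intro a f
        funext x
        simp only [Pi.smul_apply, smul_eq_mul, RingHom.id_apply, mul_left_comm _ a,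
          ← Finset.mul_sum]
        ring }
  have hAμ : ∀ f : Y → ℝ, ∑ x, μ x * A f x = ∑ y, μ y * f y := by
    intro f
    change ∑ x, μ x * (f x - ∑ y, P x y * f y + ∑ y, μ y * f y) = _
    simp only [mul_add, mul_sub, Finset.sum_add_distrib, Finset.sum_sub_distrib, hinv,
      ← Finset.sum_mul, stdSimplex.sum_eq_one]
    ring
  have hinj : Function.Injective A := by
    rw [injective_iff_map_eq_zero]
    intro f hf
    have h0 : ∑ y, μ y * f y = 0 := by
      rw [← hAμ f, hf]
      simp
    have hharm : ∀ x, f x = ∑ y, P x y * f y := by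
      intro x
      have : f x - ∑ y, P x y * f y + ∑ y, μ y * f y = 0 := congrFun hf x
      linarith
    rcases isEmpty_or_nonempty Y with hY | hY
    · exact Subsingleton.elim _ _
    -- Maximum principle: at a maximizer, a harmonic function is an average of its values with
    -- strictly positive weights, so it is constant.
    obtain ⟨x, hx⟩ := Finite.exists_max f
    have hz : ∑ y, P x y * (f x - f y) = 0 := by
      simp only [mul_sub, Finset.sum_sub_distrib, ← Finset.sum_mul, hsum]
      rw [← hharm x]
      ring
    have hconst : ∀ y, f y = f x := by
      intro y
      have := (Finset.sum_eq_zero_iff_of_nonneg fun y _ =>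
        mul_nonneg (hP x y).le (sub_nonneg.mpr (hx y))).mp hz y (Finset.mem_univ y)
      rcases mul_eq_zero.mp this with h | h
      · exact absurd h (hP x y).ne'
      · linarith
    have hx0 : f x = 0 := by
      rw [← h0]
      simp only [hconst, ← Finset.sum_mul, stdSimplex.sum_eq_one, one_mul]
    funext y
    rw [hconst y, hx0]
    rfl
  obtain ⟨h, hh⟩ := LinearMap.injective_iff_surjective.mp hinj g
  refine ⟨h, fun x => ?_⟩
  have h1 : h x - ∑ y, P x y * h y + ∑ y, μ y * h y = g x := congrFun hh x
  have h2 := hAμ h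
  rw [hh] at h2
  linarith

end Doeblin

/-! ### Continuity, attainment and positivity of the optimal rate -/

section Rate

variable {M : ℕ} {U Y : Type*} [Fintype U] [Fintype Y]

theorem ObsModel.exists_le_p (m : ObsModel M U Y) :
    ∃ δ : ℝ, 0 < δ ∧ δ ≤ 1 ∧ ∀ i u y' y, δ ≤ m.p i u y' y := by
  rcases isEmpty_or_nonempty (Fin M × U × Y × Y) with h | h
  · exact ⟨1, one_pos, le_rfl, fun i u y' y => (h.false (i, u, y', y)).elim⟩
  · obtain ⟨z, hz⟩ := Finite.exists_min fun z : Fin M × U × Y × Y => m.p z.1 z.2.1 z.2.2.1 z.2.2.2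
    refine ⟨m.p z.1 z.2.1 z.2.2.1 z.2.2.2, m.p_pos _ _ _ _, ?_, fun i u y' y => hz (i, u, y', y)⟩
    rw [← m.p_sum z.1 z.2.1 z.2.2.1]
    exact Finset.single_le_sum (f := fun y => m.p z.1 z.2.1 z.2.2.1 y)
      (fun y _ => (m.p_pos _ _ _ _).le) (Finset.mem_univ _)

theorem ObsModel.le_mixed (m : ObsModel M U Y) {δ : ℝ} (hδ : ∀ i u y' y, δ ≤ m.p i u y' y)
    (i : Fin M) (q : StatPolicy U Y) (y' y : Y) : δ ≤ m.mixed i q y' y := by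
  calc δ = ∑ u, q y' u * δ := by rw [← Finset.sum_mul, stdSimplex.sum_eq_one, one_mul]
    _ ≤ m.mixed i q y' y := Finset.sum_le_sum fun u _ =>
        mul_le_mul_of_nonneg_left (hδ _ _ _ _) (stdSimplex.zero_le _ _)

theorem ObsModel.mixed_pos (m : ObsModel M U Y) (i : Fin M) (q : StatPolicy U Y) (y' y : Y) :
    0 < m.mixed i q y' y := by
  obtain ⟨δ, h0, -, hδ⟩ := m.exists_le_p
  exact h0.trans_le (m.le_mixed hδ i q y' y)

theorem ObsModel.sum_mixed (m : ObsModel M U Y) (i : Fin M) (q : StatPolicy U Y) (y' : Y) :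
    ∑ y, m.mixed i q y' y = 1 := by
  simp only [ObsModel.mixed]
  rw [Finset.sum_comm]
  simp [← Finset.mul_sum, m.p_sum]

theorem ObsModel.isStationaryDist_statDist (m : ObsModel M U Y) (i : Fin M) (q : StatPolicy U Y) :
    IsStationaryDist (m.mixed i q) (m.statDist i q) :=
  (m.existsUnique_stationary i q).choose_spec.1

theorem ObsModel.statDist_pos (m : ObsModel M U Y) (i : Fin M) (q : StatPolicy U Y) (y : Y) :
    0 < m.statDist i q y :=
  (m.isStationaryDist_statDist i q).pos (m.mixed_pos i q) y

/-- The stationary distribution for `q` is almost invariant for the kernel of `q₀`, with a defect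
controlled by the difference of the kernels; the Doeblin bound turns this into closeness of the two
stationary distributions, since the minorization constant does not depend on the policy. -/
theorem ObsModel.continuous_statDist (m : ObsModel M U Y) (i : Fin M) (y : Y) :
    Continuous fun q : StatPolicy U Y => m.statDist i q y := by
  obtain ⟨δ, h0, -, hδ⟩ := m.exists_le_p
  have : Nonempty Y := ⟨m.y₀⟩
  have hκ : 0 < Fintype.card Y * δ := by
    have : 0 < (Fintype.card Y : ℝ) := by exact_mod_cast Fintype.card_pos
    positivity
  have hcoe : ∀ (y' : Y) (u : U), Continuous fun q : StatPolicy U Y => q y' u := fun y' u =>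
    (continuous_apply u).comp (continuous_subtype_val.comp (continuous_apply y'))
  have hmix : ∀ y' y, Continuous fun q : StatPolicy U Y => m.mixed i q y' y := fun y' y =>
    continuous_finsetSum _ fun u _ => (hcoe y' u).mul continuous_const
  rw [continuous_iff_continuousAt]
  intro q₀
  have hb : ∀ q, |m.statDist i q y - m.statDist i q₀ y| ≤
      (Fintype.card Y * δ)⁻¹ * ∑ y, ∑ x, |m.mixed i q₀ x y - m.mixed i q x y| := by
    intro q
    rw [inv_mul_eq_div, le_div_iff₀' hκ]
    have h1 := (m.isStationaryDist_statDist i q₀).sum_abs_sub_le (m.le_mixed hδ i q₀)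
      (m.sum_mixed i q₀) (m.statDist i q)
    rw [stdSimplex.sum_eq_one] at h1
    simp only [one_mul] at h1
    refine le_trans (mul_le_mul_of_nonneg_left ?_ hκ.le) (h1.trans ?_)
    · exact Finset.single_le_sum (f := fun y => |m.statDist i q y - m.statDist i q₀ y|)
        (fun _ _ => abs_nonneg _) (Finset.mem_univ y)
    · refine Finset.sum_le_sum fun y _ => ?_
      conv_lhs => rw [m.isStationaryDist_statDist i q y, ← Finset.sum_sub_distrib]
      refine (Finset.abs_sum_le_sum_abs _ _).trans (Finset.sum_le_sum fun x _ => ?_)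
      rw [← mul_sub, abs_mul, abs_of_nonneg (stdSimplex.zero_le _ _)]
      exact mul_le_of_le_one_left (abs_nonneg _) (stdSimplex.le_one _ _)
  rw [ContinuousAt, tendsto_iff_norm_sub_tendsto_zero]
  refine squeeze_zero (fun _ => norm_nonneg _) hb ?_
  have hc : Continuous fun q : StatPolicy U Y =>
      (Fintype.card Y * δ)⁻¹ * ∑ y, ∑ x, |m.mixed i q₀ x y - m.mixed i q x y| :=
    continuous_const.mul (continuous_finsetSum _ fun y _ => continuous_finsetSum _ fun x _ =>
      (continuous_const.sub (hmix x y)).abs)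
  simpa using hc.tendsto q₀

theorem ObsModel.continuous_statMean (m : ObsModel M U Y) (i : Fin M) (f : Y → U → ℝ) :
    Continuous fun q : StatPolicy U Y => m.statMean i q f :=
  continuous_finsetSum _ fun y' _ => continuous_finsetSum _ fun u _ =>
    ((m.continuous_statDist i y').mul
      ((continuous_apply u).comp (continuous_subtype_val.comp (continuous_apply y')))).mul
      continuous_const

theorem ObsModel.statMean_eq (m : ObsModel M U Y) (i : Fin M) (q : StatPolicy U Y)
    (f : Y → U → ℝ) :
    m.statMean i q f = ∑ y', m.statDist i q y' * ∑ u, q y' u * f y' u := by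
  simp only [ObsModel.statMean, Finset.mul_sum, mul_assoc]

theorem ObsModel.statMean_const (m : ObsModel M U Y) (i : Fin M) (q : StatPolicy U Y) (a : ℝ) :
    (m.statMean i q fun _ _ => a) = a := by
  simp [m.statMean_eq, ← Finset.sum_mul]

theorem ObsModel.statMean_mono (m : ObsModel M U Y) (i : Fin M) (q : StatPolicy U Y)
    {f g : Y → U → ℝ} (h : ∀ y' u, f y' u ≤ g y' u) : m.statMean i q f ≤ m.statMean i q g :=
  Finset.sum_le_sum fun y' _ => Finset.sum_le_sum fun u _ => mul_le_mul_of_nonneg_left (h y' u)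
    (mul_nonneg (stdSimplex.zero_le _ _) (stdSimplex.zero_le _ _))

theorem ObsModel.statMean_pos [Nonempty U] (m : ObsModel M U Y) (i : Fin M) (q : StatPolicy U Y)
    {f : Y → U → ℝ} (h : ∀ y' u, 0 < f y' u) : 0 < m.statMean i q f := by
  have : Nonempty Y := ⟨m.y₀⟩
  obtain ⟨z, hz⟩ := Finite.exists_min fun z : Y × U => f z.1 z.2
  refine (h z.1 z.2).trans_le ?_
  rw [← m.statMean_const i q (f z.1 z.2)]
  exact m.statMean_mono i q fun y' u => hz (y', u)

/-- Gibbs' inequality: `log x ≤ x - 1` makes each term at least `p y - q y`, strictly where the pmfs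
differ, and these differences sum to zero. -/
theorem klDist_pos_of_ne {p q : Y → ℝ} (hp : ∀ y, 0 < p y) (hq : ∀ y, 0 < q y)
    (hp1 : ∑ y, p y = 1) (hq1 : ∑ y, q y = 1) (hne : ∃ y, p y ≠ q y) : 0 < klDist p q := by
  obtain ⟨y, hy⟩ := hne
  have h0 : ∑ y, (p y - q y) = 0 := by rw [Finset.sum_sub_distrib, hp1, hq1, sub_self]
  rw [← h0]
  have hinv : ∀ y, Real.log (p y / q y) = -Real.log (q y / p y) := fun y => by
    rw [← Real.log_inv, inv_div]
  have hdiv : ∀ y, p y * (q y / p y) = q y := fun y => by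
    have := (hp y).ne'
    field_simp
  refine Finset.sum_lt_sum (fun z _ => ?_) ⟨y, Finset.mem_univ y, ?_⟩
  · have := Real.log_le_sub_one_of_pos (div_pos (hq z) (hp z))
    rw [hinv]
    nlinarith [hdiv z, hp z]
  · have := Real.log_lt_sub_one_of_pos (div_pos (hq y) (hp y)) (by
      rw [Ne, div_eq_one_iff_eq (hp y).ne']
      exact fun h => hy h.symm)
    rw [hinv]
    nlinarith [hdiv y, hp y]

theorem klDist_nonneg_of_pos {p q : Y → ℝ} (hp : ∀ y, 0 < p y) (hq : ∀ y, 0 < q y)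
    (hp1 : ∑ y, p y = 1) (hq1 : ∑ y, q y = 1) : 0 ≤ klDist p q := by
  by_cases h : ∃ y, p y ≠ q y
  · exact (klDist_pos_of_ne hp hq hp1 hq1 h).le
  · push Not at h
    refine Finset.sum_nonneg fun y _ => ?_
    rw [h y, div_self (hq y).ne', Real.log_one, mul_zero]

theorem barycenter_coe [Nonempty U] (u : U) :
    (stdSimplex.barycenter : stdSimplex ℝ U) u = (Fintype.card U : ℝ)⁻¹ := rfl

/-- The stationary information of hypothesis `i` against `j`. -/
noncomputable def ObsModel.info (m : ObsModel M U Y) (i j : Fin M) (q : StatPolicy U Y) : ℝ :=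
  m.statMean i q fun y' u => klDist (m.p i u y') (m.p j u y')

theorem nonempty_ne (hM : 2 ≤ M) (i : Fin M) : Nonempty {j : Fin M // j ≠ i} := by
  have : Nontrivial (Fin M) := Fin.nontrivial_iff_two_le.mpr hM
  obtain ⟨j, hj⟩ := exists_ne i
  exact ⟨⟨j, hj⟩⟩

theorem ObsModel.continuous_rate [Nonempty U] (m : ObsModel M U Y) (hM : 2 ≤ M) {c : U → ℝ}
    (hc : ∀ u, 0 < c u) (i : Fin M) : Continuous (m.rate c i) := by
  have := nonempty_ne hM i
  refine Continuous.div ?_ (m.continuous_statMean i _) fun q =>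
    (m.statMean_pos i q fun _ u => hc u).ne'
  simp only [← Finset.inf'_univ_eq_ciInf]
  exact Continuous.finset_inf'_apply _ fun j _ => m.continuous_statMean i _

theorem ObsModel.exists_isMax_rate [Nonempty U] (m : ObsModel M U Y) (hM : 2 ≤ M) {c : U → ℝ}
    (hc : ∀ u, 0 < c u) (i : Fin M) : ∃ q, ∀ q', m.rate c i q' ≤ m.rate c i q := by
  obtain ⟨q, -, hq⟩ := isCompact_univ.exists_isMaxOn Set.univ_nonempty
    (m.continuous_rate hM hc i).continuousOn
  exact ⟨q, fun q' => hq (Set.mem_univ q')⟩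

theorem ObsModel.optRate_eq_of_isMax (m : ObsModel M U Y) {c : U → ℝ} {i : Fin M}
    {q : StatPolicy U Y} (hq : ∀ q', m.rate c i q' ≤ m.rate c i q) :
    m.optRate c i = m.rate c i q := by
  have : Nonempty (StatPolicy U Y) := ⟨q⟩
  exact le_antisymm (ciSup_le hq) (le_ciSup ⟨_, Set.forall_mem_range.mpr hq⟩ q)

/-- The uniform policy gives every pair (observation, control) positive stationary weight, so one
pair that separates `i` from `j` makes the information positive. -/
theorem ObsModel.optRate_pos [Nonempty U] (m : ObsModel M U Y) (hM : 2 ≤ M)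
    (hdist : ∀ i j, i ≠ j → ∃ u y' y, m.p i u y' y ≠ m.p j u y' y) {c : U → ℝ}
    (hc : ∀ u, 0 < c u) (i : Fin M) : 0 < m.optRate c i := by
  obtain ⟨q, hq⟩ := m.exists_isMax_rate hM hc i
  rw [m.optRate_eq_of_isMax hq]
  refine lt_of_lt_of_le ?_ (hq fun _ => stdSimplex.barycenter)
  have := nonempty_ne hM i
  refine div_pos ?_ (m.statMean_pos i _ fun _ u => hc u)
  obtain ⟨j, hj⟩ := exists_eq_ciInf_of_finite (f := fun j : {j : Fin M // j ≠ i} =>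
    m.statMean i (fun _ => stdSimplex.barycenter) fun y' u => klDist (m.p i u y') (m.p j u y'))
  rw [← hj]
  obtain ⟨u, y', hy⟩ := hdist i j j.2.symm
  have hu : ∀ v, (0 : ℝ) < (stdSimplex.barycenter : stdSimplex ℝ U) v := fun v => by
    rw [barycenter_coe]
    exact inv_pos.mpr (by exact_mod_cast Fintype.card_pos)
  have hn : ∀ x v, 0 ≤ m.statDist i (fun _ => stdSimplex.barycenter) x *
      (stdSimplex.barycenter : stdSimplex ℝ U) v * klDist (m.p i v x) (m.p j v x) := fun x v =>
    mul_nonneg (mul_nonneg (stdSimplex.zero_le _ _) (hu v).le)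
      (klDist_nonneg_of_pos (m.p_pos _ _ _) (m.p_pos _ _ _) (m.p_sum _ _ _) (m.p_sum _ _ _))
  refine Finset.sum_pos' (fun x _ => Finset.sum_nonneg fun v _ => hn x v)
    ⟨y', Finset.mem_univ _, Finset.sum_pos' (fun v _ => hn y' v) ⟨u, Finset.mem_univ _, ?_⟩⟩
  exact mul_pos (mul_pos (m.statDist_pos _ _ _) (hu u))
    (klDist_pos_of_ne (m.p_pos _ _ _) (m.p_pos _ _ _) (m.p_sum _ _ _) (m.p_sum _ _ _) hy)

/-- The minimal stationary information is at most the optimal rate times the stationary cost. -/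
theorem ObsModel.iInf_info_le [Nonempty U] (m : ObsModel M U Y) (hM : 2 ≤ M) {c : U → ℝ}
    (hc : ∀ u, 0 < c u) (i : Fin M) (q : StatPolicy U Y) :
    (⨅ j : {j : Fin M // j ≠ i}, m.info i j q) ≤
      m.optRate c i * m.statMean i q fun _ u => c u := by
  obtain ⟨q', hq'⟩ := m.exists_isMax_rate hM hc i
  rw [← div_le_iff₀ (m.statMean_pos i q fun _ u => hc u), m.optRate_eq_of_isMax hq']
  exact hq' q

/-- Under an optimal stationary policy every alternative has information at least the optimal rate
times the stationary cost. -/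
theorem ObsModel.optRate_mul_le_info [Nonempty U] (m : ObsModel M U Y) {c : U → ℝ}
    (hc : ∀ u, 0 < c u) {i j : Fin M} (hj : j ≠ i) {q : StatPolicy U Y}
    (hq : ∀ q', m.rate c i q' ≤ m.rate c i q) :
    m.optRate c i * (m.statMean i q fun _ u => c u) ≤ m.info i j q := by
  rw [m.optRate_eq_of_isMax hq, ObsModel.rate, div_mul_cancel₀ _
    (m.statMean_pos i q fun _ u => hc u).ne']
  exact ciInf_le (Set.finite_range _).bddBelow (⟨j, hj⟩ : {j : Fin M // j ≠ i})

end Rate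

/-! ### Stopping -/

section Stopping

variable {M : ℕ} {U Y : Type*} [Fintype U] [MeasurableSpace U] [MeasurableSpace Y]

theorem hist_surjective [Nonempty (U × Y)] (n : ℕ) :
    Function.Surjective (hist n : SamplePath U Y → Hist U Y n) := by
  intro h
  refine ⟨fun k => if hk : k < n then h ⟨k, hk⟩ else Classical.arbitrary _, ?_⟩
  funext k
  exact dif_pos k.is_lt

/-- An event of `ℱ_l` is a preimage under `hist l`. This is what lets stopping be read as a function
of finite histories below. -/
theorem SeqTest.N_le_iff_of_hist_eq (γ : SeqTest M U Y) {ω ω' : SamplePath U Y} {k l : ℕ}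
    (hlk : l ≤ k) (h : hist k ω = hist k ω') : γ.N ω ≤ l ↔ γ.N ω' ≤ l := by
  obtain ⟨S, -, hS⟩ := γ.isStoppingTime l
  have h1 : ∀ ω, γ.N ω ≤ l ↔ hist l ω ∈ S := fun ω => (Set.ext_iff.mp hS ω).symm
  have h2 : hist l ω = hist l ω' := by
    rw [← take_hist k l hlk, h, take_hist]
  rw [h1, h1, h2]

theorem SeqTest.lt_N_iff_of_hist_eq (γ : SeqTest M U Y) {ω ω' : SamplePath U Y} {k : ℕ}
    (h : hist k ω = hist k ω') : k < γ.N ω ↔ k < γ.N ω' := by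
  simpa using (γ.N_le_iff_of_hist_eq le_rfl h).not

theorem SeqTest.N_eq_iff (γ : SeqTest M U Y) (ω : SamplePath U Y) (k : ℕ) :
    γ.N ω = k ↔ γ.N ω ≤ k ∧ ∀ l < k, ¬ γ.N ω ≤ l := by
  constructor
  · intro h
    refine ⟨h.le, fun l hl hle => ?_⟩
    rw [h] at hle
    exact absurd (ENat.natCast_le_natCast.mp hle) (not_le.mpr hl)
  · rintro ⟨h1, h2⟩
    obtain ⟨n, hn⟩ := ENat.ne_top_iff_exists.mp (ne_top_of_le_ne_top (ENat.natCast_ne_top k) h1)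
    rw [← hn] at h1 h2 ⊢
    have h1' := ENat.natCast_le_natCast.mp h1
    rcases h1'.lt_or_eq with h | h
    · exact absurd le_rfl (h2 n h)
    · rw [h]

theorem SeqTest.N_eq_iff_of_hist_eq (γ : SeqTest M U Y) {ω ω' : SamplePath U Y} {k : ℕ}
    (h : hist k ω = hist k ω') : γ.N ω = k ↔ γ.N ω' = k := by
  rw [γ.N_eq_iff, γ.N_eq_iff, γ.N_le_iff_of_hist_eq le_rfl h]
  refine and_congr_right' (forall₂_congr fun l hl => ?_)
  rw [γ.N_le_iff_of_hist_eq hl.le h]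

open Classical in
/-- The indicator that the test continues after the history `h`. -/
noncomputable def SeqTest.alive (γ : SeqTest M U Y) {n : ℕ} (h : Hist U Y n) : ℝ :=
  if ∃ ω, hist n ω = h ∧ (n : ℕ∞) < γ.N ω then 1 else 0

open Classical in
/-- The indicator that the test stops exactly at the end of the history `h`. -/
noncomputable def SeqTest.stops (γ : SeqTest M U Y) {n : ℕ} (h : Hist U Y n) : ℝ :=
  if ∃ ω, hist n ω = h ∧ γ.N ω = n then 1 else 0

open Classical in
theorem SeqTest.alive_hist (γ : SeqTest M U Y) (n : ℕ) (ω : SamplePath U Y) :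
    γ.alive (hist n ω) = if (n : ℕ∞) < γ.N ω then 1 else 0 := by
  unfold SeqTest.alive
  refine if_congr ⟨?_, fun h => ⟨ω, rfl, h⟩⟩ rfl rfl
  rintro ⟨ω', h1, h2⟩
  exact (γ.lt_N_iff_of_hist_eq h1).mp h2

open Classical in
theorem SeqTest.stops_hist (γ : SeqTest M U Y) (n : ℕ) (ω : SamplePath U Y) :
    γ.stops (hist n ω) = if γ.N ω = n then 1 else 0 := by
  unfold SeqTest.stops
  refine if_congr ⟨?_, fun h => ⟨ω, rfl, h⟩⟩ rfl rfl
  rintro ⟨ω', h1, h2⟩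
  exact (γ.N_eq_iff_of_hist_eq h1).mp h2

theorem SeqTest.alive_nonneg (γ : SeqTest M U Y) {n : ℕ} (h : Hist U Y n) : 0 ≤ γ.alive h := by
  unfold SeqTest.alive
  split_ifs <;> simp

theorem SeqTest.stops_nonneg (γ : SeqTest M U Y) {n : ℕ} (h : Hist U Y n) : 0 ≤ γ.stops h := by
  unfold SeqTest.stops
  split_ifs <;> simp

/-- A test still running after `h` either stops at the next time or goes on, whatever the next pair
is; this drives the telescoping sums. -/
theorem SeqTest.stops_add_alive_snoc [Nonempty (U × Y)] (γ : SeqTest M U Y) {n : ℕ}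
    (h : Hist U Y n) (z : U × Y) : γ.stops (h.snoc z) + γ.alive (h.snoc z) = γ.alive h := by
  obtain ⟨ω, hω⟩ := hist_surjective (n + 1) (h.snoc z)
  have hh : h = hist n ω := by
    rw [← take_hist (n + 1) n n.le_succ, hω, Hist.take_snoc]
  rw [← hω, hh, γ.stops_hist, γ.alive_hist, γ.alive_hist]
  generalize γ.N ω = N
  induction N using ENat.recTopCoe with
  | top => simp [ENat.natCast_lt_top, -Nat.cast_add]
  | coe k =>
    simp only [Nat.cast_inj, Nat.cast_lt]
    split_ifs <;> first | omega | norm_num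

theorem SeqTest.stops_add_alive_zero [Nonempty (U × Y)] (γ : SeqTest M U Y) (h : Hist U Y 0) :
    γ.stops h + γ.alive h = 1 := by
  obtain ⟨ω, rfl⟩ := hist_surjective 0 h
  rw [γ.stops_hist, γ.alive_hist]
  rcases eq_or_ne (γ.N ω) 0 with h | h
  · simp [h]
  · simp [h, pos_iff_ne_zero]

variable [Fintype Y]

/-- Optional stopping for additive functionals of the history. -/
theorem ObsModel.sum_expect_stops_pathSum [Nonempty (U × Y)] (m : ObsModel M U Y)
    (γ : SeqTest M U Y) (φ : Policy U Y) (i : Fin M) (F : (k : ℕ) → Hist U Y k → U × Y → ℝ)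
    (n : ℕ) :
    ∑ k ∈ Finset.range (n + 1), m.expect φ i (fun h : Hist U Y k => γ.stops h * h.pathSum F) +
      m.expect φ i (fun h : Hist U Y n => γ.alive h * h.pathSum F) =
    ∑ k ∈ Finset.range n, m.expect φ i fun h : Hist U Y k =>
      γ.alive h * m.stepMean i (φ k h) (m.lastObs h) (F k h) := by
  induction n with
  | zero => simp [m.expect_zero]
  | succ n ih =>
    rw [Finset.sum_range_succ]
    conv_rhs => rw [Finset.sum_range_succ, ← ih]
    -- Paths stopping at `n + 1` and paths surviving it are together the survivors of time `n`, so
    -- the only new contribution is the conditional mean of the last increment.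
    have : m.expect φ i (fun h : Hist U Y (n + 1) => γ.stops h * h.pathSum F) +
        m.expect φ i (fun h : Hist U Y (n + 1) => γ.alive h * h.pathSum F) =
        m.expect φ i (fun h : Hist U Y n => γ.alive h * h.pathSum F) +
        m.expect φ i (fun h : Hist U Y n =>
          γ.alive h * m.stepMean i (φ n h) (m.lastObs h) (F n h)) := by
      rw [← m.expect_add, ← m.expect_add, m.expect_succ]
      refine m.expect_congr _ _ fun h => ?_
      simp only [← add_mul, γ.stops_add_alive_snoc, Hist.pathSum_snoc]
      rw [m.stepMean_const_mul, m.stepMean_add, m.stepMean_const, mul_add]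
    linarith

theorem ObsModel.sum_expect_stops_add_alive [Nonempty (U × Y)] (m : ObsModel M U Y)
    (γ : SeqTest M U Y) (φ : Policy U Y) (i : Fin M) (n : ℕ) :
    ∑ k ∈ Finset.range (n + 1), m.expect φ i (fun h : Hist U Y k => γ.stops h) +
      m.expect φ i (fun h : Hist U Y n => γ.alive h) = 1 := by
  induction n with
  | zero => simp [m.expect_zero, γ.stops_add_alive_zero]
  | succ n ih =>
    rw [Finset.sum_range_succ, ← ih, add_assoc]
    congr 1
    rw [← m.expect_add, m.expect_succ]
    refine m.expect_congr _ _ fun h => ?_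
    simp only [γ.stops_add_alive_snoc, m.stepMean_const]

open Classical in
/-- The expected log-likelihood ratio at the stopping time (truncated at `n`) in terms of the
probabilities of deciding for `i` by time `n`. -/
theorem ObsModel.le_sum_expect_alive_stepLlr [Nonempty (U × Y)] (m : ObsModel M U Y)
    (γ : SeqTest M U Y) (φ : Policy U Y) (i j : Fin M) (x : ℝ) (n : ℕ) :
    x * ∑ k ∈ Finset.range (n + 1), m.expect φ i (fun h : Hist U Y k =>
        γ.stops h * if γ.decision k h = i then 1 else 0) -
      Real.exp x * ∑ k ∈ Finset.range (n + 1), m.expect φ j (fun h : Hist U Y k =>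
        γ.stops h * if γ.decision k h = i then 1 else 0) ≤
    ∑ k ∈ Finset.range n, m.expect φ i fun h : Hist U Y k =>
      γ.alive h * m.stepMean i (φ k h) (m.lastObs h) (m.stepLlr i j k h) := by
  rw [← m.sum_expect_stops_pathSum]
  -- Change of measure from `i` to `j`; it holds term by term over the finitely many histories.
  have hchange : ∀ (k : ℕ) (f : Hist U Y k → ℝ),
      m.expect φ i (fun h => f h * Real.exp (-m.llr i j h)) = m.expect φ j f := by
    intro k f
    unfold ObsModel.expect
    refine Finset.sum_congr rfl fun h _ => ?_
    rw [m.jointPmf_eq_mul_exp φ i j]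
    ring
  -- A tangent line of `exp`. It is used with `f = x` where the test decides for `i` and with `f =
  -- 0` elsewhere, including on the paths still running at time `n`.
  have hlog : ∀ l f : ℝ, f + 1 - Real.exp f * Real.exp (-l) ≤ l := by
    intro l f
    have := Real.add_one_le_exp (f - l)
    rw [← Real.exp_add, ← sub_eq_add_neg]
    linarith
  have hstops : ∀ k, x * m.expect φ i (fun h : Hist U Y k =>
        γ.stops h * if γ.decision k h = i then 1 else 0) +
      m.expect φ i (fun h : Hist U Y k => γ.stops h) - m.expect φ j (fun h : Hist U Y k => γ.stops h)
      - Real.exp x * m.expect φ j (fun h : Hist U Y k =>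
        γ.stops h * if γ.decision k h = i then 1 else 0) ≤
      m.expect φ i (fun h : Hist U Y k => γ.stops h * h.pathSum (m.stepLlr i j)) := by
    intro k
    rw [← hchange k, ← hchange k, ← m.expect_const_mul, ← m.expect_const_mul, ← m.expect_add,
      ← m.expect_sub, ← m.expect_sub]
    refine m.expect_mono _ _ fun h _ => ?_
    have h0 := γ.stops_nonneg h
    have h1 := (Real.exp_pos (-m.llr i j h)).le
    change _ ≤ γ.stops h * m.llr i j h
    split_ifs
    · have h2 := mul_le_mul_of_nonneg_left (hlog (m.llr i j h) x) h0
      have h3 := mul_nonneg h0 h1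
      linarith
    · have h2 := mul_le_mul_of_nonneg_left (hlog (m.llr i j h) 0) h0
      rw [Real.exp_zero] at h2
      linarith
  have halive : m.expect φ i (fun h : Hist U Y n => γ.alive h) -
      m.expect φ j (fun h : Hist U Y n => γ.alive h) ≤
      m.expect φ i (fun h : Hist U Y n => γ.alive h * h.pathSum (m.stepLlr i j)) := by
    rw [← hchange n, ← m.expect_sub]
    refine m.expect_mono _ _ fun h _ => ?_
    have h2 := mul_le_mul_of_nonneg_left (hlog (m.llr i j h) 0) (γ.alive_nonneg h)
    rw [Real.exp_zero] at h2
    change _ ≤ γ.alive h * m.llr i j h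
    linarith
  have hsum := Finset.sum_le_sum fun k (_ : k ∈ Finset.range (n + 1)) => hstops k
  simp only [Finset.sum_sub_distrib, Finset.sum_add_distrib, ← Finset.mul_sum] at hsum
  -- The constant terms cancel: stopping and survival probabilities add up to one under both
  -- hypotheses.
  have hi := m.sum_expect_stops_add_alive γ φ i n
  have hj := m.sum_expect_stops_add_alive γ φ j n
  linarith

end Stopping

/-! ### Occupation measures -/

section Occupation

variable {M : ℕ} {U Y : Type*} [Fintype U] [Fintype Y] [MeasurableSpace U] [MeasurableSpace Y]

open Classical in
/-- The expected number of times before the stopping time, truncated at `n`, at which the last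
observation is `y'` and the control is `u`. -/
noncomputable def ObsModel.occup (m : ObsModel M U Y) (γ : SeqTest M U Y) (i : Fin M) (n : ℕ)
    (y' : Y) (u : U) : ℝ :=
  ∑ k ∈ Finset.range n, m.expect γ.policy i fun h : Hist U Y k =>
    γ.alive h * if m.lastObs h = y' then γ.policy k h u else 0

theorem ObsModel.occup_nonneg (m : ObsModel M U Y) (γ : SeqTest M U Y) (i : Fin M) (n : ℕ)
    (y' : Y) (u : U) : 0 ≤ m.occup γ i n y' u :=
  Finset.sum_nonneg fun k _ => m.expect_nonneg _ _ fun h => mul_nonneg (γ.alive_nonneg h) (by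
    split_ifs
    · exact stdSimplex.zero_le _ _
    · exact le_rfl)

theorem ObsModel.sum_occup_mul (m : ObsModel M U Y) (γ : SeqTest M U Y) (i : Fin M) (n : ℕ)
    (f : Y → U → ℝ) :
    ∑ y', ∑ u, m.occup γ i n y' u * f y' u =
      ∑ k ∈ Finset.range n, m.expect γ.policy i fun h : Hist U Y k =>
        γ.alive h * ∑ u, γ.policy k h u * f (m.lastObs h) u := by
  classical
  unfold ObsModel.occup
  simp only [Finset.sum_mul]
  have hk : ∀ k, (m.expect γ.policy i fun h : Hist U Y k =>
        γ.alive h * ∑ u, γ.policy k h u * f (m.lastObs h) u) =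
      ∑ y', ∑ u, (m.expect γ.policy i fun h : Hist U Y k =>
        γ.alive h * if m.lastObs h = y' then γ.policy k h u else 0) * f y' u := by
    intro k
    simp only [mul_comm _ (f _ _), ← m.expect_const_mul, ← m.expect_sum]
    refine m.expect_congr _ _ fun h => ?_
    rw [Finset.sum_eq_single (m.lastObs h)]
    · rw [Finset.mul_sum]
      refine Finset.sum_congr rfl fun u _ => ?_
      rw [if_pos rfl]
      ring
    · intro y _ hy
      simp [hy.symm]
    · simp
  simp only [hk]
  symm
  rw [Finset.sum_comm]
  refine Finset.sum_congr rfl fun y' _ => ?_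
  rw [Finset.sum_comm]

/-- Occupation measures of stopped processes are almost invariant. -/
theorem ObsModel.sum_occup_balance [Nonempty (U × Y)] (m : ObsModel M U Y) (γ : SeqTest M U Y)
    (i : Fin M) (n : ℕ) {g : Y → ℝ} (hg : ∀ y, |g y| ≤ 1) :
    ∑ y', ∑ u, m.occup γ i n y' u * (∑ y, m.p i u y' y * g y - g y') ≤ 2 := by
  rw [m.sum_occup_mul γ i n fun y' u => ∑ y, m.p i u y' y * g y - g y']
  -- The increments of `g` along the observations telescope, so their sum is at most `2` however
  -- long the test runs.
  let F : (k : ℕ) → Hist U Y k → U × Y → ℝ := fun k h z => g z.2 - g (m.lastObs h)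
  have hF : ∀ (k : ℕ) (h : Hist U Y k), h.pathSum F = g (m.lastObs h) - g m.y₀ := by
    intro k
    induction k with
    | zero => intro h; simp [ObsModel.lastObs]
    | succ k ih =>
      intro h
      rw [← h.snoc_take_last, Hist.pathSum_snoc, ih, m.lastObs_snoc]
      simp [F]
  have hF2 : ∀ (k : ℕ) (h : Hist U Y k), h.pathSum F ≤ 2 := by
    intro k h
    rw [hF]
    have h1 := (abs_le.mp (hg (m.lastObs h))).2
    have h2 := (abs_le.mp (hg m.y₀)).1
    linarith
  have hmean : ∀ (k : ℕ) (h : Hist U Y k),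
      m.stepMean i (γ.policy k h) (m.lastObs h) (F k h) =
        ∑ u, γ.policy k h u * (∑ y, m.p i u (m.lastObs h) y * g y - g (m.lastObs h)) := by
    intro k h
    simp only [m.stepMean_eq, F, mul_sub, Finset.sum_sub_distrib, ← Finset.sum_mul, m.p_sum,
      one_mul]
  simp only [← hmean]
  rw [← m.sum_expect_stops_pathSum]
  calc _ ≤ ∑ k ∈ Finset.range (n + 1), m.expect γ.policy i (fun h : Hist U Y k => 2 * γ.stops h) +
        m.expect γ.policy i (fun h : Hist U Y n => 2 * γ.alive h) := by
        refine add_le_add (Finset.sum_le_sum fun k _ => m.expect_mono _ _ fun h _ => ?_)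
          (m.expect_mono _ _ fun h _ => ?_)
        · rw [mul_comm 2]
          exact mul_le_mul_of_nonneg_left (hF2 k h) (γ.stops_nonneg h)
        · rw [mul_comm 2]
          exact mul_le_mul_of_nonneg_left (hF2 n h) (γ.alive_nonneg h)
    _ = 2 * 1 := by
        rw [← m.sum_expect_stops_add_alive γ γ.policy i n]
        simp only [m.expect_const_mul, ← Finset.mul_sum, mul_add]
    _ ≤ 2 := by norm_num

/-- An almost invariant weight on pairs (observation, control) is close to a multiple of the
stationary weight of a stationary policy. -/
theorem ObsModel.exists_statPolicy_of_balance [Nonempty U] (m : ObsModel M U Y) (i : Fin M) :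
    ∃ K : ℝ, 0 ≤ K ∧ ∀ ν : Y → U → ℝ, (∀ y' u, 0 ≤ ν y' u) →
      (∀ g : Y → ℝ, (∀ y, |g y| ≤ 1) →
        ∑ y', ∑ u, ν y' u * (∑ y, m.p i u y' y * g y - g y') ≤ 2) →
      ∃ q : StatPolicy U Y, ∀ (f : Y → U → ℝ) (B : ℝ), (∀ y' u, |f y' u| ≤ B) →
        |∑ y', ∑ u, ν y' u * f y' u - (∑ y', ∑ u, ν y' u) * m.statMean i q f| ≤ K * B := by
  classical
  obtain ⟨δ, h0, -, hδ⟩ := m.exists_le_p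
  have : Nonempty Y := ⟨m.y₀⟩
  have hκ : 0 < Fintype.card Y * δ := by
    have : 0 < (Fintype.card Y : ℝ) := by exact_mod_cast Fintype.card_pos
    positivity
  refine ⟨2 / (Fintype.card Y * δ), by positivity, fun ν hν hbal => ?_⟩
  set ν₁ : Y → ℝ := fun y' => ∑ u, ν y' u with hν₁
  have hν₁0 : ∀ y', 0 ≤ ν₁ y' := fun y' => Finset.sum_nonneg fun u _ => hν y' u
  -- Disintegration of `ν` along its observation marginal; where the marginal vanishes the choice is
  -- immaterial.
  let q : StatPolicy U Y := fun y' => if h : 0 < ν₁ y' then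
    ⟨fun u => ν y' u / ν₁ y', fun u => div_nonneg (hν _ _) h.le, by
      rw [← Finset.sum_div, div_self h.ne']⟩ else stdSimplex.barycenter
  have hq : ∀ y' u, ν y' u = ν₁ y' * q y' u := by
    intro y' u
    rcases (hν₁0 y').lt_or_eq with h | h
    · have : q y' u = ν y' u / ν₁ y' := by
        simp only [q, dif_pos h]
        rfl
      rw [this]
      field_simp
    · rw [← h, zero_mul]
      exact (Finset.sum_eq_zero_iff_of_nonneg fun u _ => hν y' u).mp h.symm u (Finset.mem_univ u)
  refine ⟨q, fun f B hB => ?_⟩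
  have hbal' : ∑ y, |∑ x, ν₁ x * m.mixed i q x y - ν₁ y| ≤ 2 := by
    -- Testing the balance against the sign of the defect turns it into an `ℓ¹` bound.
    let r : Y → ℝ := fun y => ∑ x, ν₁ x * m.mixed i q x y - ν₁ y
    let g : Y → ℝ := fun y => if 0 ≤ r y then 1 else -1
    have hg : ∀ y, |g y| ≤ 1 := fun y => by
      simp only [g]
      split_ifs <;> simp
    refine le_trans (le_of_eq ?_) (hbal g hg)
    have h1 : ∀ y, |r y| = r y * g y := fun y => by
      simp only [g]
      split_ifs with h
      · rw [abs_of_nonneg h, mul_one]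
      · rw [abs_of_neg (not_le.mp h)]; ring
    have h2 : ∀ y', ∑ u, ν y' u * (∑ y, m.p i u y' y * g y - g y') =
        ∑ y, ν₁ y' * m.mixed i q y' y * g y - ν₁ y' * g y' := by
      intro y'
      simp only [mul_sub, Finset.sum_sub_distrib, ← Finset.sum_mul]
      congr 1
      simp only [hq, ObsModel.mixed, Finset.mul_sum, Finset.sum_mul]
      rw [Finset.sum_comm]
      exact Finset.sum_congr rfl fun y _ => Finset.sum_congr rfl fun u _ => by ring
    change ∑ y, |r y| = _
    simp only [h1, h2, r, sub_mul, Finset.sum_sub_distrib]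
    congr 1
    rw [Finset.sum_comm]
    exact Finset.sum_congr rfl fun y _ => Finset.sum_mul _ _ _
  have hdist := (m.isStationaryDist_statDist i q).sum_abs_sub_le (m.le_mixed hδ i q)
    (m.sum_mixed i q) ν₁
  have hF : ∀ y', |∑ u, q y' u * f y' u| ≤ B := by
    intro y'
    refine (Finset.abs_sum_le_sum_abs _ _).trans ?_
    calc ∑ u, |q y' u * f y' u| ≤ ∑ u, q y' u * B := Finset.sum_le_sum fun u _ => by
          rw [abs_mul, abs_of_nonneg (stdSimplex.zero_le _ _)]
          exact mul_le_mul_of_nonneg_left (hB _ _) (stdSimplex.zero_le _ _)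
      _ = B := by rw [← Finset.sum_mul, stdSimplex.sum_eq_one, one_mul]
  have hB0 : 0 ≤ B := (abs_nonneg _).trans (hF m.y₀)
  have hdiff : ∑ y', ∑ u, ν y' u * f y' u - (∑ y', ν₁ y') * m.statMean i q f =
      ∑ y', (ν₁ y' - (∑ x, ν₁ x) * m.statDist i q y') * ∑ u, q y' u * f y' u := by
    rw [m.statMean_eq, Finset.mul_sum, ← Finset.sum_sub_distrib]
    refine Finset.sum_congr rfl fun y' _ => ?_
    simp only [hq, mul_assoc, ← Finset.mul_sum, sub_mul]
  change |∑ y', ∑ u, ν y' u * f y' u - (∑ y', ν₁ y') * m.statMean i q f| ≤ _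
  rw [hdiff]
  calc _ ≤ ∑ y', |ν₁ y' - (∑ x, ν₁ x) * m.statDist i q y'| * B := by
        refine (Finset.abs_sum_le_sum_abs _ _).trans (Finset.sum_le_sum fun y' _ => ?_)
        rw [abs_mul]
        exact mul_le_mul_of_nonneg_left (hF y') (abs_nonneg _)
    _ ≤ 2 / (Fintype.card Y * δ) * B := by
        rw [← Finset.sum_mul]
        refine mul_le_mul_of_nonneg_right ?_ hB0
        rw [le_div_iff₀' hκ]
        exact hdist.trans hbal'

/-- Information collected along an almost invariant weight is paid for at the optimal rate. -/
theorem ObsModel.exists_le_optRate_mul_cost [Nonempty U] (m : ObsModel M U Y) (hM : 2 ≤ M)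
    (hdist : ∀ i j, i ≠ j → ∃ u y' y, m.p i u y' y ≠ m.p j u y' y)
    {c : U → ℝ} (hc : ∀ u, 0 < c u) (i : Fin M) :
    ∃ C : ℝ, 0 ≤ C ∧ ∀ ν : Y → U → ℝ, (∀ y' u, 0 ≤ ν y' u) →
      (∀ g : Y → ℝ, (∀ y, |g y| ≤ 1) →
        ∑ y', ∑ u, ν y' u * (∑ y, m.p i u y' y * g y - g y') ≤ 2) →
      ∀ v : ℝ, (∀ j, j ≠ i → v ≤ ∑ y', ∑ u, ν y' u * klDist (m.p i u y') (m.p j u y')) →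
      v - C ≤ m.optRate c i * ∑ y', ∑ u, ν y' u * c u := by
  obtain ⟨K, hK, hbal⟩ := m.exists_statPolicy_of_balance i
  set B : ℝ := ∑ j, ∑ y', ∑ u, |klDist (m.p i u y') (m.p j u y')| with hBdef
  set B' : ℝ := ∑ u, |c u| with hB'def
  have hB : ∀ j y' u, |klDist (m.p i u y') (m.p j u y')| ≤ B := fun j y' u =>
    (Finset.single_le_sum (f := fun u => |klDist (m.p i u y') (m.p j u y')|)
      (fun _ _ => abs_nonneg _) (Finset.mem_univ u)).trans <|
    (Finset.single_le_sum (f := fun y' => ∑ u, |klDist (m.p i u y') (m.p j u y')|)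
      (fun _ _ => Finset.sum_nonneg fun _ _ => abs_nonneg _) (Finset.mem_univ y')).trans <|
    Finset.single_le_sum (f := fun j => ∑ y', ∑ u, |klDist (m.p i u y') (m.p j u y')|)
      (fun _ _ => Finset.sum_nonneg fun _ _ => Finset.sum_nonneg fun _ _ => abs_nonneg _)
      (Finset.mem_univ j)
  have hB' : ∀ u, |c u| ≤ B' := fun u =>
    Finset.single_le_sum (f := fun u => |c u|) (fun _ _ => abs_nonneg _) (Finset.mem_univ u)
  have hd := m.optRate_pos hM hdist hc i
  have hB0 : 0 ≤ B := Finset.sum_nonneg fun _ _ => Finset.sum_nonneg fun _ _ =>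
    Finset.sum_nonneg fun _ _ => abs_nonneg _
  have hB'0 : 0 ≤ B' := Finset.sum_nonneg fun _ _ => abs_nonneg _
  -- The two terms are the errors made in replacing the sums against `ν` by stationary means, for
  -- the information and for the cost.
  refine ⟨K * B + m.optRate c i * (K * B'), by positivity, fun ν hν hν' v hv => ?_⟩
  obtain ⟨q, hq⟩ := hbal ν hν hν'
  set s : ℝ := ∑ y', ∑ u, ν y' u
  have hs : 0 ≤ s := Finset.sum_nonneg fun _ _ => Finset.sum_nonneg fun _ _ => hν _ _
  have := nonempty_ne hM i
  -- Only the alternative hardest to separate under `q` is needed; it depends on `ν`, which is why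
  -- `v` must bound the information of all alternatives.
  obtain ⟨j, hj⟩ := exists_eq_ciInf_of_finite
    (f := fun j : {j : Fin M // j ≠ i} => m.info i j q)
  have h1 := m.iInf_info_le hM hc i q
  rw [← hj] at h1
  have h2 := (abs_le.mp (hq (fun y' u => klDist (m.p i u y') (m.p j u y')) B (hB j))).2
  have h3 := (abs_le.mp (hq (fun _ u => c u) B' fun _ u => hB' u)).1
  have h4 := hv j j.2
  have h5 := mul_le_mul_of_nonneg_left h1 hs
  change _ - s * m.info i j q ≤ _ at h2
  have h6 := mul_le_mul_of_nonneg_left h3 hd.le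
  linarith

end Occupation

/-! ### The converse -/

section Converse

variable {M : ℕ} {U Y : Type*} [Fintype U] [Fintype Y]
  [MeasurableSpace U] [DiscreteMeasurableSpace U] [MeasurableSpace Y] [DiscreteMeasurableSpace Y]

theorem natCast_succ_le_iff (k : ℕ) (N : ℕ∞) : ((k + 1 : ℕ) : ℕ∞) ≤ N ↔ (k : ℕ∞) < N := by
  rw [Nat.cast_add, Nat.cast_one]
  exact ENat.add_one_le_iff (ENat.natCast_ne_top k)

theorem SeqTest.ofReal_alive_mul (γ : SeqTest M U Y) (c : U → ℝ) (k : ℕ) (ω : SamplePath U Y) :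
    (if ((k + 1 : ℕ) : ℕ∞) ≤ γ.N ω then ENNReal.ofReal (c (ω k).1) else 0) =
      ENNReal.ofReal (γ.alive (hist k ω) * c (ω k).1) := by
  rw [γ.alive_hist]
  simp only [natCast_succ_le_iff]
  split_ifs <;> simp

theorem SeqTest.measurable_cost_term (γ : SeqTest M U Y) (c : U → ℝ) (k : ℕ) :
    Measurable fun ω : SamplePath U Y =>
      if ((k + 1 : ℕ) : ℕ∞) ≤ γ.N ω then ENNReal.ofReal (c (ω k).1) else 0 := by
  simp only [γ.ofReal_alive_mul]
  exact ((measurable_comp_hist _).mul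
    ((measurable_of_countable c).comp ((measurable_pi_apply k).fst))).ennreal_ofReal

/-- Whether control number `k + 1` is applied is decided by the first `k` pairs, so its cost can be
averaged over the policy given the history. -/
theorem SeqTest.expectedCost_eq_tsum (γ : SeqTest M U Y) (m : ObsModel M U Y) {c : U → ℝ}
    (hc : ∀ u, 0 < c u) (i : Fin M) :
    γ.expectedCost m c i = ∑' k : ℕ, ENNReal.ofReal (m.expect γ.policy i fun h : Hist U Y k =>
      γ.alive h * ∑ u, γ.policy k h u * c u) := by
  unfold SeqTest.expectedCost
  rw [lintegral_tsum fun k => (γ.measurable_cost_term c k).aemeasurable]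
  refine tsum_congr fun k => ?_
  simp only [γ.ofReal_alive_mul]
  have h1 := m.lintegral_ofReal_hist γ.policy i (n := k + 1)
    (f := fun h => γ.alive (h.take k k.le_succ) * c (h (Fin.last k)).1)
    fun h => mul_nonneg (γ.alive_nonneg _) (hc _).le
  refine h1.trans ?_
  rw [m.expect_succ]
  congr 1
  refine m.expect_congr _ _ fun h => ?_
  simp only [Hist.take_snoc, Hist.snoc_last]
  rw [m.stepMean_const_mul, m.stepMean_fst]

theorem SeqTest.ofReal_sum_occup_le_expectedCost (γ : SeqTest M U Y) (m : ObsModel M U Y)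
    {c : U → ℝ} (hc : ∀ u, 0 < c u) (i : Fin M) (n : ℕ) :
    ENNReal.ofReal (∑ y', ∑ u, m.occup γ i n y' u * c u) ≤ γ.expectedCost m c i := by
  rw [γ.expectedCost_eq_tsum m hc, m.sum_occup_mul γ i n fun _ u => c u,
    ENNReal.ofReal_sum_of_nonneg fun k _ => m.expect_nonneg _ _ fun h =>
      mul_nonneg (γ.alive_nonneg h) (Finset.sum_nonneg fun u _ =>
        mul_nonneg (stdSimplex.zero_le _ _) (hc u).le)]
  exact ENNReal.sum_le_tsum _

/-- The event that the test decides for `i` by time `n`. -/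
def SeqTest.decidesBy (γ : SeqTest M U Y) (i : Fin M) (n : ℕ) : Set (SamplePath U Y) :=
  ⋃ k ∈ Finset.range (n + 1), {ω | γ.N ω = k ∧ γ.decision k (hist k ω) = i}

open Classical in
theorem SeqTest.decides_at_eq (γ : SeqTest M U Y) (i : Fin M) (k : ℕ) :
    {ω | γ.N ω = k ∧ γ.decision k (hist k ω) = i} =
      hist k ⁻¹' {h | γ.stops h = 1 ∧ γ.decision k h = i} := by
  ext ω
  simp only [Set.mem_ofPred_eq, Set.mem_preimage, γ.stops_hist]
  simp

theorem SeqTest.measurableSet_decides_at (γ : SeqTest M U Y) (i : Fin M) (k : ℕ) :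
    MeasurableSet {ω | γ.N ω = k ∧ γ.decision k (hist k ω) = i} := by
  rw [γ.decides_at_eq]
  exact measurable_hist k (Set.to_countable _).measurableSet

theorem SeqTest.decides_eq_iUnion (γ : SeqTest M U Y) (i : Fin M) :
    γ.decides i = ⋃ k : ℕ, {ω | γ.N ω = k ∧ γ.decision k (hist k ω) = i} := by
  ext ω
  simp [SeqTest.decides]

theorem SeqTest.measurableSet_decides (γ : SeqTest M U Y) (i : Fin M) :
    MeasurableSet (γ.decides i) := by
  rw [γ.decides_eq_iUnion]
  exact MeasurableSet.iUnion fun k => γ.measurableSet_decides_at i k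

theorem SeqTest.disjoint_decides_at (γ : SeqTest M U Y) (i : Fin M) :
    Pairwise (Function.onFun Disjoint
      fun k : ℕ => {ω | γ.N ω = k ∧ γ.decision k (hist k ω) = i}) := by
  intro k l hkl
  refine Set.disjoint_left.mpr ?_
  rintro ω ⟨h1, -⟩ ⟨h2, -⟩
  rw [h1] at h2
  exact hkl (by exact_mod_cast h2)

theorem SeqTest.decidesBy_subset (γ : SeqTest M U Y) (i : Fin M) (n : ℕ) :
    γ.decidesBy i n ⊆ γ.decides i := by
  rw [γ.decides_eq_iUnion]
  exact Set.iUnion₂_subset fun k _ => Set.subset_iUnion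
    (fun k : ℕ => {ω | γ.N ω = k ∧ γ.decision k (hist k ω) = i}) k

theorem SeqTest.tendsto_decidesBy (γ : SeqTest M U Y) (i : Fin M) (μ : Measure (SamplePath U Y))
    [IsProbabilityMeasure μ] :
    Tendsto (fun n => μ.real (γ.decidesBy i n)) atTop (𝓝 (μ.real (γ.decides i))) := by
  have hmono : Monotone (γ.decidesBy i) := fun a b hab =>
    Set.biUnion_subset_biUnion_left fun k hk =>
      Finset.mem_range.mpr ((Finset.mem_range.mp hk).trans_le (Nat.succ_le_succ hab))
  have hU : γ.decides i = ⋃ n, γ.decidesBy i n := by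
    refine Set.Subset.antisymm ?_ (Set.iUnion_subset fun n => γ.decidesBy_subset i n)
    rw [γ.decides_eq_iUnion]
    refine Set.iUnion_subset fun k => ?_
    refine Set.subset_iUnion_of_subset k ?_
    exact Set.subset_biUnion_of_mem (u := fun k : ℕ =>
      {ω | γ.N ω = k ∧ γ.decision k (hist k ω) = i}) (Finset.self_mem_range_succ k)
  rw [hU]
  exact (ENNReal.tendsto_toReal (measure_ne_top _ _)).comp (tendsto_measure_iUnion_atTop hmono)

open Classical in
theorem ObsModel.sum_expect_stops_decision (m : ObsModel M U Y) (γ : SeqTest M U Y)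
    (φ : Policy U Y) (i j : Fin M) (n : ℕ) :
    ∑ k ∈ Finset.range (n + 1), m.expect φ j (fun h : Hist U Y k =>
        γ.stops h * if γ.decision k h = i then 1 else 0) =
      (m.law φ j).real (γ.decidesBy i n) := by
  unfold SeqTest.decidesBy
  rw [measureReal_biUnion_finset (fun k _ l _ hkl => γ.disjoint_decides_at i hkl)
    fun k _ => γ.measurableSet_decides_at i k]
  refine Finset.sum_congr rfl fun k _ => ?_
  rw [γ.decides_at_eq, m.law_real_hist]
  refine m.expect_congr _ _ fun h => ?_
  have h01 : γ.stops h = 0 ∨ γ.stops h = 1 := by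
    unfold SeqTest.stops
    split_ifs <;> simp
  by_cases hd : γ.decision k h = i
  · rcases h01 with h0 | h0
    · rw [Set.indicator_of_notMem (by simp [h0]), h0, zero_mul]
    · rw [Set.indicator_of_mem (by simp [h0, hd]), h0, if_pos hd]
      simp
  · rw [Set.indicator_of_notMem (by simp [hd]), if_neg hd, mul_zero]

theorem ObsModel.stepMean_stepLlr (m : ObsModel M U Y) (i j : Fin M) (q : stdSimplex ℝ U) {k : ℕ}
    (h : Hist U Y k) :
    m.stepMean i q (m.lastObs h) (m.stepLlr i j k h) =
      ∑ u, q u * klDist (m.p i u (m.lastObs h)) (m.p j u (m.lastObs h)) := by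
  rw [m.stepMean_eq]
  rfl

theorem SeqTest.law_real_decides_le_risk (γ : SeqTest M U Y) (m : ObsModel M U Y) {i j : Fin M}
    (hj : j ≠ i) : (m.law γ.policy j).real (γ.decides i) ≤ γ.risk m i :=
  le_ciSup (f := fun j : {j : Fin M // j ≠ i} => (m.law γ.policy j).real (γ.decides i))
    (Set.finite_range _).bddAbove ⟨j, hj⟩

theorem SeqTest.errorProb_le_maxError (γ : SeqTest M U Y) (m : ObsModel M U Y) (i : Fin M) :
    γ.errorProb m i ≤ γ.maxError m :=
  le_ciSup (f := fun i => γ.errorProb m i) (Set.finite_range _).bddAbove i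

theorem SeqTest.errorProb_eq (γ : SeqTest M U Y) (m : ObsModel M U Y) (i : Fin M) :
    γ.errorProb m i = 1 - (m.law γ.policy i).real (γ.decides i) :=
  probReal_compl_eq_one_sub (γ.measurableSet_decides i)

theorem SeqTest.errorProb_nonneg (γ : SeqTest M U Y) (m : ObsModel M U Y) (i : Fin M) :
    0 ≤ γ.errorProb m i := measureReal_nonneg

theorem SeqTest.risk_le_maxError (hM : 2 ≤ M) (γ : SeqTest M U Y) (m : ObsModel M U Y)
    (i : Fin M) : γ.risk m i ≤ γ.maxError m := by
  have := nonempty_ne hM i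
  refine ciSup_le fun j => le_trans ?_ (γ.errorProb_le_maxError m j)
  refine measureReal_mono ?_
  rintro ω ⟨n, hn, hd⟩ ⟨n', hn', hd'⟩
  rw [hn] at hn'
  have : n = n' := by exact_mod_cast hn'
  subst this
  exact j.2 (hd'.symm.trans hd)

/-- A test that decides for `i` with positive probability under `i` does so under all
hypotheses. -/
theorem SeqTest.risk_pos (hM : 2 ≤ M) (γ : SeqTest M U Y) (m : ObsModel M U Y) {i : Fin M}
    (h : γ.errorProb m i < 1) : 0 < γ.risk m i := by
  obtain ⟨j, hj⟩ := nonempty_ne hM i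
  refine lt_of_lt_of_le ?_ (γ.law_real_decides_le_risk m hj)
  rw [γ.errorProb_eq] at h
  by_contra hcon
  have hz : (m.law γ.policy j).real (γ.decides i) = 0 :=
    le_antisymm (not_lt.mp hcon) measureReal_nonneg
  have hzero : (m.law γ.policy i) (γ.decides i) = 0 := by
    rw [γ.decides_eq_iUnion, measure_iUnion_null_iff]
    intro k
    have h1 : (m.law γ.policy j).real {ω | γ.N ω = k ∧ γ.decision k (hist k ω) = i} = 0 := by
      refine le_antisymm ?_ measureReal_nonneg
      rw [← hz, γ.decides_eq_iUnion]
      exact measureReal_mono (Set.subset_iUnion (fun k : ℕ =>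
        {ω | γ.N ω = k ∧ γ.decision k (hist k ω) = i}) k)
    rw [← measureReal_eq_zero_iff]
    rw [γ.decides_at_eq, m.law_real_hist] at h1 ⊢
    unfold ObsModel.expect at h1 ⊢
    have hnn : ∀ (l : Fin M) (h : Hist U Y k), 0 ≤ m.jointPmf γ.policy l h *
        ({h : Hist U Y k | γ.stops h = 1 ∧ γ.decision k h = i}.indicator 1 h) := fun l h =>
      mul_nonneg (m.jointPmf_nonneg _ _ _)
        (Set.indicator_nonneg (fun _ _ => zero_le_one) h)
    rw [Finset.sum_eq_zero_iff_of_nonneg fun h _ => hnn _ h] at h1 ⊢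
    intro h hh
    -- The laws of a finite history under two hypotheses have the same null sets.
    rw [m.jointPmf_eq_mul_exp γ.policy j i, mul_right_comm, h1 h hh, zero_mul]
  rw [measureReal_def, hzero] at h
  simp at h

/-- The finite-sample converse bound. -/
theorem ObsModel.exists_converse [Nonempty U] (m : ObsModel M U Y) (hM : 2 ≤ M)
    (hdist : ∀ i j, i ≠ j → ∃ u y' y, m.p i u y' y ≠ m.p j u y' y)
    {c : U → ℝ} (hc : ∀ u, 0 < c u) (i : Fin M) :
    ∃ C : ℝ, 0 ≤ C ∧ ∀ (γ : SeqTest M U Y) (x : ℝ), Real.exp x * γ.risk m i ≤ 1 →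
      ENNReal.ofReal ((x * (1 - γ.errorProb m i) - C) / m.optRate c i) ≤
        γ.expectedCost m c i := by
  obtain ⟨C, hC, hν⟩ := m.exists_le_optRate_mul_cost hM hdist hc i
  have hd := m.optRate_pos hM hdist hc i
  have : Nonempty (U × Y) := ⟨(Classical.arbitrary U, m.y₀)⟩
  -- The extra `1` bounds `exp x * ℙ_j {δ = i}`.
  refine ⟨C + 1, by linarith, fun γ x hx => ?_⟩
  rw [γ.errorProb_eq, sub_sub_cancel]
  have hn : ∀ n : ℕ, ENNReal.ofReal
      ((x * (m.law γ.policy i).real (γ.decidesBy i n) - (C + 1)) / m.optRate c i) ≤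
      γ.expectedCost m c i := by
    intro n
    refine le_trans (ENNReal.ofReal_le_ofReal ?_)
      (γ.ofReal_sum_occup_le_expectedCost m hc i n)
    rw [div_le_iff₀' hd]
    have := hν (m.occup γ i n) (m.occup_nonneg γ i n) (fun g hg => m.sum_occup_balance γ i n hg)
      (x * (m.law γ.policy i).real (γ.decidesBy i n) - 1) (fun j hj => ?_)
    · linarith
    · have h1 := m.le_sum_expect_alive_stepLlr γ γ.policy i j x n
      rw [m.sum_expect_stops_decision, m.sum_expect_stops_decision] at h1
      rw [m.sum_occup_mul γ i n fun y' u => klDist (m.p i u y') (m.p j u y')]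
      simp only [m.stepMean_stepLlr] at h1
      have h2 : Real.exp x * (m.law γ.policy j).real (γ.decidesBy i n) ≤ 1 :=
        (mul_le_mul_of_nonneg_left ((measureReal_mono (γ.decidesBy_subset i n)).trans
          (γ.law_real_decides_le_risk m hj)) (Real.exp_pos x).le).trans hx
      linarith
  -- Letting the horizon tend to infinity recovers the full probability of a correct decision.
  have hlim := γ.tendsto_decidesBy i (m.law γ.policy i)
  refine le_of_tendsto (ENNReal.tendsto_ofReal
    (((hlim.const_mul x).sub_const (C + 1)).div_const (m.optRate c i))) ?_
  exact Eventually.of_forall hn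

/-- The converse part of the main theorem. -/
theorem ObsModel.exists_asymptotic_converse [Nonempty U] (m : ObsModel M U Y) (hM : 2 ≤ M)
    (hdist : ∀ i j, i ≠ j → ∃ u y' y, m.p i u y' y ≠ m.p j u y' y)
    {c : U → ℝ} (hc : ∀ u, 0 < c u) (γ : ℕ → SeqTest M U Y)
    (hγ : Tendsto (fun n => (γ n).maxError m) atTop (𝓝 0)) (i : Fin M) :
    ∃ ε : ℕ → ℝ, Tendsto ε atTop (𝓝 0) ∧ ∀ᶠ n in atTop,
        0 < (γ n).risk m i ∧
        ENNReal.ofReal (-Real.log ((γ n).risk m i) / m.optRate c i * (1 + ε n)) ≤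
          (γ n).expectedCost m c i ∧
        -Real.log ((γ n).maxError m) / m.optRate c i * (1 + ε n) ≤
          -Real.log ((γ n).risk m i) / m.optRate c i * (1 + ε n) := by
  obtain ⟨C, hC, hconv⟩ := m.exists_converse hM hdist hc i
  have hd := m.optRate_pos hM hdist hc i
  have herr : Tendsto (fun n => (γ n).errorProb m i) atTop (𝓝 0) :=
    squeeze_zero (fun n => (γ n).errorProb_nonneg m i)
      (fun n => (γ n).errorProb_le_maxError m i) hγ
  have hpos : ∀ᶠ n in atTop, 0 < (γ n).risk m i := by
    filter_upwards [herr.eventually_lt_const one_pos] with n hn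
    exact (γ n).risk_pos hM m hn
  have hrisk : Tendsto (fun n => (γ n).risk m i) atTop (𝓝 0) :=
    squeeze_zero' (hpos.mono fun n hn => hn.le)
      (Eventually.of_forall fun n => (γ n).risk_le_maxError hM m i) hγ
  have hlog : Tendsto (fun n => -Real.log ((γ n).risk m i)) atTop atTop :=
    tendsto_neg_atBot_atTop.comp (Real.tendsto_log_nhdsGT_zero.comp
      (tendsto_nhdsWithin_iff.mpr ⟨hrisk, hpos⟩))
  -- With `x = -log R_i`, the finite-sample numerator `x * (1 - error) - C` is `x * (1 + ε)` for
  -- this `ε`.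
  refine ⟨fun n => -(γ n).errorProb m i - C / -Real.log ((γ n).risk m i), ?_, ?_⟩
  · simpa using herr.neg.sub (hlog.const_div_atTop C)
  · have hε : Tendsto (fun n => 1 + (-(γ n).errorProb m i - C / -Real.log ((γ n).risk m i)))
        atTop (𝓝 1) := by
      simpa using (herr.neg.sub (hlog.const_div_atTop C)).const_add 1
    filter_upwards [hpos, hlog.eventually_gt_atTop 0, hε.eventually_const_lt one_pos]
      with n h1 h2 h3
    refine ⟨h1, ?_, ?_⟩
    · refine le_trans (ENNReal.ofReal_le_ofReal (le_of_eq ?_))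
        (hconv (γ n) (-Real.log ((γ n).risk m i)) ?_)
      · have h4 := (neg_pos.mp h2).ne
        field_simp
        ring
      · rw [Real.exp_neg, Real.exp_log h1, inv_mul_cancel₀ h1.ne']
    · refine mul_le_mul_of_nonneg_right ?_ h3.le
      rw [div_le_div_iff_of_pos_right hd, neg_le_neg_iff]
      exact Real.log_le_log h1 ((γ n).risk_le_maxError hM m i)

end Converse

/-! ### Exploration times -/

section Exploration

/-- Contraction takes two steps, so consecutive exploration times must be at least two apart. The
`3` in the proof pays for this gap and for rounding up. -/
theorem exists_ceil_pow_gap {a : ℝ} (ha : 1 < a) :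
    ∃ ℓ₀ : ℕ, ∀ ℓ, ℓ₀ ≤ ℓ → ⌈a ^ ℓ⌉₊ + 2 ≤ ⌈a ^ (ℓ + 1)⌉₊ := by
  obtain ⟨ℓ₀, h₀⟩ := ((tendsto_pow_atTop_atTop_of_one_lt ha).eventually_ge_atTop
    (3 / (a - 1))).exists_forall_of_atTop
  refine ⟨ℓ₀, fun ℓ hℓ => ?_⟩
  have h1 := h₀ ℓ hℓ
  rw [div_le_iff₀ (by linarith)] at h1
  have h2 := Nat.ceil_lt_add_one (a := a ^ ℓ) (by positivity)
  have h3 := Nat.le_ceil (a ^ (ℓ + 1))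
  rw [pow_succ] at h3
  have h4 : ((⌈a ^ ℓ⌉₊ + 2 : ℕ) : ℝ) ≤ (⌈a ^ (ℓ + 1)⌉₊ : ℝ) := by
    push_cast
    rw [pow_succ]
    linarith
  exact_mod_cast h4

/-- A nonincreasing sequence contracted at the times `⌈a ^ ℓ⌉` decays along these times. -/
theorem le_pow_of_contract {a : ℝ} {ρ : ℝ} (hρ0 : 0 < ρ) {b : ℕ → ℝ} (hb : Antitone b)
    (hb1 : b 0 ≤ 1) (hcon : ∀ n, (∃ ℓ : ℕ, n + 2 = ⌈a ^ ℓ⌉₊) → b (n + 2) ≤ ρ * b n) {ℓ₀ : ℕ}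
    (hℓ₀ : ∀ ℓ, ℓ₀ ≤ ℓ → ⌈a ^ ℓ⌉₊ + 2 ≤ ⌈a ^ (ℓ + 1)⌉₊) (k : ℕ) :
    b ⌈a ^ (ℓ₀ + k)⌉₊ ≤ ρ ^ k := by
  induction k with
  | zero => simpa using (hb (Nat.zero_le _)).trans hb1
  | succ k ih =>
    have h := hℓ₀ (ℓ₀ + k) (Nat.le_add_right _ _)
    obtain ⟨n, hn⟩ := Nat.exists_eq_add_of_le' (show 2 ≤ ⌈a ^ (ℓ₀ + k + 1)⌉₊ by omega)
    rw [← add_assoc, hn, pow_succ']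
    refine (hcon n ⟨_, hn.symm⟩).trans (mul_le_mul_of_nonneg_left ?_ hρ0.le)
    exact (hb (by omega)).trans ih

theorem le_ceil_pow_of_gap {a : ℝ} {ℓ₀ : ℕ}
    (hℓ₀ : ∀ ℓ, ℓ₀ ≤ ℓ → ⌈a ^ ℓ⌉₊ + 2 ≤ ⌈a ^ (ℓ + 1)⌉₊) (k : ℕ) : k ≤ ⌈a ^ (ℓ₀ + k)⌉₊ := by
  induction k with
  | zero => exact Nat.zero_le _
  | succ k ih =>
    have h := hℓ₀ (ℓ₀ + k) (Nat.le_add_right _ _)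
    rw [← add_assoc]
    omega

theorem tendsto_zero_of_contract {a : ℝ} (ha : 1 < a) {ρ : ℝ} (hρ0 : 0 < ρ) (hρ1 : ρ < 1)
    {b : ℕ → ℝ} (hb0 : ∀ n, 0 ≤ b n) (hb : Antitone b) (hb1 : b 0 ≤ 1)
    (hcon : ∀ n, (∃ ℓ : ℕ, n + 2 = ⌈a ^ ℓ⌉₊) → b (n + 2) ≤ ρ * b n) :
    Tendsto b atTop (𝓝 0) := by
  obtain ⟨ℓ₀, hℓ₀⟩ := exists_ceil_pow_gap ha
  rw [Metric.tendsto_atTop]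
  intro ε hε
  obtain ⟨k, hk⟩ := exists_pow_lt_of_lt_one hε hρ1
  refine ⟨⌈a ^ (ℓ₀ + k)⌉₊, fun n hn => ?_⟩
  rw [Real.dist_eq, sub_zero, abs_of_nonneg (hb0 n)]
  exact ((hb hn).trans (le_pow_of_contract hρ0 hb hb1 hcon hℓ₀ k)).trans_lt hk

/-- There are of order `a ^ k` indices up to the `k`-th exploration time, while `b` has decayed like
`ρ ^ k` by then; hence the condition `a * ρ < 1`. -/
theorem tsum_ne_top_of_contract {a : ℝ} (ha : 1 < a) {ρ : ℝ} (hρ0 : 0 < ρ) (haρ : a * ρ < 1)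
    {b : ℕ → ℝ} (hb : Antitone b) (hb1 : b 0 ≤ 1)
    (hcon : ∀ n, (∃ ℓ : ℕ, n + 2 = ⌈a ^ ℓ⌉₊) → b (n + 2) ≤ ρ * b n) :
    ∑' n, ENNReal.ofReal (b n) ≠ ∞ := by
  obtain ⟨ℓ₀, hℓ₀⟩ := exists_ceil_pow_gap ha
  have hρ1 : ρ < 1 := by nlinarith
  -- The term of the first exploration time beyond `n` already dominates `b n`. Keeping all later
  -- terms as well permits interchanging the two sums.
  have hle : ∀ n, ENNReal.ofReal (b n) ≤
      ∑' k : ℕ, if n < ⌈a ^ (ℓ₀ + (k + 1))⌉₊ then ENNReal.ofReal (ρ ^ k) else 0 := by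
    intro n
    have hex : ∃ k : ℕ, n < ⌈a ^ (ℓ₀ + (k + 1))⌉₊ :=
      ⟨n, (Nat.lt_succ_self n).trans_le (le_ceil_pow_of_gap hℓ₀ (n + 1))⟩
    classical
    refine le_trans ?_ (ENNReal.le_tsum (Nat.find hex))
    rw [if_pos (Nat.find_spec hex)]
    refine ENNReal.ofReal_le_ofReal ?_
    rcases hk : Nat.find hex with _ | k
    · simpa using (hb (Nat.zero_le _)).trans hb1
    · refine (hb (not_lt.mp ?_)).trans (le_pow_of_contract hρ0 hb hb1 hcon hℓ₀ (k + 1))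
      exact Nat.find_min hex (by omega)
  refine ne_top_of_le_ne_top ?_ (ENNReal.tsum_le_tsum hle)
  rw [ENNReal.tsum_comm]
  have hsum : ∀ k : ℕ, (∑' n : ℕ, if n < ⌈a ^ (ℓ₀ + (k + 1))⌉₊ then ENNReal.ofReal (ρ ^ k) else 0) ≤
      ENNReal.ofReal (a ^ (ℓ₀ + 1) * (a * ρ) ^ k + ρ ^ k) := by
    intro k
    rw [tsum_eq_sum (s := Finset.range ⌈a ^ (ℓ₀ + (k + 1))⌉₊) fun n hn =>
      if_neg (by simpa using hn)]
    rw [Finset.sum_congr rfl fun n hn => if_pos (Finset.mem_range.mp hn), Finset.sum_const,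
      Finset.card_range, ← ENNReal.ofReal_nsmul]
    refine ENNReal.ofReal_le_ofReal ?_
    rw [nsmul_eq_mul]
    have h2 := (Nat.ceil_lt_add_one (a := a ^ (ℓ₀ + (k + 1))) (by positivity)).le
    calc _ ≤ (a ^ (ℓ₀ + (k + 1)) + 1) * ρ ^ k :=
          mul_le_mul_of_nonneg_right h2 (by positivity)
      _ = a ^ (ℓ₀ + 1) * (a * ρ) ^ k + ρ ^ k := by
          rw [mul_pow, show ℓ₀ + (k + 1) = (ℓ₀ + 1) + k by ring, pow_add a (ℓ₀ + 1) k]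
          ring
  refine ne_top_of_le_ne_top ?_ (ENNReal.tsum_le_tsum hsum)
  refine Summable.tsum_ofReal_ne_top ?_
  exact ((summable_geometric_of_lt_one (by positivity) haρ).mul_left _).add
    (summable_geometric_of_lt_one hρ0.le hρ1)

open Classical in
/-- The number of exploration times is sublinear. -/
theorem exists_card_explore_le {a : ℝ} (ha : 1 < a) {ε : ℝ} (hε : 0 < ε) :
    ∃ K : ℝ, 0 ≤ K ∧ ∀ n : ℕ,
      (((Finset.range n).filter fun k => ∃ ℓ : ℕ, k + 1 = ⌈a ^ ℓ⌉₊).card : ℝ) ≤ ε * n + K := by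
  have hla : 0 < Real.log a := Real.log_pos ha
  have hε' : 0 < ε * Real.log a := mul_pos hε hla
  refine ⟨|Real.log (ε * Real.log a)| / Real.log a + 1, by positivity, fun n => ?_⟩
  rcases Nat.eq_zero_or_pos n with rfl | hn
  · simp
    positivity
  have hn' : (0 : ℝ) < n := by exact_mod_cast hn
  set L : ℕ := ⌊Real.log n / Real.log a⌋₊ with hL
  have hsub : ((Finset.range n).filter fun k => ∃ ℓ : ℕ, k + 1 = ⌈a ^ ℓ⌉₊) ⊆
      (Finset.range (L + 1)).image fun ℓ => ⌈a ^ ℓ⌉₊ - 1 := by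
    intro k hk
    rw [Finset.mem_filter, Finset.mem_range] at hk
    obtain ⟨hkn, ℓ, hℓ⟩ := hk
    refine Finset.mem_image.mpr ⟨ℓ, Finset.mem_range.mpr (Nat.lt_succ_of_le ?_), by omega⟩
    refine Nat.le_floor ?_
    rw [le_div_iff₀ hla, ← Real.log_pow]
    refine Real.log_le_log (by positivity) ((Nat.le_ceil _).trans ?_)
    rw [← hℓ]
    exact_mod_cast hkn
  have hcard := (Finset.card_le_card hsub).trans Finset.card_image_le
  rw [Finset.card_range] at hcard
  have h1 : (L : ℝ) ≤ Real.log n / Real.log a :=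
    Nat.floor_le (div_nonneg (Real.log_natCast_nonneg n) hla.le)
  -- From `log x ≤ x - 1` at `x = ε * log a * n`; the slope is chosen so that dividing by `log a`
  -- leaves `ε`.
  have h2 : Real.log n ≤ ε * Real.log a * n + |Real.log (ε * Real.log a)| := by
    have h3 := Real.log_le_sub_one_of_pos (mul_pos hε' hn')
    rw [Real.log_mul hε'.ne' hn'.ne'] at h3
    have := neg_abs_le (Real.log (ε * Real.log a))
    linarith
  calc _ ≤ ((L + 1 : ℕ) : ℝ) := by exact_mod_cast hcard
    _ ≤ Real.log n / Real.log a + 1 := by push_cast; linarith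
    _ ≤ (ε * Real.log a * n + |Real.log (ε * Real.log a)|) / Real.log a + 1 := by gcongr
    _ = _ := by
        field_simp
        ring

end Exploration

/-! ### Bhattacharyya coefficients -/

section Bhattacharyya

variable {M : ℕ} {U Y : Type*} [Fintype U] [Fintype Y]

/-- The inequality `√r ≤ (1 + r) / 2` at the likelihood ratio `r = exp (-x)`; averaged over an
observation it bounds the Bhattacharyya coefficient by one. -/
theorem exp_neg_half_le {x : ℝ} : Real.exp (-x / 2) ≤ (1 + Real.exp (-x)) / 2 := by
  have h : Real.exp (-x) = Real.exp (-x / 2) * Real.exp (-x / 2) := by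
    rw [← Real.exp_add]
    ring_nf
  rw [h]
  nlinarith [sq_nonneg (Real.exp (-x / 2) - 1)]

theorem exp_neg_half_lt {x : ℝ} (hx : x ≠ 0) : Real.exp (-x / 2) < (1 + Real.exp (-x)) / 2 := by
  have h : Real.exp (-x) = Real.exp (-x / 2) * Real.exp (-x / 2) := by
    rw [← Real.exp_add]
    ring_nf
  have h1 : Real.exp (-x / 2) - 1 ≠ 0 := by
    rw [sub_ne_zero, Ne, Real.exp_eq_one_iff]
    intro h
    exact hx (by linarith)
  rw [h]
  nlinarith [sq_pos_of_ne_zero h1]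

/-- The Bhattacharyya coefficient of hypotheses `i` and `j` for one observation. -/
noncomputable def ObsModel.bhatt (m : ObsModel M U Y) (i j : Fin M) (u : U) (y' : Y) : ℝ :=
  ∑ y, m.p i u y' y * Real.exp (-Real.log (m.p i u y' y / m.p j u y' y) / 2)

theorem ObsModel.p_mul_exp (m : ObsModel M U Y) (i j : Fin M) (u : U) (y' y : Y) :
    m.p i u y' y * ((1 + Real.exp (-Real.log (m.p i u y' y / m.p j u y' y))) / 2) =
      (m.p i u y' y + m.p j u y' y) / 2 := by
  rw [← Real.log_inv, inv_div, Real.exp_log (div_pos (m.p_pos _ _ _ _) (m.p_pos _ _ _ _))]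
  have := (m.p_pos i u y' y).ne'
  field_simp

theorem ObsModel.sum_half_p (m : ObsModel M U Y) (i j : Fin M) (u : U) (y' : Y) :
    ∑ y, (m.p i u y' y + m.p j u y' y) / 2 = 1 := by
  rw [← Finset.sum_div, Finset.sum_add_distrib, m.p_sum, m.p_sum]
  norm_num

theorem ObsModel.bhatt_le_one (m : ObsModel M U Y) (i j : Fin M) (u : U) (y' : Y) :
    m.bhatt i j u y' ≤ 1 := by
  rw [← m.sum_half_p i j u y']
  refine Finset.sum_le_sum fun y _ => ?_
  rw [← m.p_mul_exp]
  exact mul_le_mul_of_nonneg_left exp_neg_half_le (m.p_pos _ _ _ _).le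

theorem ObsModel.bhatt_lt_one (m : ObsModel M U Y) {i j : Fin M} {u : U} {y' : Y}
    (h : ∃ y, m.p i u y' y ≠ m.p j u y' y) : m.bhatt i j u y' < 1 := by
  obtain ⟨y, hy⟩ := h
  rw [← m.sum_half_p i j u y']
  refine Finset.sum_lt_sum (fun y _ => ?_) ⟨y, Finset.mem_univ y, ?_⟩
  · rw [← m.p_mul_exp]
    exact mul_le_mul_of_nonneg_left exp_neg_half_le (m.p_pos _ _ _ _).le
  · rw [← m.p_mul_exp]
    refine mul_lt_mul_of_pos_left (exp_neg_half_lt ?_) (m.p_pos _ _ _ _)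
    intro h0
    rcases Real.log_eq_zero.mp h0 with h | h | h
    · exact (div_pos (m.p_pos i u y' y) (m.p_pos j u y' y)).ne' h
    · exact hy ((div_eq_one_iff_eq (m.p_pos j u y' y).ne').mp h)
    · linarith [div_pos (m.p_pos i u y' y) (m.p_pos j u y' y)]

theorem ObsModel.stepMean_exp_half (m : ObsModel M U Y) (i j : Fin M) (q : stdSimplex ℝ U) {k : ℕ}
    (h : Hist U Y k) :
    m.stepMean i q (m.lastObs h) (fun z => Real.exp (-m.stepLlr i j k h z / 2)) =
      ∑ u, q u * m.bhatt i j u (m.lastObs h) :=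
  m.stepMean_eq _ _ _ _

/-- The expectation of the square root of the likelihood ratio of `j` against `i`. -/
noncomputable def ObsModel.histBhatt (m : ObsModel M U Y) (φ : Policy U Y) (i j : Fin M) (n : ℕ) :
    ℝ :=
  m.expect φ i fun h : Hist U Y n => Real.exp (-m.llr i j h / 2)

theorem ObsModel.histBhatt_nonneg (m : ObsModel M U Y) (φ : Policy U Y) (i j : Fin M) (n : ℕ) :
    0 ≤ m.histBhatt φ i j n :=
  m.expect_nonneg _ _ fun _ => (Real.exp_pos _).le

theorem ObsModel.histBhatt_zero (m : ObsModel M U Y) (φ : Policy U Y) (i j : Fin M) :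
    m.histBhatt φ i j 0 = 1 := by
  simp [ObsModel.histBhatt, m.expect_zero, ObsModel.llr]

theorem ObsModel.llr_snoc (m : ObsModel M U Y) (i j : Fin M) {n : ℕ} (h : Hist U Y n)
    (z : U × Y) : m.llr i j (h.snoc z) = m.llr i j h + m.stepLlr i j n h z :=
  Hist.pathSum_snoc _ _ _

theorem ObsModel.histBhatt_succ (m : ObsModel M U Y) (φ : Policy U Y) (i j : Fin M) (n : ℕ) :
    m.histBhatt φ i j (n + 1) = m.expect φ i fun h : Hist U Y n =>
      Real.exp (-m.llr i j h / 2) * ∑ u, φ n h u * m.bhatt i j u (m.lastObs h) := by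
  unfold ObsModel.histBhatt
  rw [m.expect_succ]
  refine m.expect_congr _ _ fun h => ?_
  rw [← m.stepMean_exp_half, ← m.stepMean_const_mul]
  simp only [m.llr_snoc, neg_add, add_div, Real.exp_add]

theorem ObsModel.sum_mul_bhatt_le_one (m : ObsModel M U Y) (i j : Fin M) (q : stdSimplex ℝ U)
    (y' : Y) : ∑ u, q u * m.bhatt i j u y' ≤ 1 := by
  calc ∑ u, q u * m.bhatt i j u y' ≤ ∑ u, q u * 1 := Finset.sum_le_sum fun u _ =>
        mul_le_mul_of_nonneg_left (m.bhatt_le_one _ _ _ _) (stdSimplex.zero_le _ _)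
    _ = 1 := by simp

theorem ObsModel.histBhatt_antitone (m : ObsModel M U Y) (φ : Policy U Y) (i j : Fin M) :
    Antitone (m.histBhatt φ i j) := by
  refine antitone_nat_of_succ_le fun n => ?_
  rw [m.histBhatt_succ]
  refine m.expect_mono _ _ fun h _ => ?_
  exact mul_le_of_le_one_right (Real.exp_pos _).le (m.sum_mul_bhatt_le_one _ _ _ _)

open Classical in
/-- Uniform exploration contracts the Bhattacharyya coefficient over two steps. -/
theorem ObsModel.exists_histBhatt_contract_pair [Nonempty U] (m : ObsModel M U Y) {i j : Fin M}
    (hij : ∃ u y' y, m.p i u y' y ≠ m.p j u y' y) :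
    ∃ ρ : ℝ, ρ < 1 ∧ ∀ (φ : Policy U Y) (n : ℕ),
      (∀ h : Hist U Y (n + 1), φ (n + 1) h = stdSimplex.barycenter) →
      m.histBhatt φ i j (n + 2) ≤ ρ * m.histBhatt φ i j n := by
  obtain ⟨u₀, y₁, hy⟩ := hij
  obtain ⟨δ, hδ0, hδ1, hδ⟩ := m.exists_le_p
  have hcard : (0 : ℝ) < Fintype.card U := by exact_mod_cast Fintype.card_pos
  set κ : ℝ := (Fintype.card U : ℝ)⁻¹ * (1 - m.bhatt i j u₀ y₁) with hκ
  have hκ0 : 0 < κ := mul_pos (inv_pos.mpr hcard) (sub_pos.mpr (m.bhatt_lt_one hy))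
  -- The likelihood ratio of `j` against `i` is at least `δ`, and its square root at least `√δ ≥ δ`.
  have hexp : ∀ u y' y, δ ≤ Real.exp (-Real.log (m.p i u y' y / m.p j u y' y) / 2) := by
    intro u y' y
    rw [← Real.log_le_iff_le_exp hδ0, ← Real.log_inv, inv_div]
    have hp1 : m.p i u y' y ≤ 1 := by
      rw [← m.p_sum i u y']
      exact Finset.single_le_sum (f := fun y => m.p i u y' y)
        (fun y _ => (m.p_pos _ _ _ _).le) (Finset.mem_univ y)
    have h1 : δ ≤ m.p j u y' y / m.p i u y' y :=
      (hδ j u y' y).trans (le_div_self (m.p_pos _ _ _ _).le (m.p_pos _ _ _ _) hp1)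
    have h2 := Real.log_le_log hδ0 h1
    have h3 := Real.log_nonpos hδ0.le hδ1
    linarith
  -- The hypotheses may be separable only after the observation `y₁`, hence two steps. The first,
  -- under any control, reaches `y₁` with weight at least `δ * δ` (transition probability times root
  -- likelihood ratio); the second, exploratory, then loses at least `κ`.
  refine ⟨1 - κ * (δ * δ), by nlinarith [mul_pos hκ0 (mul_pos hδ0 hδ0)], fun φ n hφ => ?_⟩
  have hlast : ∀ y', ∑ u, (stdSimplex.barycenter : stdSimplex ℝ U) u * m.bhatt i j u y' ≤
      1 - κ * if y' = y₁ then 1 else 0 := by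
    intro y'
    split_ifs with h
    · rw [h, mul_one, le_sub_comm, hκ]
      have h1 : 1 - ∑ u, (stdSimplex.barycenter : stdSimplex ℝ U) u * m.bhatt i j u y₁ =
          ∑ u, (stdSimplex.barycenter : stdSimplex ℝ U) u * (1 - m.bhatt i j u y₁) := by
        simp only [mul_sub, Finset.sum_sub_distrib, mul_one, stdSimplex.sum_eq_one]
      rw [h1, ← barycenter_coe u₀]
      exact Finset.single_le_sum
        (f := fun u => (stdSimplex.barycenter : stdSimplex ℝ U) u * (1 - m.bhatt i j u y₁))
        (fun u _ => mul_nonneg (stdSimplex.zero_le _ _) (sub_nonneg.mpr (m.bhatt_le_one _ _ _ _)))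
        (Finset.mem_univ u₀)
    · rw [mul_zero, sub_zero]
      exact m.sum_mul_bhatt_le_one _ _ _ _
  calc m.histBhatt φ i j (n + 2)
      ≤ m.expect φ i fun h : Hist U Y (n + 1) => Real.exp (-m.llr i j h / 2) *
        (1 - κ * if m.lastObs h = y₁ then 1 else 0) := by
        rw [m.histBhatt_succ]
        refine m.expect_mono _ _ fun h _ => mul_le_mul_of_nonneg_left ?_ (Real.exp_pos _).le
        rw [hφ h]
        exact hlast _
    _ ≤ m.expect φ i fun h : Hist U Y n => (1 - κ * (δ * δ)) * Real.exp (-m.llr i j h / 2) := by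
        rw [m.expect_succ]
        refine m.expect_mono _ _ fun h _ => ?_
        simp only [m.llr_snoc, m.lastObs_snoc, neg_add, add_div, Real.exp_add, mul_assoc]
        rw [m.stepMean_const_mul, mul_comm (1 - κ * (δ * δ))]
        refine mul_le_mul_of_nonneg_left ?_ (Real.exp_pos _).le
        simp only [mul_sub, mul_one, mul_left_comm _ κ]
        rw [m.stepMean_sub, m.stepMean_exp_half, m.stepMean_const_mul]
        refine sub_le_sub (m.sum_mul_bhatt_le_one _ _ _ _) (mul_le_mul_of_nonneg_left ?_ hκ0.le)
        rw [m.stepMean_eq]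
        calc δ * δ = ∑ u, φ n h u * (δ * δ) := by
              rw [← Finset.sum_mul, stdSimplex.sum_eq_one, one_mul]
          _ ≤ _ := by
              refine Finset.sum_le_sum fun u _ =>
                mul_le_mul_of_nonneg_left ?_ (stdSimplex.zero_le _ _)
              rw [Finset.sum_eq_single y₁ (fun y _ hy => by simp [hy]) (by simp), if_pos rfl,
                mul_one]
              exact mul_le_mul (hδ _ _ _ _) (hexp _ _ _) hδ0.le (m.p_pos _ _ _ _).le
    _ = (1 - κ * (δ * δ)) * m.histBhatt φ i j n := m.expect_const_mul _ _ _ _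

theorem ObsModel.exists_histBhatt_contract [Nonempty U] (m : ObsModel M U Y)
    (hdist : ∀ i j, i ≠ j → ∃ u y' y, m.p i u y' y ≠ m.p j u y' y) :
    ∃ ρ : ℝ, 0 < ρ ∧ ρ < 1 ∧ ∀ i j, i ≠ j → ∀ (φ : Policy U Y) (n : ℕ),
      (∀ h : Hist U Y (n + 1), φ (n + 1) h = stdSimplex.barycenter) →
      m.histBhatt φ i j (n + 2) ≤ ρ * m.histBhatt φ i j n := by
  choose! ρ hρ1 hρ using fun i j (hij : i ≠ j) => m.exists_histBhatt_contract_pair (hdist i j hij)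
  -- The diagonal gets a harmless value, so that a maximum over all pairs yields one constant below
  -- `1`.
  let r : Fin M × Fin M → ℝ := fun z => if z.1 = z.2 then 0 else ρ z.1 z.2
  have hr : ∀ z, r z < 1 := fun z => by
    simp only [r]
    split_ifs with h
    · exact one_pos
    · exact hρ1 _ _ h
  obtain ⟨s, hs0, hs1, hs⟩ : ∃ s : ℝ, 0 < s ∧ s < 1 ∧ ∀ z, r z ≤ s := by
    rcases isEmpty_or_nonempty (Fin M × Fin M) with h | h
    · exact ⟨1 / 2, by norm_num, by norm_num, fun z => h.elim z⟩
    · obtain ⟨z, hz⟩ := Finite.exists_max r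
      exact ⟨max (1 / 2) (r z), by positivity, max_lt (by norm_num) (hr z),
        fun w => (hz w).trans (le_max_right _ _)⟩
  refine ⟨s, hs0, hs1, fun i j hij φ n hφ => (hρ i j hij φ n hφ).trans ?_⟩
  have := hs (i, j)
  simp only [r, if_neg hij] at this
  exact mul_le_mul_of_nonneg_right this (m.histBhatt_nonneg _ _ _ _)

end Bhattacharyya

/-! ### Error probabilities of the proposed test -/

section ErrorBound

variable {M : ℕ} {U Y : Type*} [Fintype U] [Fintype Y]

theorem ObsModel.IsMLE.llr_nonpos {m : ObsModel M U Y} {φ : Policy U Y}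
    {ihat : (n : ℕ) → Hist U Y n → Fin M} (hmle : m.IsMLE φ ihat) {i : Fin M} {n : ℕ}
    {h : Hist U Y n} (hpos : 0 < m.jointPmf φ i h) : m.llr i (ihat n h) h ≤ 0 := by
  have h1 := hmle n h i
  rw [m.jointPmf_eq_mul_exp φ i (ihat n h)] at h1
  have h2 := Real.one_le_exp_iff.mp (le_of_mul_le_mul_left (by linarith) hpos :
    1 ≤ Real.exp (-m.llr i (ihat n h) h))
  linarith

/-- Positivity of all log-likelihood ratios forces the estimate to be `i`; exceeding `log T` then
gives the threshold. This explains `max (log T) 0`, which also covers `T < 1`. -/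
theorem ObsModel.IsMLE.exceedsThreshold (hM : 2 ≤ M) {m : ObsModel M U Y} {φ : Policy U Y}
    {ihat : (n : ℕ) → Hist U Y n → Fin M} (hmle : m.IsMLE φ ihat) {T : ℝ} (hT : 0 < T)
    {i : Fin M} {n : ℕ} {h : Hist U Y n} (hpos : 0 < m.jointPmf φ i h)
    (hllr : ∀ j, j ≠ i → max (Real.log T) 0 < m.llr i j h) : m.ExceedsThreshold φ ihat T n h := by
  have hi : ihat n h = i := by
    by_contra hne
    have h1 := hllr _ hne
    have h2 := hmle.llr_nonpos hpos
    linarith [le_max_right (Real.log T) 0]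
  unfold ObsModel.ExceedsThreshold
  rw [hi]
  have := nonempty_ne hM i
  obtain ⟨j, hj⟩ := exists_eq_ciSup_of_finite
    (f := fun j : {j : Fin M // j ≠ i} => m.jointPmf φ j h)
  have hj0 : 0 < m.jointPmf φ j h := (m.jointPmf_pos_iff φ i j h).mpr hpos
  rw [← hj, lt_div_iff₀ hj0, m.jointPmf_eq_mul_exp φ i j]
  have h1 : T < Real.exp (m.llr i j h) := by
    rw [← Real.log_lt_iff_lt_exp hT]
    exact (le_max_left _ _).trans_lt (hllr j j.2)
  calc T * (m.jointPmf φ i h * Real.exp (-m.llr i j h))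
      < Real.exp (m.llr i j h) * (m.jointPmf φ i h * Real.exp (-m.llr i j h)) :=
        mul_lt_mul_of_pos_right h1 (mul_pos hpos (Real.exp_pos _))
    _ = m.jointPmf φ i h := by
        rw [mul_left_comm, ← Real.exp_add, add_neg_cancel, Real.exp_zero, mul_one]

theorem ObsModel.ExceedsThreshold.mul_le {m : ObsModel M U Y} {φ : Policy U Y}
    {ihat : (n : ℕ) → Hist U Y n → Fin M} {T : ℝ} (hT : 0 < T) {n : ℕ}
    {h : Hist U Y n} (hex : m.ExceedsThreshold φ ihat T n h) {j : Fin M} (hj : j ≠ ihat n h) :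
    m.jointPmf φ j h ≤ 1 / T * m.jointPmf φ (ihat n h) h := by
  unfold ObsModel.ExceedsThreshold at hex
  set S : ℝ := ⨆ j : {j : Fin M // j ≠ ihat n h}, m.jointPmf φ j h with hS
  have hjS : m.jointPmf φ j h ≤ S :=
    le_ciSup (f := fun j : {j : Fin M // j ≠ ihat n h} => m.jointPmf φ j h)
      (Set.finite_range _).bddAbove ⟨j, hj⟩
  have hS0 : 0 ≤ S := (m.jointPmf_nonneg _ _ _).trans hjS
  -- If all competitors have likelihood zero, the quotient is `0` by the division convention, so the
  -- threshold is not exceeded.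
  rcases hS0.eq_or_lt with h0 | h0
  · rw [← h0, div_zero] at hex
    exact absurd hex hT.le.not_gt
  · rw [lt_div_iff₀ h0] at hex
    rw [one_div, inv_mul_eq_div, le_div_iff₀' hT]
    nlinarith

theorem ObsModel.msprtTime_eq {m : ObsModel M U Y} {φ : Policy U Y}
    {ihat : (n : ℕ) → Hist U Y n → Fin M} {T : ℝ} {ω : SamplePath U Y} {n : ℕ}
    (h : m.msprtTime φ ihat T ω = n) : m.ExceedsThreshold φ ihat T n (hist n ω) := by
  unfold ObsModel.msprtTime at h
  rcases Set.eq_empty_or_nonempty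
    ((fun n : ℕ => (n : ℕ∞)) '' {n | 1 ≤ n ∧ m.ExceedsThreshold φ ihat T n (hist n ω)}) with h0 | h0
  · rw [h0, sInf_empty] at h
    exact absurd h.symm (ENat.natCast_ne_top n)
  · have h1 := csInf_mem h0
    rw [h] at h1
    obtain ⟨k, ⟨-, hk⟩, hkn⟩ := h1
    have : k = n := ENat.natCast_inj.mp hkn
    exact this ▸ hk

theorem ObsModel.not_exceedsThreshold_of_lt {m : ObsModel M U Y} {φ : Policy U Y}
    {ihat : (n : ℕ) → Hist U Y n → Fin M} {T : ℝ} {ω : SamplePath U Y} {n : ℕ} (hn : 1 ≤ n)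
    (h : n < m.msprtTime φ ihat T ω) : ¬ m.ExceedsThreshold φ ihat T n (hist n ω) := fun hex =>
  absurd (sInf_le (Set.mem_image_of_mem (fun n : ℕ => (n : ℕ∞))
    (show n ∈ {n | 1 ≤ n ∧ m.ExceedsThreshold φ ihat T n (hist n ω)} from ⟨hn, hex⟩))) (not_le.mpr h)

/-- The policy at index `n + 1` governs the control at time `n + 2`, which is why the exploration
times enter as `n + 2`. -/
theorem ObsModel.IsPlugInPolicy.histBhatt_contract [Nonempty U] {m : ObsModel M U Y} {a : ℝ}
    {qstar : Fin M → StatPolicy U Y} {φ : Policy U Y} {ihat : (n : ℕ) → Hist U Y n → Fin M}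
    (hφ : m.IsPlugInPolicy a qstar φ ihat) {i j : Fin M} {ρ : ℝ}
    (hρ : ∀ (φ : Policy U Y) (n : ℕ),
      (∀ h : Hist U Y (n + 1), φ (n + 1) h = stdSimplex.barycenter) →
      m.histBhatt φ i j (n + 2) ≤ ρ * m.histBhatt φ i j n) (n : ℕ)
    (hn : ∃ ℓ : ℕ, n + 2 = ⌈a ^ ℓ⌉₊) :
    m.histBhatt φ i j (n + 2) ≤ ρ * m.histBhatt φ i j n :=
  hρ φ n fun h => by rw [hφ.2, if_pos hn]

variable [MeasurableSpace U] [DiscreteMeasurableSpace U] [MeasurableSpace Y]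
  [DiscreteMeasurableSpace Y]

theorem SeqTest.errorProb_le_sum (γ : SeqTest M U Y) (m : ObsModel M U Y) (i : Fin M) :
    γ.errorProb m i ≤ ∑ j ∈ Finset.univ.erase i, (m.law γ.policy i).real (γ.decides j) +
      (m.law γ.policy i).real {ω | γ.N ω = ⊤} := by
  have hsub : (γ.decides i)ᶜ ⊆ (⋃ j ∈ Finset.univ.erase i, γ.decides j) ∪ {ω | γ.N ω = ⊤} := by
    intro ω hω
    rcases eq_or_ne (γ.N ω) ⊤ with h | h
    · exact Or.inr h
    · obtain ⟨n, hn⟩ := ENat.ne_top_iff_exists.mp h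
      refine Or.inl (Set.mem_biUnion (x := γ.decision n (hist n ω)) ?_ ⟨n, hn.symm, rfl⟩)
      rw [Finset.mem_coe, Finset.mem_erase]
      exact ⟨fun hd => hω ⟨n, hn.symm, hd⟩, Finset.mem_univ _⟩
  exact (measureReal_mono hsub).trans ((measureReal_union_le _ _).trans
    (add_le_add_left (measureReal_biUnion_finset_le _ _) _))

/-- On each history at which the test stops in favour of `j`, the stopping rule gives `p_i ≤ p_j /
T`. Summing, `ℙ_i {δ = j}` is at most `ℙ_j {δ = j} / T`. -/
theorem ObsModel.law_real_msprt_decides_le [Nonempty (U × Y)] (m : ObsModel M U Y)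
    {φ : Policy U Y} {ihat : (n : ℕ) → Hist U Y n → Fin M} {T : ℝ} (hT : 0 < T) {i j : Fin M}
    (hij : i ≠ j) : (m.law φ i).real ((m.msprt φ ihat T).decides j) ≤ 1 / T := by
  classical
  set γ := m.msprt φ ihat T
  refine le_of_tendsto (γ.tendsto_decidesBy j (m.law φ i)) (Eventually.of_forall fun n => ?_)
  have h1 : (m.law φ i).real (γ.decidesBy j n) ≤ 1 / T * (m.law φ j).real (γ.decidesBy j n) := by
    rw [← m.sum_expect_stops_decision, ← m.sum_expect_stops_decision, Finset.mul_sum]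
    refine Finset.sum_le_sum fun k _ => ?_
    unfold ObsModel.expect
    rw [Finset.mul_sum]
    refine Finset.sum_le_sum fun h _ => ?_
    change m.jointPmf φ i h * (γ.stops h * if γ.decision k h = j then 1 else 0) ≤
      1 / T * (m.jointPmf φ j h * (γ.stops h * if γ.decision k h = j then 1 else 0))
    rw [← mul_assoc]
    by_cases hd : γ.decision k h = j
    · rw [if_pos hd, mul_one]
      unfold SeqTest.stops
      split_ifs with hs
      · obtain ⟨ω, rfl, hω⟩ := hs
        have h2 := (ObsModel.msprtTime_eq hω).mul_le hT (j := i) (fun h => hij (h.trans hd))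
        change ihat k (hist k ω) = j at hd
        rw [hd] at h2
        simpa only [mul_one] using h2
      · simp
    · simp [if_neg hd]
  refine h1.trans (mul_le_of_le_one_right (by positivity) measureReal_le_one)

open Classical in
-- Chernoff bound with exponent one half: if the threshold is not exceeded, some log-likelihood
-- ratio is at most `max (log T) 0`, and the corresponding summand is at least one.
theorem ObsModel.IsMLE.expect_not_exceeds_le (hM : 2 ≤ M) {m : ObsModel M U Y} {φ : Policy U Y}
    {ihat : (n : ℕ) → Hist U Y n → Fin M} (hmle : m.IsMLE φ ihat) {T : ℝ} (hT : 0 < T)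
    (i : Fin M) (n : ℕ) :
    m.expect φ i ({h : Hist U Y n | ¬ m.ExceedsThreshold φ ihat T n h}.indicator 1) ≤
      ∑ j ∈ Finset.univ.erase i, Real.exp (max (Real.log T) 0 / 2) * m.histBhatt φ i j n := by
  unfold ObsModel.histBhatt
  simp only [← m.expect_const_mul]
  rw [← m.expect_sum]
  refine m.expect_mono _ _ fun h hpos => ?_
  have hnn : ∀ j ∈ Finset.univ.erase i,
      0 ≤ Real.exp (max (Real.log T) 0 / 2) * Real.exp (-m.llr i j h / 2) :=
    fun j _ => (mul_pos (Real.exp_pos _) (Real.exp_pos _)).le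
  by_cases hex : m.ExceedsThreshold φ ihat T n h
  · rw [Set.indicator_of_notMem (by simpa using hex)]
    exact Finset.sum_nonneg hnn
  · rw [Set.indicator_of_mem (by exact hex), Pi.one_apply]
    have hj : ∃ j, j ≠ i ∧ m.llr i j h ≤ max (Real.log T) 0 := by
      by_contra hcon
      push Not at hcon
      exact hex (hmle.exceedsThreshold hM hT hpos hcon)
    obtain ⟨j, hji, hj⟩ := hj
    refine le_trans ?_ (Finset.single_le_sum hnn
      (Finset.mem_erase.mpr ⟨hji, Finset.mem_univ j⟩))
    rw [← Real.exp_add]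
    exact Real.one_le_exp (by linarith)

/-- Never stopping means failing the threshold at every `n ≥ 1`, an event of vanishing probability.
Convergence of the Bhattacharyya coefficients suffices, so any `a > 1` is allowed here. -/
theorem ObsModel.IsPlugInPolicy.law_real_msprt_top [Nonempty U] (hM : 2 ≤ M) {m : ObsModel M U Y}
    (hdist : ∀ i j, i ≠ j → ∃ u y' y, m.p i u y' y ≠ m.p j u y' y) {a : ℝ} (ha : 1 < a)
    {qstar : Fin M → StatPolicy U Y} {φ : Policy U Y} {ihat : (n : ℕ) → Hist U Y n → Fin M}
    (hφ : m.IsPlugInPolicy a qstar φ ihat) {T : ℝ} (hT : 0 < T) (i : Fin M) :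
    (m.law φ i).real {ω | (m.msprt φ ihat T).N ω = ⊤} = 0 := by
  refine le_antisymm ?_ measureReal_nonneg
  obtain ⟨ρ, hρ0, hρ1, hρ⟩ := m.exists_histBhatt_contract hdist
  have hlim : Tendsto (fun n => ∑ j ∈ Finset.univ.erase i,
      Real.exp (max (Real.log T) 0 / 2) * m.histBhatt φ i j n) atTop (𝓝 0) := by
    have h0 : ∑ j ∈ Finset.univ.erase i, Real.exp (max (Real.log T) 0 / 2) * (0 : ℝ) = 0 := by
      simp
    conv => arg 3; rw [← h0]
    refine tendsto_finsetSum _ fun j hj => Tendsto.const_mul _ (tendsto_zero_of_contract ha hρ0 hρ1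
      (m.histBhatt_nonneg φ i j) (m.histBhatt_antitone φ i j) (m.histBhatt_zero φ i j).le
      (hφ.histBhatt_contract (hρ i j (Finset.ne_of_mem_erase hj).symm)))
  refine ge_of_tendsto hlim ?_
  filter_upwards [eventually_ge_atTop 1] with n hn
  refine le_trans ?_ (hφ.1.expect_not_exceeds_le hM hT i n)
  rw [← m.law_real_hist]
  refine measureReal_mono fun ω hω => ?_
  refine ObsModel.not_exceedsThreshold_of_lt hn ?_
  change m.msprtTime φ ihat T ω = ⊤ at hω
  rw [hω]
  exact ENat.natCast_lt_top n

/-- The maximal error probability of the proposed test is at most `(M - 1) / T`. -/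
theorem ObsModel.IsPlugInPolicy.maxError_msprt_le [Nonempty U] (hM : 2 ≤ M) {m : ObsModel M U Y}
    (hdist : ∀ i j, i ≠ j → ∃ u y' y, m.p i u y' y ≠ m.p j u y' y) {a : ℝ} (ha : 1 < a)
    {qstar : Fin M → StatPolicy U Y} {φ : Policy U Y} {ihat : (n : ℕ) → Hist U Y n → Fin M}
    (hφ : m.IsPlugInPolicy a qstar φ ihat) {T : ℝ} (hT : 0 < T) :
    (m.msprt φ ihat T).maxError m ≤ (M - 1 : ℝ) / T := by
  have : Nonempty (Fin M) := ⟨⟨0, by omega⟩⟩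
  have : Nonempty (U × Y) := ⟨(Classical.arbitrary U, m.y₀)⟩
  refine ciSup_le fun i => ((m.msprt φ ihat T).errorProb_le_sum m i).trans ?_
  change _ + (m.law φ i).real _ ≤ _
  rw [hφ.law_real_msprt_top hM hdist ha hT i, add_zero]
  calc _ ≤ ∑ j ∈ Finset.univ.erase i, 1 / T := Finset.sum_le_sum fun j hj =>
        m.law_real_msprt_decides_le hT (Finset.ne_of_mem_erase hj).symm
    _ = (M - 1 : ℝ) / T := by
        rw [Finset.sum_const, Finset.card_erase_of_mem (Finset.mem_univ i), Finset.card_univ,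
          Fintype.card_fin, nsmul_eq_mul, Nat.cast_sub (by omega)]
        simp [div_eq_mul_inv]

end ErrorBound

/-! ### Upper bound on the cost of the proposed test -/

section UpperBound

variable {M : ℕ} {U Y : Type*} [Fintype U] [Fintype Y]

open Classical in
/-- The indicator that the control after the history `h` is an exploration or is based on a wrong
estimate. -/
noncomputable def badStep (a : ℝ) (ihat : (n : ℕ) → Hist U Y n → Fin M) (i : Fin M) (k : ℕ)
    (h : Hist U Y k) : ℝ :=
  if (∃ ℓ : ℕ, k + 1 = ⌈a ^ ℓ⌉₊) ∨ ihat k h ≠ i then 1 else 0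

theorem badStep_nonneg (a : ℝ) (ihat : (n : ℕ) → Hist U Y n → Fin M) (i : Fin M) (k : ℕ)
    (h : Hist U Y k) : 0 ≤ badStep a ihat i k h := by
  unfold badStep
  split_ifs <;> simp

theorem badStep_le_one (a : ℝ) (ihat : (n : ℕ) → Hist U Y n → Fin M) (i : Fin M) (k : ℕ)
    (h : Hist U Y k) : badStep a ihat i k h ≤ 1 := by
  unfold badStep
  split_ifs <;> simp

theorem ObsModel.IsPlugInPolicy.eq_of_badStep_eq_zero [Nonempty U] {m : ObsModel M U Y} {a : ℝ}
    {qstar : Fin M → StatPolicy U Y} {φ : Policy U Y} {ihat : (n : ℕ) → Hist U Y n → Fin M}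
    (hφ : m.IsPlugInPolicy a qstar φ ihat) {i : Fin M} {k : ℕ} {h : Hist U Y k}
    (hb : badStep a ihat i k h ≠ 1) :
    φ k h = qstar i (m.lastObs h) ∧ badStep a ihat i k h = 0 := by
  unfold badStep at hb ⊢
  split_ifs at hb ⊢ with hc
  · exact absurd rfl hb
  · push Not at hc
    rw [hφ.2, if_neg (by simpa using hc.1), hc.2]
    exact ⟨rfl, rfl⟩

/-- Along an optimal stationary policy the log-likelihood ratio minus the rescaled cost has
nonnegative drift, up to a bounded corrector. -/
theorem ObsModel.exists_corrector [Nonempty U] (m : ObsModel M U Y) {c : U → ℝ}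
    (hc : ∀ u, 0 < c u) {i j : Fin M} (hj : j ≠ i) {q : StatPolicy U Y}
    (hq : ∀ q', m.rate c i q' ≤ m.rate c i q) :
    ∃ f : Y → ℝ, ∀ y', 0 ≤ m.stepMean i (q y') y' fun z =>
      Real.log (m.p i z.1 y' z.2 / m.p j z.1 y' z.2) - m.optRate c i * c z.1 + (f z.2 - f y') := by
  set d := m.optRate c i with hd
  obtain ⟨f, hf⟩ := (m.isStationaryDist_statDist i q).exists_poisson (m.mixed_pos i q)
    (m.sum_mixed i q) fun y' => ∑ u, q y' u * (klDist (m.p i u y') (m.p j u y') - d * c u)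
  refine ⟨f, fun y' => ?_⟩
  -- The stationary drift is nonnegative because `q` attains the optimal rate. The Poisson equation
  -- makes the corrected drift equal to this constant at every state.
  have h1 : 0 ≤ ∑ y', m.statDist i q y' *
      ∑ u, q y' u * (klDist (m.p i u y') (m.p j u y') - d * c u) := by
    have h2 := m.optRate_mul_le_info hc hj hq
    rw [ObsModel.info, m.statMean_eq, m.statMean_eq, Finset.mul_sum] at h2
    rw [← sub_nonneg, ← Finset.sum_sub_distrib] at h2
    refine h2.trans (le_of_eq (Finset.sum_congr rfl fun y' _ => ?_))
    simp only [mul_sub, Finset.sum_sub_distrib, Finset.mul_sum]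
    congr 1
    exact Finset.sum_congr rfl fun u _ => by ring
  rw [← hf y'] at h1
  refine h1.trans (le_of_eq ?_)
  rw [m.stepMean_add, m.stepMean_sub, m.stepMean_sub, m.stepMean_const, m.stepMean_const_mul,
    m.stepMean_fst]
  have h3 : m.stepMean i (q y') y' (fun z => Real.log (m.p i z.1 y' z.2 / m.p j z.1 y' z.2)) =
      ∑ u, q y' u * klDist (m.p i u y') (m.p j u y') := m.stepMean_eq _ _ _ _
  have h4 : m.stepMean i (q y') y' (fun z => f z.2) = ∑ y, m.mixed i q y' y * f y := by
    rw [m.stepMean_eq]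
    simp only [ObsModel.mixed, Finset.mul_sum, Finset.sum_mul]
    rw [Finset.sum_comm]
    exact Finset.sum_congr rfl fun y _ => Finset.sum_congr rfl fun u _ => by ring
  rw [h3, h4]
  simp only [mul_sub, Finset.sum_sub_distrib, Finset.mul_sum]
  have h5 : ∑ u, q y' u * (d * c u) = ∑ u, d * (q y' u * c u) :=
    Finset.sum_congr rfl fun u _ => by ring
  rw [h5]
  ring

theorem exp_neg_le_of_abs_le_one {x : ℝ} (hx : |x| ≤ 1) : Real.exp (-x) ≤ 1 - x + x ^ 2 := by
  have := (abs_le.mp (Real.abs_exp_sub_one_sub_id_le (x := -x) (by rwa [abs_neg]))).2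
  nlinarith

/-- The total cost along a history. -/
def Hist.costSum (c : U → ℝ) {n : ℕ} (h : Hist U Y n) : ℝ := h.pathSum fun _ _ z => c z.1

/-- Pathwise comparison of the cost with the log-likelihood ratio, up to an error term with
exponentially small mean. -/
theorem ObsModel.exists_cost_le_llr [Nonempty U] (m : ObsModel M U Y) {c : U → ℝ}
    (hc : ∀ u, 0 < c u) {i j : Fin M} (hj : j ≠ i) {qstar : Fin M → StatPolicy U Y}
    (hq : ∀ q', m.rate c i q' ≤ m.rate c i (qstar i)) {a : ℝ} {φ : Policy U Y}
    {ihat : (n : ℕ) → Hist U Y n → Fin M} (hφ : m.IsPlugInPolicy a qstar φ ihat)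
    {ε : ℝ} (hε : 0 < ε) :
    ∃ K r : ℝ, 0 < K ∧ 0 < r ∧ r < 1 ∧ ∃ E : (n : ℕ) → Hist U Y n → ℝ,
      (∀ n h, 0 ≤ E n h) ∧ (∀ n, m.expect φ i (E n) ≤ K * r ^ n) ∧
      ∀ n (h : Hist U Y n), m.optRate c i * h.costSum c ≤
        m.llr i j h + K + K * h.pathSum (fun k h _ => badStep a ihat i k h) + ε * n + E n h := by
  set d := m.optRate c i with hd
  obtain ⟨f, hf⟩ := m.exists_corrector hc hj hq
  let X : Y → U × Y → ℝ := fun y' z =>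
    Real.log (m.p i z.1 y' z.2 / m.p j z.1 y' z.2) - d * c z.1 + (f z.2 - f y')
  have : Nonempty Y := ⟨m.y₀⟩
  obtain ⟨z₀, hz₀⟩ := Finite.exists_max fun z : Y × U × Y => |X z.1 z.2|
  set B : ℝ := |X z₀.1 z₀.2| + 1 with hBdef
  have hB0 : 0 < B := by positivity
  have hXB : ∀ y' z, |X y' z| ≤ B := fun y' z => (hz₀ (y', z)).trans (by linarith)
  obtain ⟨y₁, hy₁⟩ := Finite.exists_max fun y : Y => |f y|
  -- Adding the bound `B` at bad steps makes the conditional drift nonnegative at every step.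
  let F : (k : ℕ) → Hist U Y k → U × Y → ℝ := fun k h z =>
    X (m.lastObs h) z + B * badStep a ihat i k h
  have hFB : ∀ k h z, |F k h z| ≤ 2 * B := by
    intro k h z
    refine (abs_add_le _ _).trans ?_
    rw [abs_mul, abs_of_pos hB0, abs_of_nonneg (badStep_nonneg _ _ _ _ _)]
    have := hXB (m.lastObs h) z
    have := mul_le_of_le_one_right hB0.le (badStep_le_one a ihat i k h)
    linarith
  have hFmean : ∀ k h, 0 ≤ m.stepMean i (φ k h) (m.lastObs h) (F k h) := by
    intro k h
    by_cases hb : badStep a ihat i k h = 1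
    · rw [← m.stepMean_const i (φ k h) (m.lastObs h) 0]
      refine m.stepMean_mono _ _ _ fun z => ?_
      simp only [F, hb]
      have := (abs_le.mp (hXB (m.lastObs h) z)).1
      linarith
    · obtain ⟨h1, h2⟩ := hφ.eq_of_badStep_eq_zero hb
      simp only [F, h2, mul_zero, add_zero, h1]
      exact hf _
  -- The first bound keeps `s * F` within `[-1, 1]`, where the quadratic estimate of `exp` holds;
  -- the second keeps the quadratic term `4 * B ^ 2 * s ^ 2` below `s * ε / 2`, half of the slack.
  set s : ℝ := min (1 / (2 * B)) (ε / (8 * B ^ 2)) with hs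
  have hs0 : 0 < s := lt_min (by positivity) (by positivity)
  have hs1 : s * (2 * B) ≤ 1 := by
    rw [← le_div_iff₀ (by positivity)]
    exact min_le_left _ _
  have hs2 : s * (8 * B ^ 2) ≤ ε := by
    rw [← le_div_iff₀ (by positivity)]
    exact min_le_right _ _
  let G : (k : ℕ) → Hist U Y k → U × Y → ℝ := fun k h z => -(s * (F k h z + ε))
  have hG : ∀ k h, m.stepMean i (φ k h) (m.lastObs h) (fun z => Real.exp (G k h z)) ≤
      Real.exp (-(s * ε / 2)) := by
    intro k h
    have h1 : ∀ z, Real.exp (G k h z) ≤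
        Real.exp (-(s * ε)) * ((1 + 4 * B ^ 2 * s ^ 2) - s * F k h z) := by
      intro z
      have h2 : |s * F k h z| ≤ s * (2 * B) := by
        rw [abs_mul, abs_of_pos hs0]
        exact mul_le_mul_of_nonneg_left (hFB k h z) hs0.le
      have h3 := exp_neg_le_of_abs_le_one (h2.trans hs1)
      have h4 : (s * F k h z) ^ 2 ≤ (s * (2 * B)) ^ 2 := sq_le_sq' (abs_le.mp h2).1 (abs_le.mp h2).2
      have h5 : Real.exp (G k h z) = Real.exp (-(s * ε)) * Real.exp (-(s * F k h z)) := by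
        rw [← Real.exp_add]
        simp only [G]
        ring_nf
      rw [h5]
      refine mul_le_mul_of_nonneg_left ?_ (Real.exp_pos _).le
      nlinarith
    refine (m.stepMean_mono _ _ _ h1).trans ?_
    rw [m.stepMean_const_mul, m.stepMean_sub, m.stepMean_const, m.stepMean_const_mul]
    have h6 := mul_nonneg hs0.le (hFmean k h)
    have h7 : 1 + 4 * B ^ 2 * s ^ 2 ≤ Real.exp (s * ε / 2) := by
      have := Real.add_one_le_exp (s * ε / 2)
      nlinarith
    calc _ ≤ Real.exp (-(s * ε)) * Real.exp (s * ε / 2) :=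
          mul_le_mul_of_nonneg_left (by linarith) (Real.exp_pos _).le
      _ = Real.exp (-(s * ε / 2)) := by
          rw [← Real.exp_add]
          ring_nf
  have hpath : ∀ n (h : Hist U Y n), h.pathSum G = -(s * (m.llr i j h - d * h.costSum c +
      (f (m.lastObs h) - f m.y₀) + B * h.pathSum (fun k h _ => badStep a ihat i k h) +
      ε * n)) := by
    intro n
    induction n with
    | zero => intro h; simp [ObsModel.llr, Hist.costSum, ObsModel.lastObs]
    | succ n ih =>
      intro h
      rw [← h.snoc_take_last]
      simp only [Hist.costSum, m.llr_snoc, Hist.pathSum_snoc, m.lastObs_snoc] at ih ⊢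
      rw [ih]
      simp only [G, F, X, ObsModel.stepLlr]
      push_cast
      ring
  have hr : s * ε / 2 > 0 := by positivity
  -- One constant for three purposes: the factor of the exponential error, the oscillation of the
  -- corrector, and the price of a bad step.
  set K : ℝ := max (max (1 / s) (2 * |f y₁|)) B with hK
  have hK0 : 0 < K := hB0.trans_le (le_max_right _ _)
  refine ⟨K, Real.exp (-(s * ε / 2)), hK0, Real.exp_pos _, (by rw [← Real.exp_zero]; exact Real.exp_lt_exp.mpr (by linarith)),
    fun n h => 1 / s * Real.exp (h.pathSum G), fun n h => by positivity, fun n => ?_,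
    fun n h => ?_⟩
  · rw [m.expect_const_mul]
    exact mul_le_mul ((le_max_left _ _).trans (le_max_left _ _))
      (m.expect_exp_pathSum_le φ i G (Real.exp_pos _).le hG n)
      (m.expect_nonneg _ _ fun _ => (Real.exp_pos _).le) hK0.le
  · have h1 := Real.add_one_le_exp (h.pathSum G)
    have h2 : 1 / s * h.pathSum G ≤ 1 / s * Real.exp (h.pathSum G) :=
      mul_le_mul_of_nonneg_left (by linarith) (by positivity)
    have h3 : 1 / s * h.pathSum G = -(m.llr i j h - d * h.costSum c +
        (f (m.lastObs h) - f m.y₀) + B * h.pathSum (fun k h _ => badStep a ihat i k h) +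
        ε * n) := by
      rw [hpath]
      field_simp
    have h4 : f (m.lastObs h) - f m.y₀ ≤ K := by
      have h5 := (abs_le.mp (hy₁ (m.lastObs h))).2
      have h6 := (abs_le.mp (hy₁ m.y₀)).1
      have h7 : 2 * |f y₁| ≤ K := (le_max_right _ _).trans (le_max_left _ _)
      linarith
    have h8 : 0 ≤ h.pathSum (fun k h _ => badStep a ihat i k h) :=
      Finset.sum_nonneg fun _ _ => badStep_nonneg _ _ _ _ _
    have h9 := mul_le_mul_of_nonneg_right (le_max_right _ _ : B ≤ K) h8
    linarith

theorem pathSum_hist (F : (k : ℕ) → Hist U Y k → U × Y → ℝ) (n : ℕ) (ω : SamplePath U Y) :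
    (hist n ω).pathSum F = ∑ k ∈ Finset.range n, F k (hist k ω) (ω k) :=
  Fin.sum_univ_eq_sum_range (fun k => F k (hist k ω) (ω k)) n

open Classical in
/-- The bad steps are the explorations, whose number is sublinear, and the steps with a wrong
estimate. -/
theorem exists_pathSum_badStep_le {a : ℝ} (ha : 1 < a) (ihat : (n : ℕ) → Hist U Y n → Fin M)
    (i : Fin M) {ε : ℝ} (hε : 0 < ε) :
    ∃ K : ℝ, 0 ≤ K ∧ ∀ n (ω : SamplePath U Y),
      (hist n ω).pathSum (fun k h _ => badStep a ihat i k h) ≤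
        ε * n + K + ∑ k ∈ Finset.range n, if ihat k (hist k ω) ≠ i then (1 : ℝ) else 0 := by
  obtain ⟨K, hK0, hK⟩ := exists_card_explore_le ha hε
  refine ⟨K, hK0, fun n ω => ?_⟩
  rw [pathSum_hist]
  refine le_trans ?_ (add_le_add_left (hK n) _)
  rw [Finset.card_filter]
  push_cast
  rw [← Finset.sum_add_distrib]
  refine Finset.sum_le_sum fun k _ => ?_
  unfold badStep
  split_ifs <;> first | tauto | norm_num

variable [MeasurableSpace U] [DiscreteMeasurableSpace U] [MeasurableSpace Y]
  [DiscreteMeasurableSpace Y]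

open Classical in
-- If the estimate is some `j ≠ i`, the likelihood ratio of `j` against `i` is at least one, and so
-- is its square root.
theorem ObsModel.IsMLE.lintegral_wrong_le {m : ObsModel M U Y} {φ : Policy U Y}
    {ihat : (n : ℕ) → Hist U Y n → Fin M} (hmle : m.IsMLE φ ihat) (i : Fin M) (n : ℕ) :
    ∫⁻ ω, ENNReal.ofReal (if ihat n (hist n ω) ≠ i then (1 : ℝ) else 0) ∂(m.law φ i) ≤
      ∑ j ∈ Finset.univ.erase i, ENNReal.ofReal (m.histBhatt φ i j n) := by
  rw [← ENNReal.ofReal_sum_of_nonneg fun j _ => m.histBhatt_nonneg φ i j n]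
  rw [m.lintegral_ofReal_hist φ i (f := fun h : Hist U Y n => if ihat n h ≠ i then (1 : ℝ) else 0)
    fun h => by split_ifs <;> simp]
  refine ENNReal.ofReal_le_ofReal ?_
  unfold ObsModel.histBhatt
  rw [← m.expect_sum]
  refine m.expect_mono _ _ fun h hpos => ?_
  have hnn : ∀ j ∈ Finset.univ.erase i, 0 ≤ Real.exp (-m.llr i j h / 2) :=
    fun j _ => (Real.exp_pos _).le
  split_ifs with hi
  · refine le_trans (Real.one_le_exp ?_) (Finset.single_le_sum hnn
      (Finset.mem_erase.mpr ⟨hi, Finset.mem_univ _⟩))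
    have := hmle.llr_nonpos hpos
    linarith
  · exact Finset.sum_nonneg hnn

open Classical in
/-- The expected number of wrong estimates is finite for fine exploration grids. -/
theorem ObsModel.IsPlugInPolicy.tsum_wrong_ne_top [Nonempty U] {m : ObsModel M U Y} {a : ℝ}
    (ha : 1 < a) {ρ : ℝ} (hρ0 : 0 < ρ) (haρ : a * ρ < 1)
    (hρ : ∀ i j, i ≠ j → ∀ (φ : Policy U Y) (n : ℕ),
      (∀ h : Hist U Y (n + 1), φ (n + 1) h = stdSimplex.barycenter) →
      m.histBhatt φ i j (n + 2) ≤ ρ * m.histBhatt φ i j n)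
    {qstar : Fin M → StatPolicy U Y} {φ : Policy U Y} {ihat : (n : ℕ) → Hist U Y n → Fin M}
    (hφ : m.IsPlugInPolicy a qstar φ ihat) (i : Fin M) :
    ∑' n, ∫⁻ ω, ENNReal.ofReal (if ihat n (hist n ω) ≠ i then (1 : ℝ) else 0) ∂(m.law φ i) ≠ ∞ := by
  refine ne_top_of_le_ne_top ?_ (ENNReal.tsum_le_tsum fun n => hφ.1.lintegral_wrong_le i n)
  rw [Summable.tsum_finsetSum fun _ _ => ENNReal.summable]
  refine ENNReal.sum_ne_top.mpr fun j hj => ?_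
  exact tsum_ne_top_of_contract ha hρ0 haρ (m.histBhatt_antitone φ i j) (m.histBhatt_zero φ i j).le
    (hφ.histBhatt_contract (hρ i j (Finset.ne_of_mem_erase hj).symm))

end UpperBound

section CostBound

variable {M : ℕ} {U Y : Type*} [Fintype U] [Fintype Y]
  [MeasurableSpace U] [DiscreteMeasurableSpace U] [MeasurableSpace Y] [DiscreteMeasurableSpace Y]

open Classical in
/-- Pathwise bound on the cost of the proposed test before stopping. -/
theorem ObsModel.exists_pathwise_cost_le [Nonempty U] (hM : 2 ≤ M) (m : ObsModel M U Y)
    {c : U → ℝ} (hc : ∀ u, 0 < c u) (i : Fin M) {qstar : Fin M → StatPolicy U Y}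
    (hq : ∀ q', m.rate c i q' ≤ m.rate c i (qstar i)) {a : ℝ} (ha : 1 < a) {φ : Policy U Y}
    {ihat : (n : ℕ) → Hist U Y n → Fin M} (hφ : m.IsPlugInPolicy a qstar φ ihat)
    (hd : 0 < m.optRate c i) {η : ℝ} (hη : 0 < η) :
    ∃ K : ℝ, 0 ≤ K ∧ ∃ E : (n : ℕ) → Hist U Y n → ℝ, (∀ n h, 0 ≤ E n h) ∧
      ∑' n, ENNReal.ofReal (m.expect φ i (E n)) ≠ ∞ ∧
      ∀ T : ℝ, 0 < T → ∀ (ω : SamplePath U Y) (n : ℕ), 0 < m.jointPmf φ i (hist n ω) →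
        n < m.msprtTime φ ihat T ω →
        (m.optRate c i - η) * ∑ k ∈ Finset.range (n + 1), c (ω k).1 ≤
          max (Real.log T) 0 + K +
            K * (∑ k ∈ Finset.range n, if ihat k (hist k ω) ≠ i then (1 : ℝ) else 0) +
            E n (hist n ω) := by
  set d := m.optRate c i
  obtain ⟨umin, humin⟩ := Finite.exists_min c
  obtain ⟨umax, humax⟩ := Finite.exists_max c
  have hcmin := hc umin
  -- The linear errors of the drift estimate and of the exploration count are each at most `ε * n`.
  -- Since every step costs at least `c umin`, the loss `η` in the rate absorbs both.
  set ε : ℝ := η * c umin / 2 with hε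
  have hε0 : 0 < ε := by positivity
  choose! K r hK hr0 hr1 E hE0 hE hpath using fun j (hj : j ≠ i) =>
    m.exists_cost_le_llr hc hj hq hφ hε0
  set J := Finset.univ.erase i with hJ
  have hJne : ∀ j ∈ J, j ≠ i := fun j hj => Finset.ne_of_mem_erase hj
  set Ks : ℝ := ∑ j ∈ J, K j with hKs
  have hKs0 : 0 ≤ Ks := Finset.sum_nonneg fun j hj => (hK j (hJne j hj)).le
  obtain ⟨K₂, hK₂0, hK₂⟩ := exists_pathSum_badStep_le (U := U) (Y := Y) ha ihat i
    (show 0 < ε / (Ks + 1) by positivity)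
  have hsum0 : ∀ n (h : Hist U Y n), 0 ≤ ∑ j ∈ J, E j n h :=
    fun n h => Finset.sum_nonneg fun j hj => hE0 j (hJne j hj) n h
  -- The middle term pays for control `n + 1`, applied because the test is still running at time
  -- `n`.
  refine ⟨Ks * (1 + K₂) + d * c umax + Ks, ?_, fun n h => ∑ j ∈ J, E j n h, hsum0, ?_, ?_⟩
  · have := (hc umax).le
    positivity
  · simp only [m.expect_sum]
    have h1 : ∀ n, ENNReal.ofReal (∑ j ∈ J, m.expect φ i (E j n)) ≤
        ENNReal.ofReal (∑ j ∈ J, K j * r j ^ n) := fun n =>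
      ENNReal.ofReal_le_ofReal (Finset.sum_le_sum fun j hj => hE j (hJne j hj) n)
    refine ne_top_of_le_ne_top (Summable.tsum_ofReal_ne_top ?_) (ENNReal.tsum_le_tsum h1)
    exact summable_sum fun j hj => (summable_geometric_of_lt_one (hr0 j (hJne j hj)).le
      (hr1 j (hJne j hj))).mul_left _
  · intro T hT ω n hpos hn
    set W : ℝ := ∑ k ∈ Finset.range n, if ihat k (hist k ω) ≠ i then (1 : ℝ) else 0 with hW
    have hW0 : 0 ≤ W := Finset.sum_nonneg fun k _ => by split_ifs <;> simp
    set τ := max (Real.log T) 0 with hτ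
    have hτ0 : 0 ≤ τ := le_max_right _ _
    have hcs : (hist n ω).costSum c = ∑ k ∈ Finset.range n, c (ω k).1 := pathSum_hist _ n ω
    have hmain : (d - η) * ∑ k ∈ Finset.range n, c (ω k).1 ≤
        τ + Ks * (1 + K₂) + Ks * W + ∑ j ∈ J, E j n (hist n ω) := by
      -- Time `0` is separate: the stopping condition is checked only from time `1` on.
      rcases Nat.eq_zero_or_pos n with h0 | h0
      · subst h0
        have := hsum0 0 (hist 0 ω)
        simp only [Finset.range_zero, Finset.sum_empty, mul_zero]
        positivity
      · have hj : ∃ j, j ≠ i ∧ m.llr i j (hist n ω) ≤ τ := by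
          by_contra hcon
          push Not at hcon
          exact ObsModel.not_exceedsThreshold_of_lt h0 hn
            (hφ.1.exceedsThreshold hM hT hpos hcon)
        obtain ⟨j, hji, hj⟩ := hj
        have hjJ : j ∈ J := Finset.mem_erase.mpr ⟨hji, Finset.mem_univ j⟩
        have h1 := hpath j hji n (hist n ω)
        rw [hcs] at h1
        have h2 := hK₂ n ω
        have hKj : K j ≤ Ks :=
          Finset.single_le_sum (fun j hj => (hK j (hJne j hj)).le) hjJ
        have hEj : E j n (hist n ω) ≤ ∑ j ∈ J, E j n (hist n ω) :=
          Finset.single_le_sum (f := fun j => E j n (hist n ω))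
            (fun j hj => hE0 j (hJne j hj) n (hist n ω)) hjJ
        have hb0 : 0 ≤ (hist n ω).pathSum fun k h _ => badStep a ihat i k h :=
          Finset.sum_nonneg fun _ _ => badStep_nonneg _ _ _ _ _
        have h3 : K j * (hist n ω).pathSum (fun k h _ => badStep a ihat i k h) ≤
            Ks * (ε / (Ks + 1) * n + K₂ + W) :=
          (mul_le_mul_of_nonneg_right hKj hb0).trans (mul_le_mul_of_nonneg_left h2 hKs0)
        have h4 : Ks * (ε / (Ks + 1) * n) ≤ ε * n := by
          have h5 : Ks * (ε / (Ks + 1)) ≤ ε := by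
            rw [mul_div_assoc', div_le_iff₀ (by positivity)]
            nlinarith
          rw [← mul_assoc]
          exact mul_le_mul_of_nonneg_right h5 (Nat.cast_nonneg n)
        have h6 : c umin * n ≤ ∑ k ∈ Finset.range n, c (ω k).1 := by
          have := Finset.card_nsmul_le_sum (Finset.range n) (fun k => c (ω k).1) (c umin)
            fun k _ => humin _
          rw [Finset.card_range, nsmul_eq_mul] at this
          linarith
        have h7 : 2 * ε * n ≤ η * ∑ k ∈ Finset.range n, c (ω k).1 := by
          have := mul_le_mul_of_nonneg_left h6 hη.le
          rw [hε]
          linarith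
        linarith
    rw [Finset.sum_range_succ, mul_add]
    have h8 : (d - η) * c (ω n).1 ≤ d * c umax := by
      have h9 := mul_le_mul_of_nonneg_left (humax (ω n).1) hd.le
      have h10 := mul_pos hη (hc (ω n).1)
      linarith
    have h11 : Ks * W ≤ (Ks * (1 + K₂) + d * c umax + Ks) * W := by
      refine mul_le_mul_of_nonneg_right ?_ hW0
      have := mul_nonneg hd.le (hc umax).le
      have : 0 ≤ Ks * (1 + K₂) := by positivity
      linarith
    linarith

/-- The expected cost of the proposed test is at most `log T / d (1 + o(1))`. -/
theorem ObsModel.exists_expectedCost_msprt_le [Nonempty U] (hM : 2 ≤ M) (m : ObsModel M U Y)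
    {c : U → ℝ} (hc : ∀ u, 0 < c u) (i : Fin M) {qstar : Fin M → StatPolicy U Y}
    (hq : ∀ q', m.rate c i q' ≤ m.rate c i (qstar i)) {a : ℝ} (ha : 1 < a) {ρ : ℝ} (hρ0 : 0 < ρ)
    (haρ : a * ρ < 1)
    (hρ : ∀ i j, i ≠ j → ∀ (φ : Policy U Y) (n : ℕ),
      (∀ h : Hist U Y (n + 1), φ (n + 1) h = stdSimplex.barycenter) →
      m.histBhatt φ i j (n + 2) ≤ ρ * m.histBhatt φ i j n)
    {φ : Policy U Y} {ihat : (n : ℕ) → Hist U Y n → Fin M}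
    (hφ : m.IsPlugInPolicy a qstar φ ihat) (hd : 0 < m.optRate c i) {η : ℝ} (hη : 0 < η)
    (hηd : η < m.optRate c i) :
    ∃ K : ℝ, ∀ T : ℝ, 0 < T → (m.msprt φ ihat T).expectedCost m c i ≤
      ENNReal.ofReal ((max (Real.log T) 0 + K) / (m.optRate c i - η)) := by
  classical
  obtain ⟨K, hK0, E, hE0, hE, hpath⟩ := m.exists_pathwise_cost_le hM hc i hq ha hφ hd hη
  set d := m.optRate c i
  have hdη : 0 < d - η := sub_pos.mpr hηd
  have hW := hφ.tsum_wrong_ne_top ha hρ0 haρ hρ i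
  set w : ℕ → SamplePath U Y → ℝ≥0∞ := fun n ω =>
    ENNReal.ofReal (if ihat n (hist n ω) ≠ i then (1 : ℝ) else 0) with hw
  have hwm : ∀ n, Measurable (w n) := fun n =>
    measurable_comp_hist fun h : Hist U Y n =>
      ENNReal.ofReal (if ihat n h ≠ i then (1 : ℝ) else 0)
  have hEm : ∀ n, Measurable fun ω : SamplePath U Y => ENNReal.ofReal (E n (hist n ω)) := fun n =>
    measurable_comp_hist fun h : Hist U Y n => ENNReal.ofReal (E n h)
  -- The error at the random stopping time is dominated by the sum of the errors over all times,
  -- whose mean is finite and independent of `T`.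
  set S : ℝ≥0∞ := ENNReal.ofReal K * (∑' n, ∫⁻ ω, w n ω ∂(m.law φ i)) +
    ∑' n, ENNReal.ofReal (m.expect φ i (E n)) with hS
  have hS_ne : S ≠ ∞ := ENNReal.add_ne_top.mpr ⟨ENNReal.mul_ne_top ENNReal.ofReal_ne_top hW, hE⟩
  refine ⟨K + S.toReal, fun T hT => ?_⟩
  set τ := max (Real.log T) 0 with hτ
  have hτ0 : 0 ≤ τ := le_max_right _ _
  rw [ENNReal.ofReal_div_of_pos hdη, ENNReal.le_div_iff_mul_le
    (Or.inl (ENNReal.ofReal_pos.mpr hdη).ne') (Or.inl ENNReal.ofReal_ne_top)]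
  have hrhs : ENNReal.ofReal (τ + (K + S.toReal)) = ENNReal.ofReal (τ + K) + S := by
    rw [← add_assoc, ENNReal.ofReal_add (by positivity) ENNReal.toReal_nonneg,
      ENNReal.ofReal_toReal hS_ne]
  have hint : ∫⁻ ω, (ENNReal.ofReal (τ + K) + (ENNReal.ofReal K * ∑' n, w n ω +
      ∑' n, ENNReal.ofReal (E n (hist n ω)))) ∂(m.law φ i) = ENNReal.ofReal (τ + K) + S := by
    rw [lintegral_add_left measurable_const, lintegral_const, measure_univ, mul_one,
      lintegral_add_left ((Measurable.tsum hwm).const_mul _),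
      lintegral_const_mul _ (Measurable.tsum hwm),
      lintegral_tsum fun n => (hwm n).aemeasurable, lintegral_tsum fun n => (hEm n).aemeasurable]
    simp only [m.lintegral_ofReal_hist φ i (hE0 _), hS]
  rw [hrhs, ← hint, mul_comm]
  unfold SeqTest.expectedCost
  rw [← lintegral_const_mul _ (Measurable.tsum fun k =>
    (m.msprt φ ihat T).measurable_cost_term c k)]
  refine lintegral_mono_ae ?_
  filter_upwards [m.ae_jointPmf_pos φ i] with ω hω
  rw [← ENNReal.tsum_mul_left, ENNReal.tsum_eq_iSup_nat]
  refine iSup_le fun n => ?_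
  -- Partial sums are constant beyond the stopping time, so the pathwise bound is needed only while
  -- the test is running.
  induction n with
  | zero => simp
  | succ n ih =>
    by_cases hn : ((n + 1 : ℕ) : ℕ∞) ≤ (m.msprt φ ihat T).N ω
    · have h1 : ∑ k ∈ Finset.range (n + 1), ENNReal.ofReal (d - η) *
          (if ((k + 1 : ℕ) : ℕ∞) ≤ (m.msprt φ ihat T).N ω then ENNReal.ofReal (c (ω k).1) else 0) =
          ENNReal.ofReal ((d - η) * ∑ k ∈ Finset.range (n + 1), c (ω k).1) := by
        rw [ENNReal.ofReal_mul hdη.le, ENNReal.ofReal_sum_of_nonneg fun k _ => (hc _).le,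
          Finset.mul_sum]
        refine Finset.sum_congr rfl fun k hk => ?_
        rw [if_pos]
        refine le_trans ?_ hn
        exact_mod_cast Nat.succ_le_of_lt (Finset.mem_range.mp hk)
      rw [h1]
      refine (ENNReal.ofReal_le_ofReal
        (hpath T hT ω n (hω n) ((natCast_succ_le_iff n _).mp hn))).trans ?_
      have hW0 : 0 ≤ ∑ k ∈ Finset.range n, if ihat k (hist k ω) ≠ i then (1 : ℝ) else 0 :=
        Finset.sum_nonneg fun k _ => by split_ifs <;> simp
      rw [ENNReal.ofReal_add (by positivity) (hE0 _ _),
        ENNReal.ofReal_add (by positivity) (by positivity), ENNReal.ofReal_mul hK0,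
        ENNReal.ofReal_sum_of_nonneg fun k _ => by split_ifs <;> simp, add_assoc]
      gcongr
      · exact ENNReal.sum_le_tsum (f := fun n => w n ω) _
      · exact ENNReal.le_tsum (f := fun n => ENNReal.ofReal (E n (hist n ω))) n
    · rw [Finset.sum_range_succ, if_neg hn, mul_zero, add_zero]
      exact ih

theorem SeqTest.law_real_top_eq_zero [Nonempty U] (γ : SeqTest M U Y) (m : ObsModel M U Y)
    {c : U → ℝ} (hc : ∀ u, 0 < c u) {i : Fin M} (h : γ.expectedCost m c i ≠ ∞) :
    (m.law γ.policy i).real {ω | γ.N ω = ⊤} = 0 := by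
  rw [measureReal_eq_zero_iff]
  have h1 := ae_lt_top (Measurable.tsum fun k => γ.measurable_cost_term c k) h
  refine measure_mono_null ?_ (ae_iff.mp h1)
  intro ω hω
  obtain ⟨umin, humin⟩ := Finite.exists_min c
  change ¬ _ < ∞
  rw [not_lt_top_iff]
  rw [Set.mem_ofPred_eq] at hω
  simp only [hω, le_top, if_true]
  refine top_unique ?_
  rw [← ENNReal.tsum_const_eq_top_of_ne_zero (α := ℕ) (ENNReal.ofReal_pos.mpr (hc umin)).ne']
  exact ENNReal.tsum_le_tsum fun k => ENNReal.ofReal_le_ofReal (humin _)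

/-- Risks do not see paths that never stop; finite expected cost excludes them, since every step
costs at least a fixed positive amount. -/
theorem SeqTest.errorProb_le_sum_risk [Nonempty U] (γ : SeqTest M U Y) (m : ObsModel M U Y)
    {c : U → ℝ} (hc : ∀ u, 0 < c u) {i : Fin M} (h : γ.expectedCost m c i ≠ ∞) :
    γ.errorProb m i ≤ ∑ j ∈ Finset.univ.erase i, γ.risk m j := by
  refine (γ.errorProb_le_sum m i).trans ?_
  rw [γ.law_real_top_eq_zero m hc h, add_zero]
  exact Finset.sum_le_sum fun j hj =>
    γ.law_real_decides_le_risk m (Finset.ne_of_mem_erase hj).symm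

end CostBound

/-! ### Asymptotics -/

section Asymptotic

theorem isEquivalent_of_tendsto_div_log {f g : ℝ → ℝ} {b : ℝ} (hb : b ≠ 0)
    (hf : Tendsto (fun T => f T / Real.log T) atTop (𝓝 b))
    (hg : Tendsto (fun T => g T / Real.log T) atTop (𝓝 b)) :
    Asymptotics.IsEquivalent atTop f g := by
  have key : ∀ {f : ℝ → ℝ}, Tendsto (fun T => f T / Real.log T) atTop (𝓝 b) →
      Asymptotics.IsEquivalent atTop f fun T => b * Real.log T := by
    intro f hf
    rw [Asymptotics.isEquivalent_iff_tendsto_one]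
    · have h1 := hf.div_const b
      rw [div_self hb] at h1
      refine h1.congr fun T => ?_
      simp only [Pi.div_apply]
      rw [div_div, mul_comm]
    · filter_upwards [Real.tendsto_log_atTop.eventually_gt_atTop 0] with T hT
      exact mul_ne_zero hb hT.ne'
  exact (key hf).trans (key hg).symm

theorem tendsto_const_div_log (A : ℝ) : Tendsto (fun T : ℝ => A / Real.log T) atTop (𝓝 0) :=
  Real.tendsto_log_atTop.const_div_atTop A

theorem tendsto_lower_div_log (κ A C d : ℝ) :
    Tendsto (fun T : ℝ => ((Real.log T - κ) * (1 - A / T) - C) / d / Real.log T) atTop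
      (𝓝 (1 / d)) := by
  have h1 : Tendsto (fun T : ℝ => ((1 - κ / Real.log T) * (1 - A / T) - C / Real.log T) / d) atTop
      (𝓝 (((1 - 0) * (1 - 0) - 0) / d)) :=
    ((((tendsto_const_div_log κ).const_sub 1).mul
      ((tendsto_id.const_div_atTop A).const_sub 1)).sub (tendsto_const_div_log C)).div_const d
  simp only [sub_zero, mul_one] at h1
  refine h1.congr' ?_
  filter_upwards [Real.tendsto_log_atTop.eventually_gt_atTop 0] with T hT
  field_simp

theorem tendsto_div_log_of_bounds {f g : ℝ → ℝ} {b : ℝ}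
    (hg : Tendsto (fun T => g T / Real.log T) atTop (𝓝 b))
    (hgf : ∀ᶠ T in atTop, g T ≤ f T)
    (hf : ∀ b', b < b' → ∀ᶠ T in atTop, f T / Real.log T < b') :
    Tendsto (fun T => f T / Real.log T) atTop (𝓝 b) := by
  refine tendsto_order.mpr ⟨fun b' hb' => ?_, hf⟩
  filter_upwards [hg.eventually_const_lt hb', hgf,
    Real.tendsto_log_atTop.eventually_gt_atTop 0] with T h1 h2 h3
  exact h1.trans_le (div_le_div_of_nonneg_right h2 h3.le)

end Asymptotic

/-! ### Matching upper and lower bounds -/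

section Optimality

variable {M : ℕ} {U Y : Type*} [Fintype U] [Fintype Y]
  [MeasurableSpace U] [DiscreteMeasurableSpace U] [MeasurableSpace Y] [DiscreteMeasurableSpace Y]

/-- Asymptotic optimality of the proposed test. -/
theorem ObsModel.IsPlugInPolicy.asymptotic_optimality [Nonempty U] (hM : 2 ≤ M)
    {m : ObsModel M U Y} (hdist : ∀ i j, i ≠ j → ∃ u y' y, m.p i u y' y ≠ m.p j u y' y)
    {c : U → ℝ} (hc : ∀ u, 0 < c u) {qstar : Fin M → StatPolicy U Y}
    (hq : ∀ i q', m.rate c i q' ≤ m.rate c i (qstar i)) {a : ℝ} (ha : 1 < a) {ρ : ℝ} (hρ0 : 0 < ρ)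
    (haρ : a * ρ < 1)
    (hρ : ∀ i j, i ≠ j → ∀ (φ : Policy U Y) (n : ℕ),
      (∀ h : Hist U Y (n + 1), φ (n + 1) h = stdSimplex.barycenter) →
      m.histBhatt φ i j (n + 2) ≤ ρ * m.histBhatt φ i j n)
    {φ : Policy U Y} {ihat : (n : ℕ) → Hist U Y n → Fin M}
    (hφ : m.IsPlugInPolicy a qstar φ ihat) (i : Fin M) :
    (∀ T : ℝ, 0 < T → (m.msprt φ ihat T).expectedCost m c i ≠ ∞) ∧
        Asymptotics.IsEquivalent atTop
          (fun T : ℝ => ((m.msprt φ ihat T).expectedCost m c i).toReal)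
          (fun T : ℝ => -Real.log ((m.msprt φ ihat T).maxError m) / m.optRate c i) ∧
        Asymptotics.IsEquivalent atTop
          (fun T : ℝ => ((m.msprt φ ihat T).expectedCost m c i).toReal)
          (fun T : ℝ => (infCostOfMaxError m c i ((m.msprt φ ihat T).maxError m)).toReal) ∧
        Asymptotics.IsEquivalent atTop
          (fun T : ℝ => ((m.msprt φ ihat T).expectedCost m c i).toReal)
          (fun T : ℝ => -Real.log ((m.msprt φ ihat T).risk m i) / m.optRate c i) ∧
        Asymptotics.IsEquivalent atTop
          (fun T : ℝ => ((m.msprt φ ihat T).expectedCost m c i).toReal)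
          (fun T : ℝ => (infCostOfRisks m c i fun j => (m.msprt φ ihat T).risk m j).toReal) := by
  have hd := m.optRate_pos hM hdist hc i
  set d := m.optRate c i with hddef
  obtain ⟨C, hC0, hconv⟩ := m.exists_converse hM hdist hc i
  have hupper := fun {η : ℝ} (hη : 0 < η) (hηd : η < d) =>
    m.exists_expectedCost_msprt_le hM hc i (hq i) ha hρ0 haρ hρ hφ hd hη hηd
  have hfin : ∀ T : ℝ, 0 < T → (m.msprt φ ihat T).expectedCost m c i ≠ ∞ := by
    intro T hT
    obtain ⟨K, hK⟩ := hupper (half_pos hd) (half_lt_self hd)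
    exact ne_top_of_le_ne_top ENNReal.ofReal_ne_top (hK T hT)
  set cost : ℝ → ℝ := fun T => ((m.msprt φ ihat T).expectedCost m c i).toReal with hcost
  have hM1 : (1 : ℝ) ≤ M - 1 := by
    have : (2 : ℝ) ≤ M := by exact_mod_cast hM
    linarith
  have hM0 : (0 : ℝ) < M - 1 := by linarith
  set κ : ℝ := Real.log (M - 1 : ℝ) with hκ
  set A : ℝ := (M - 1 : ℝ) * (M - 1 : ℝ) with hA
  have hAM : (M - 1 : ℝ) ≤ A := by nlinarith
  set lo : ℝ → ℝ := fun T => ((Real.log T - κ) * (1 - A / T) - C) / d with hlo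
  have hlolim : Tendsto (fun T => lo T / Real.log T) atTop (𝓝 (1 / d)) :=
    tendsto_lower_div_log κ A C d
  have hmax : ∀ T : ℝ, 0 < T → (m.msprt φ ihat T).maxError m ≤ (M - 1 : ℝ) / T :=
    fun T hT => hφ.maxError_msprt_le hM hdist ha hT
  have hrisk : ∀ T : ℝ, 0 < T → ∀ j, (m.msprt φ ihat T).risk m j ≤ (M - 1 : ℝ) / T :=
    fun T hT j => ((m.msprt φ ihat T).risk_le_maxError hM m j).trans (hmax T hT)
  have hexp : ∀ {T R : ℝ}, 0 < T → R ≤ (M - 1 : ℝ) / T → Real.exp (Real.log T - κ) * R ≤ 1 := by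
    intro T R hT hR
    rw [Real.exp_sub, Real.exp_log hT, hκ, Real.exp_log hM0]
    calc T / (M - 1 : ℝ) * R ≤ T / (M - 1 : ℝ) * ((M - 1 : ℝ) / T) :=
          mul_le_mul_of_nonneg_left hR (by positivity)
      _ = 1 := by field_simp
  -- lower bound for all tests with small risks
  have hlower : ∀ T : ℝ, (M - 1 : ℝ) ≤ T → ∀ γ : SeqTest M U Y,
      (∀ j, γ.risk m j ≤ (m.msprt φ ihat T).risk m j) →
      ENNReal.ofReal (lo T) ≤ γ.expectedCost m c i := by
    intro T hT γ hγ
    have hT0 : 0 < T := by linarith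
    -- Bounding the error probability by risks requires finite cost; otherwise the claim is trivial.
    rcases eq_or_ne (γ.expectedCost m c i) ∞ with htop | htop
    · rw [htop]
      exact le_top
    have hγ' : ∀ j, γ.risk m j ≤ (M - 1 : ℝ) / T := fun j => (hγ j).trans (hrisk T hT0 j)
    refine le_trans (ENNReal.ofReal_le_ofReal ?_)
      (hconv γ (Real.log T - κ) (hexp hT0 (hγ' i)))
    have herr : γ.errorProb m i ≤ A / T := by
      refine (γ.errorProb_le_sum_risk m hc htop).trans ?_
      refine (Finset.sum_le_sum fun j _ => hγ' j).trans (le_of_eq ?_)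
      rw [Finset.sum_const, Finset.card_erase_of_mem (Finset.mem_univ i), Finset.card_univ,
        Fintype.card_fin, nsmul_eq_mul, Nat.cast_sub (by omega), hA]
      push_cast
      ring
    have hx : 0 ≤ Real.log T - κ := sub_nonneg.mpr (Real.log_le_log hM0 hT)
    simp only [hlo]
    refine div_le_div_of_nonneg_right ?_ hd.le
    have := mul_le_mul_of_nonneg_left herr hx
    linarith
  have hlower' : ∀ T : ℝ, (M - 1 : ℝ) ≤ T → ∀ γ : SeqTest M U Y,
      γ.maxError m ≤ (m.msprt φ ihat T).maxError m →
      ENNReal.ofReal (lo T) ≤ γ.expectedCost m c i := by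
    intro T hT γ hγ
    have hT0 : 0 < T := by linarith
    have hγ' := hγ.trans (hmax T hT0)
    refine le_trans (ENNReal.ofReal_le_ofReal ?_)
      (hconv γ (Real.log T - κ) (hexp hT0 ((γ.risk_le_maxError hM m i).trans hγ')))
    have herr : γ.errorProb m i ≤ A / T := (γ.errorProb_le_maxError m i).trans
      (hγ'.trans (div_le_div_of_nonneg_right hAM hT0.le))
    have hx : 0 ≤ Real.log T - κ := sub_nonneg.mpr (Real.log_le_log hM0 hT)
    simp only [hlo]
    refine div_le_div_of_nonneg_right ?_ hd.le
    have := mul_le_mul_of_nonneg_left herr hx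
    linarith
  -- the limits of all quantities divided by `log T`
  have hlogpos : ∀ᶠ T : ℝ in atTop, 0 < Real.log T :=
    Real.tendsto_log_atTop.eventually_gt_atTop 0
  have hcostlim : Tendsto (fun T => cost T / Real.log T) atTop (𝓝 (1 / d)) := by
    refine tendsto_div_log_of_bounds hlolim ?_ fun b hb => ?_
    · filter_upwards [eventually_ge_atTop (M - 1 : ℝ)] with T hT
      exact (ENNReal.ofReal_le_iff_le_toReal (hfin T (by linarith))).mp
        (hlower T hT _ fun j => le_rfl)
    · have hb0 : 0 < b := (one_div_pos.mpr hd).trans hb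
      have hbd : 1 / b < d := by
        rw [div_lt_iff₀ hb0]
        rwa [div_lt_iff₀ hd, mul_comm] at hb
      -- Chosen so that `1 / (d - η) < b`.
      obtain ⟨η, hη0, hη⟩ := exists_between (sub_pos.mpr hbd)
      have hb1 : 0 < 1 / b := one_div_pos.mpr hb0
      have hdη : 0 < d - η := by linarith
      obtain ⟨K, hK⟩ := hupper hη0 (by linarith)
      have hlim : Tendsto (fun T : ℝ => (1 + K / Real.log T) / (d - η)) atTop
          (𝓝 ((1 + 0) / (d - η))) := ((tendsto_const_div_log K).const_add 1).div_const _
      have hlt : (1 + 0) / (d - η) < b := by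
        rw [add_zero, div_lt_iff₀ hdη]
        have h1 : 1 / b < d - η := by linarith
        rwa [div_lt_iff₀ hb0, mul_comm] at h1
      filter_upwards [hlim.eventually_lt_const hlt, hlogpos, eventually_gt_atTop 0,
        Real.tendsto_log_atTop.eventually_ge_atTop (-K)] with T h1 h2 h3 h4
      refine lt_of_le_of_lt ?_ h1
      have h5 := hK T h3
      rw [max_eq_left h2.le] at h5
      have h6 : cost T ≤ (Real.log T + K) / (d - η) :=
        ENNReal.toReal_le_of_le_ofReal (div_nonneg (by linarith) hdη.le) h5
      calc cost T / Real.log T ≤ (Real.log T + K) / (d - η) / Real.log T :=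
            div_le_div_of_nonneg_right h6 h2.le
        _ = (1 + K / Real.log T) / (d - η) := by field_simp
  have hpos : ∀ᶠ T : ℝ in atTop, 0 < (m.msprt φ ihat T).risk m i := by
    filter_upwards [eventually_gt_atTop (M - 1 : ℝ)] with T hT
    have hT0 : 0 < T := hM0.trans hT
    refine (m.msprt φ ihat T).risk_pos hM m ?_
    refine ((m.msprt φ ihat T).errorProb_le_maxError m i).trans_lt ((hmax T hT0).trans_lt ?_)
    rwa [div_lt_one hT0]
  have hRP : ∀ᶠ T : ℝ in atTop, -Real.log ((m.msprt φ ihat T).maxError m) / d ≤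
      -Real.log ((m.msprt φ ihat T).risk m i) / d := by
    filter_upwards [hpos] with T hT
    refine div_le_div_of_nonneg_right (neg_le_neg ?_) hd.le
    exact Real.log_le_log hT ((m.msprt φ ihat T).risk_le_maxError hM m i)
  have hPlo : ∀ᶠ T : ℝ in atTop,
      ((Real.log T - κ) * (1 - 0 / T) - 0) / d ≤
        -Real.log ((m.msprt φ ihat T).maxError m) / d := by
    filter_upwards [hpos, eventually_gt_atTop 0] with T hT hT0
    refine div_le_div_of_nonneg_right ?_ hd.le
    have h1 := Real.log_le_log (hT.trans_le ((m.msprt φ ihat T).risk_le_maxError hM m i))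
      (hmax T hT0)
    rw [Real.log_div hM0.ne' hT0.ne'] at h1
    simp only [zero_div, sub_zero, mul_one]
    linarith
  -- The converse is applied to the proposed test itself: its known cost bounds how small its risk
  -- can be.
  have hRup : ∀ b, 1 / d < b → ∀ᶠ T : ℝ in atTop,
      -Real.log ((m.msprt φ ihat T).risk m i) / d / Real.log T < b := by
    intro b hb
    have hlim : Tendsto (fun T : ℝ => (cost T / Real.log T + C / d / Real.log T) / (1 - A / T))
        atTop (𝓝 ((1 / d + 0) / (1 - 0))) :=
      (hcostlim.add (tendsto_const_div_log (C / d))).div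
        ((tendsto_id.const_div_atTop A).const_sub 1) (by norm_num)
    rw [add_zero, sub_zero, div_one] at hlim
    filter_upwards [hlim.eventually_lt_const hb, hpos, hlogpos, eventually_gt_atTop A,
      eventually_gt_atTop (M - 1 : ℝ)] with T h1 h2 h3 h4 h4'
    have hT0 : 0 < T := by linarith
    refine lt_of_le_of_lt ?_ h1
    have h5 : 0 < 1 - A / T := by rw [sub_pos, div_lt_one hT0]; exact h4
    set x := -Real.log ((m.msprt φ ihat T).risk m i) with hx
    have h6 := hconv (m.msprt φ ihat T) x (by
      rw [hx, Real.exp_neg, Real.exp_log h2, inv_mul_cancel₀ h2.ne'])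
    rw [ENNReal.ofReal_le_iff_le_toReal (hfin T hT0)] at h6
    have herr : (m.msprt φ ihat T).errorProb m i ≤ A / T :=
      ((m.msprt φ ihat T).errorProb_le_maxError m i).trans
        ((hmax T hT0).trans (div_le_div_of_nonneg_right hAM hT0.le))
    have hx0 : 0 ≤ x := by
      rw [hx, neg_nonneg]
      refine Real.log_nonpos h2.le ((hrisk T hT0 i).trans ?_)
      rw [div_le_one hT0]
      exact h4'.le
    have h7 : x / d * (1 - A / T) ≤ cost T + C / d := by
      have h8 : (x * (1 - A / T) - C) / d ≤ cost T := by
        refine le_trans (div_le_div_of_nonneg_right ?_ hd.le) h6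
        have := mul_le_mul_of_nonneg_left herr hx0
        linarith
      rw [sub_div] at h8
      have h9 : x / d * (1 - A / T) = x * (1 - A / T) / d := by ring
      linarith
    rw [le_div_iff₀ h5, ← add_div, div_mul_eq_mul_div]
    exact div_le_div_of_nonneg_right h7 h3.le
  have hPlim : Tendsto (fun T => -Real.log ((m.msprt φ ihat T).maxError m) / d / Real.log T)
      atTop (𝓝 (1 / d)) := by
    refine tendsto_div_log_of_bounds (tendsto_lower_div_log κ 0 0 d) hPlo fun b hb => ?_
    filter_upwards [hRup b hb, hRP, hlogpos] with T h1 h2 h3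
    exact (div_le_div_of_nonneg_right h2 h3.le).trans_lt h1
  have hRlim : Tendsto (fun T => -Real.log ((m.msprt φ ihat T).risk m i) / d / Real.log T)
      atTop (𝓝 (1 / d)) :=
    tendsto_div_log_of_bounds (tendsto_lower_div_log κ 0 0 d)
      (by filter_upwards [hPlo, hRP] with T h1 h2 using h1.trans h2) hRup
  -- Both infima lie between the universal lower bound and the cost of the proposed test, which
  -- satisfies its own constraints.
  have hinf : ∀ I : ℝ → ℝ≥0∞, (∀ T, I T ≤ (m.msprt φ ihat T).expectedCost m c i) →
      (∀ T : ℝ, (M - 1 : ℝ) ≤ T → ENNReal.ofReal (lo T) ≤ I T) →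
      Tendsto (fun T => (I T).toReal / Real.log T) atTop (𝓝 (1 / d)) := by
    intro I hI1 hI2
    refine tendsto_div_log_of_bounds hlolim ?_ fun b hb => ?_
    · filter_upwards [eventually_ge_atTop (M - 1 : ℝ)] with T hT
      exact (ENNReal.ofReal_le_iff_le_toReal
        (ne_top_of_le_ne_top (hfin T (by linarith)) (hI1 T))).mp (hI2 T hT)
    · filter_upwards [hcostlim.eventually_lt_const hb, hlogpos, eventually_gt_atTop 0]
        with T h1 h2 h3
      exact (div_le_div_of_nonneg_right (ENNReal.toReal_mono (hfin T h3) (hI1 T)) h2.le).trans_lt h1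
  have hb : 1 / d ≠ 0 := (one_div_pos.mpr hd).ne'
  refine ⟨hfin, isEquivalent_of_tendsto_div_log hb hcostlim hPlim,
    isEquivalent_of_tendsto_div_log hb hcostlim (hinf _ (fun T => ?_) fun T hT => ?_),
    isEquivalent_of_tendsto_div_log hb hcostlim hRlim,
    isEquivalent_of_tendsto_div_log hb hcostlim (hinf _ (fun T => ?_) fun T hT => ?_)⟩
  · exact iInf₂_le_of_le (m.msprt φ ihat T) (le_refl ((m.msprt φ ihat T).maxError m)) le_rfl
  · exact le_iInf₂ fun γ hγ => hlower' T hT γ hγ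
  · exact iInf₂_le_of_le (m.msprt φ ihat T) (fun j => le_refl ((m.msprt φ ihat T).risk m j)) le_rfl
  · exact le_iInf₂ fun γ hγ => hlower T hT γ hγ

end Optimality

end ControlledSensing

theorem mainTheorem1 {M : ℕ} (hM : 2 ≤ M) {U Y : Type*}
    [Fintype U] [Nonempty U] [MeasurableSpace U] [DiscreteMeasurableSpace U]
    [Fintype Y] [MeasurableSpace Y] [DiscreteMeasurableSpace Y]
    (m : ObsModel M U Y)
    (hdist : ∀ i j, i ≠ j → ∃ u y' y, m.p i u y' y ≠ m.p j u y' y)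
    (c : U → ℝ) (hc : ∀ u, 0 < c u) :
    (∀ i, 0 < m.optRate c i ∧ ∃ q, m.rate c i q = m.optRate c i ∧
      ∀ q', m.rate c i q' ≤ m.rate c i q) ∧
    (∀ γ : ℕ → SeqTest M U Y, Tendsto (fun n => (γ n).maxError m) atTop (𝓝 0) →
      ∀ i, ∃ ε : ℕ → ℝ, Tendsto ε atTop (𝓝 0) ∧ ∀ᶠ n in atTop,
        0 < (γ n).risk m i ∧
        ENNReal.ofReal (-Real.log ((γ n).risk m i) / m.optRate c i * (1 + ε n)) ≤
          (γ n).expectedCost m c i ∧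
        -Real.log ((γ n).maxError m) / m.optRate c i * (1 + ε n) ≤
          -Real.log ((γ n).risk m i) / m.optRate c i * (1 + ε n)) ∧
    (∀ qstar : Fin M → StatPolicy U Y, (∀ i q, m.rate c i q ≤ m.rate c i (qstar i)) →
      ∀ a : ℝ, 1 < a → ∀ φ ihat, m.IsPlugInPolicy a qstar φ ihat →
        ∀ T : ℝ, 0 < T → (m.msprt φ ihat T).maxError m ≤ (M - 1 : ℝ) / T) ∧
    (∃ a₀ : ℝ, 1 < a₀ ∧ ∀ qstar : Fin M → StatPolicy U Y,
      (∀ i q, m.rate c i q ≤ m.rate c i (qstar i)) →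
      ∀ a : ℝ, 1 < a → a < a₀ → ∀ φ ihat, m.IsPlugInPolicy a qstar φ ihat → ∀ i,
        (∀ T : ℝ, 0 < T → (m.msprt φ ihat T).expectedCost m c i ≠ ∞) ∧
        Asymptotics.IsEquivalent atTop
          (fun T : ℝ => ((m.msprt φ ihat T).expectedCost m c i).toReal)
          (fun T : ℝ => -Real.log ((m.msprt φ ihat T).maxError m) / m.optRate c i) ∧
        Asymptotics.IsEquivalent atTop
          (fun T : ℝ => ((m.msprt φ ihat T).expectedCost m c i).toReal)
          (fun T : ℝ => (infCostOfMaxError m c i ((m.msprt φ ihat T).maxError m)).toReal) ∧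
        Asymptotics.IsEquivalent atTop
          (fun T : ℝ => ((m.msprt φ ihat T).expectedCost m c i).toReal)
          (fun T : ℝ => -Real.log ((m.msprt φ ihat T).risk m i) / m.optRate c i) ∧
        Asymptotics.IsEquivalent atTop
          (fun T : ℝ => ((m.msprt φ ihat T).expectedCost m c i).toReal)
          (fun T : ℝ => (infCostOfRisks m c i fun j => (m.msprt φ ihat T).risk m j).toReal)) := by
  refine ⟨fun i => ⟨m.optRate_pos hM hdist hc i, ?_⟩,
    fun γ hγ i => m.exists_asymptotic_converse hM hdist hc γ hγ i,
    fun qstar _ a ha φ ihat hφ T hT => hφ.maxError_msprt_le hM hdist ha hT, ?_⟩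
  · obtain ⟨q, hq⟩ := m.exists_isMax_rate hM hc i
    exact ⟨q, (m.optRate_eq_of_isMax hq).symm, hq⟩
  · obtain ⟨ρ, hρ0, hρ1, hρ⟩ := m.exists_histBhatt_contract hdist
    -- This choice of `a₀` is the summability condition `a * ρ < 1`; `ρ` comes from the model alone.
    refine ⟨1 / ρ, one_lt_one_div hρ0 hρ1, fun qstar hq a ha haρ φ ihat hφ i => ?_⟩
    rw [lt_div_iff₀ hρ0] at haρ
    exact hφ.asymptotic_optimality hM hdist hc hq ha hρ0 haρ hρ i
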